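/- **Setting.** Let $d\ge 1$ and write $\widehat f(\xi)=(2\pi)^{-r/2}\int_{\mathbb R^r} f(x)e^{-i\xi\cdot x}\,dx$ for the Fourier transform on $\mathbb R^r$. Let $\mathcal S_{l}(\mathbb R)$ be the set of Schwartz functions $h$ with $h(\xi)=O(|\xi|^{l})$ as $\xi\to0$. A measurable $\widehat t\in L^2_{\rm loc}(\mathbb R\setminus\{0\})$ is a *generalised Fourier transform* of a continuous $t:\mathbb R\to\mathbb R$ of polynomial growth, *of order* $l\in\mathbb N_0$, if $\int \widehat t\,h=\int t\,\widehat h$ for all $h\in\mathcal S_{2l}(\mathbb R)$. $C_1^*(\mathbb R)$ is the set of continuous $t$ with $\sup_x|t(x)|/(1+|x|)<\infty$ that admit a generalised Fourier transform of some order (e.g. ReLU). *Activation.* $\phi\in C_1^*(\mathbb R)$ is Lipschitz with generalised Fourier transform $\widehat\phi$, and $\psi\in\mathcal S(\mathbb R)$ is real-valued with $(2\pi)^{d/2}\int_{\mathbb R}|\xi|^{-d}\,\overline{\widehat\psi(\xi)}\,\widehat\phi(\xi)\,d\xi=1$ and $\int_{\mathbb R}|\xi|^{-d-2}\,|\overline{\widehat\psi(\xi)}\,\widehat\phi(\xi)|\,d\xi<\infty$.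 Moreover there is an $l\in\mathbb N_0$ such that $\widehat\phi$ is a generalised Fourier transform of $\phi$ of order $l$ and $\widehat\psi\in\mathcal S_{2l}(\mathbb R)$. *Bandwidths.* $p_{w}:\mathbb R^d\to[0,\infty)$ and $p_b:\mathbb R\to[0,\infty)$ are probability densities, each of them even, bounded, with finite second moment and with $\widehat p$ strictly positive and integrable; in addition $\int\|\xi\|^2\widehat{p_{w}}(\xi)\,d\xi<\infty$ and $p_b$ is differentiable with bounded derivative. For $\sigma_w,\sigma_b>0$ put $p_{w,\sigma}(w)=\sigma_w^{-d}p_w(w/\sigma_w)$, $p_{b,\sigma}(b)=\sigma_b^{-1}p_b(b/\sigma_b)$ and $Z=(2\pi)^{1/2}\sigma_w^d\sigma_b/(\|\widehat{p_w}\|_{L^1}\|\widehat{p_b}\|_{L^1})$. *Cubature.* Let $S>0$, let $\mathcal X$ be a compact subset of the interior of $[-S,S]^d$, and let $\chi\in C^\infty(\mathbb R^d)$ be $[0,1]$-valued with $\chi=1$ on $\mathcal X$ and $\chi=0$ outside $[-S,S]^d$. For $D=n^d$ ($n\ge1$) let $(x_j)_{j=1}^D$ be the grid $\{-S+2Sr/n: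 r=0,\dots,n-1\}^d$, and $u_j=(2S)^dD^{-1}\chi(x_j)$. For $N\ge1$ let $(w_i,b_i)_{i=1}^N$ be i.i.d. with density $p_{w,\sigma}\times p_{b,\sigma}$, and put $$I_{\sigma,D,N}f(x)=\sum_{i=1}^N\frac ZN\Big(\sum_{j=1}^D u_j f(x_j)\,\psi(w_i\cdot x_j+b_i)\Big)\phi(w_i\cdot x+b_i).$$ *Gaussian process.* A function $h(x,y)$ on $\mathbb R^d\times\mathbb R^d$ is of class $C^{1\times1}$ if $\partial_x^\alpha\partial_y^\beta h$ exists and is continuous for all multi-indices with $|\alpha|,|\beta|\le1$; then $M_1^*(h)=\max_{|\alpha|,|\beta|\le1}\sup_{x,y\in[-S,S]^d}|\partial_x^\alpha\partial_y^\beta h(x,y)|$. Let $f\sim\mathcal{GP}(m,k)$ with $m\in C^1(\mathbb R^d)$ and $k\in C^{1\times1}$ symmetric and (strictly) positive definite. Assume that $f$ is a random variable with values in the reproducing kernel Hilbert space $\mathcal H_R$ of a kernel $R\in C^{1\times1}$, that $f$ is independent of $(w_i,b_i)_{i\le N}$, that $m\in\mathcal H_R$, and that the covariance operator $\mathcal K$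 of $f$ on $\mathcal H_R$ is trace class. **Theorem.** There is a constant $C>0$, depending only on $d,\phi,\psi,p_w,p_b,S,\mathcal X,\chi$ (and not on $m,k,R,\sigma_w,\sigma_b,D,N,\delta$), such that for every $\delta\in(0,1)$, with probability at least $1-\delta$, $$\sup_{x\in\mathcal X}\sqrt{\mathbb E\big[(f(x)-I_{\sigma,D,N}f(x))^2\,\big|\,(w_i,b_i)_{i=1}^N\big]}\le C\sqrt{M_1^*(R)}\,\big(\|m\|_{\mathcal H_R}+\sqrt{\operatorname{tr}\mathcal K}\big)\Big\{\frac1{\sigma_w}+\frac{\sigma_w^d(\sigma_w+1)^2}{\sigma_b}+\frac{\sigma_b(\sigma_b+1)\sigma_w^d(\sigma_w+1)^2}{D^{1/d}}+\frac{\sigma_b\sigma_w^{d+1}}{\delta\sqrt N}\Big\}.$$ Here $(f(x)-I_{\sigma,D,N}f(x))^2$ is integrable for each $x\in\mathcal X$, and the conditional expectation is taken in its (existing, almost surely unique) version that is continuous in $x\in\mathcal X$. -/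

import Mathlib

open MeasureTheory ProbabilityTheory Filter Topology
open scoped SchwartzMap

noncomputable section

namespace Ridgelet

/-! ### Fourier transforms -/

/-- The Fourier transform `(2π)^(-dim V / 2) ∫ f(x) exp(-i ξ·x) dx`. -/
def fourier {V : Type*} [NormedAddCommGroup V] [InnerProductSpace ℝ V] [MeasureSpace V]
    (f : V → ℂ) (ξ : V) : ℂ :=
  (((2 * Real.pi) ^ (-(Module.finrank ℝ V : ℝ) / 2) : ℝ) : ℂ) *
    ∫ x, f x * Complex.exp (-(Complex.I * ((inner ℝ ξ x : ℝ) : ℂ)))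

/-- `t` has at most polynomial growth of order `k`. -/
def HasPolyGrowth (k : ℕ) (t : ℝ → ℝ) : Prop :=
  ∃ C : ℝ, ∀ x, |t x| ≤ C * (1 + |x| ^ k)

/-- Membership of a Schwartz function in `𝒮_l(ℝ)`: it is `O(|x|^l)` as `x → 0`. -/
def VanishesToOrder (l : ℕ) (f : ℝ → ℂ) : Prop :=
  f =O[𝓝 0] fun x : ℝ => |x| ^ l

/-- `that ∈ L²_loc(ℝ \ {0})` is a generalised Fourier transform of `t`, with the duality identity
tested against all of `𝒮_{2m}(ℝ)`. -/
structure IsGenFourier (m : ℕ) (t : ℝ → ℝ) (that : ℝ → ℂ) : Prop where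
  measurable : Measurable that
  memLp_loc : ∀ K : Set ℝ, IsCompact K → K ⊆ {0}ᶜ → MemLp that 2 (volume.restrict K)
  duality : ∀ f : 𝓢(ℝ, ℂ), VanishesToOrder (2 * m) f →
    Integrable (fun ξ => that ξ * f ξ) ∧
      ∫ ξ, that ξ * f ξ = ∫ x, (t x : ℂ) * fourier (fun y : ℝ => f y) x

/-- The class `C_k^*(ℝ)`: continuous functions of at most polynomial growth of order `k` that
admit a generalised Fourier transform. -/
structure MemCStar (k : ℕ) (t : ℝ → ℝ) : Prop where
  continuous : Continuous t
  growth : HasPolyGrowth k t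
  exists_genFourier : ∃ (that : ℝ → ℂ) (m : ℕ), IsGenFourier m t that

/-- The Fourier transform of the (real) function `ψ`. -/
def psiHat (ψ : 𝓢(ℝ, ℝ)) (ξ : ℝ) : ℂ := fourier (fun z : ℝ => ((ψ z : ℝ) : ℂ)) ξ

/-- The conditions on the activation function `φ ∈ C_1^*(ℝ)`, with generalised Fourier transform
`φhat`, and on the Schwartz function `ψ` defining the ridgelet transform on `ℝ^d`. -/
structure IsActivationPair (d : ℕ) (φ : ℝ → ℝ) (φhat : ℝ → ℂ) (ψ : 𝓢(ℝ, ℝ)) : Prop where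
  mem_cstar : MemCStar 1 φ
  /-- `φhat` is a generalised Fourier transform of `φ`, tested on some `𝒮_{2m}(ℝ)`, to which
  the Fourier transform of `ψ` belongs. -/
  genFourier : ∃ m : ℕ, IsGenFourier m φ φhat ∧ VanishesToOrder (2 * m) (psiHat ψ)
  admissible : (((2 * Real.pi) ^ ((d : ℝ) / 2) : ℝ) : ℂ) *
    ∫ ξ : ℝ, ((|ξ| ^ (-(d : ℤ)) : ℝ) : ℂ) * ((starRingEnd ℂ) (psiHat ψ ξ) * φhat ξ) = 1
  integrable : Integrable fun ξ : ℝ =>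
    |ξ| ^ (-(d : ℤ) - 2) * ‖(starRingEnd ℂ) (psiHat ψ ξ) * φhat ξ‖

/-! ### Bandwidth densities -/

/-- The Fourier transform of a real density. -/
def densHat {V : Type*} [NormedAddCommGroup V] [InnerProductSpace ℝ V] [MeasureSpace V]
    (p : V → ℝ) (ξ : V) : ℂ := fourier (fun x => (p x : ℂ)) ξ

/-- A probability density that is symmetric, bounded, has finite second moment, and has a
(strictly) positive and integrable Fourier transform. -/
structure IsBandwidthDensity {V : Type*} [NormedAddCommGroup V] [InnerProductSpace ℝ V]
    [MeasureSpace V] (p : V → ℝ) : Prop where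
  measurable : Measurable p
  nonneg : ∀ x, 0 ≤ p x
  integrable : Integrable p
  integral_eq_one : ∫ x, p x = 1
  symm : ∀ x, p x = p (-x)
  bounded : MemLp p ⊤
  second_moment : Integrable fun x => ‖x‖ ^ 2 * p x
  fourier_pos : ∀ ξ, 0 < (densHat p ξ).re ∧ (densHat p ξ).im = 0
  fourier_integrable : Integrable (densHat p)

/-- The finite-bandwidth conditions on the pair `(p_w, p_b)`. -/
structure FiniteBandwidth {d : ℕ} (pw : EuclideanSpace ℝ (Fin d) → ℝ) (pb : ℝ → ℝ) : Prop where
  weight : IsBandwidthDensity pw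
  bias : IsBandwidthDensity pb
  weight_fourier_moment : Integrable fun ξ => ‖ξ‖ ^ 2 * ‖densHat pw ξ‖
  bias_differentiable : Differentiable ℝ pb
  bias_deriv_bounded : ∃ M : ℝ, ∀ b, |deriv pb b| ≤ M

/-- The rescaled density `σ^(-dim V) p(x / σ)`. -/
def scaledDensity {V : Type*} [NormedAddCommGroup V] [InnerProductSpace ℝ V]
    (σ : ℝ) (p : V → ℝ) (x : V) : ℝ :=
  (σ ^ Module.finrank ℝ V)⁻¹ * p (σ⁻¹ • x)

/-- The joint law `p_{w,σ} × p_{b,σ}` of a weight and a bias. -/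
def paramLaw {d : ℕ} (pw : EuclideanSpace ℝ (Fin d) → ℝ) (pb : ℝ → ℝ) (σw σb : ℝ) :
    Measure (EuclideanSpace ℝ (Fin d) × ℝ) :=
  (volume.withDensity fun w => ENNReal.ofReal (scaledDensity σw pw w)).prod
    (volume.withDensity fun b => ENNReal.ofReal (scaledDensity σb pb b))

/-- `Z = (2π)^(1/2) σ_w^d σ_b / (‖p̂_w‖_{L¹} ‖p̂_b‖_{L¹})`. -/
def totalMass {d : ℕ} (pw : EuclideanSpace ℝ (Fin d) → ℝ) (pb : ℝ → ℝ) (σw σb : ℝ) : ℝ :=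
  (2 * Real.pi) ^ (1 / 2 : ℝ) * σw ^ d * σb / ((∫ ξ, ‖densHat pw ξ‖) * ∫ ξ, ‖densHat pb ξ‖)

/-! ### The cubature rules and the discretised ridgelet operator -/

/-- The cube `[-S,S]^d`. -/
def cube (d : ℕ) (S : ℝ) : Set (EuclideanSpace ℝ (Fin d)) := {x | ∀ i, x i ∈ Set.Icc (-S) S}

/-- A mollifier: smooth, `[0,1]`-valued, equal to `1` on `𝒳` and to `0` off `[-S,S]^d`. -/
structure IsMollifier {d : ℕ} (S : ℝ) (𝒳 : Set (EuclideanSpace ℝ (Fin d)))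
    (χ : EuclideanSpace ℝ (Fin d) → ℝ) : Prop where
  smooth : ContDiff ℝ (⊤ : ℕ∞) χ
  range : ∀ x, χ x ∈ Set.Icc (0 : ℝ) 1
  eq_one : ∀ x ∈ 𝒳, χ x = 1
  eq_zero : ∀ x, x ∉ cube d S → χ x = 0

/-- The grid of the Cartesian product of `d` left endpoint rules on `[-S,S]`, with `n` nodes each;
it has `n ^ d` nodes. -/
def gridNode {d : ℕ} (S : ℝ) (n : ℕ) (j : Fin d → Fin n) : EuclideanSpace ℝ (Fin d) :=
  WithLp.toLp 2 fun i => -S + 2 * S * ((j i : ℕ) : ℝ) / n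

/-- The weight `u_j = (2S)^d D⁻¹ χ(x_j)`, where `D = n ^ d`. -/
def gridWeight {d : ℕ} (S : ℝ) (n : ℕ) (χ : EuclideanSpace ℝ (Fin d) → ℝ)
    (j : Fin d → Fin n) : ℝ :=
  (2 * S) ^ d * (((n ^ d : ℕ) : ℝ))⁻¹ * χ (gridNode S n j)

/-- The operator `I_{σ,D,N}`, with `D = n ^ d`, for given weights and biases `θ i = (w_i, b_i)`:
`∑ i, v_i (∑ j, u_j f(x_j) ψ(w_i·x_j + b_i)) φ(w_i·x + b_i)` with `v_i = Z / N`. -/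
def ridgeletOp {d : ℕ} (φ : ℝ → ℝ) (ψ : 𝓢(ℝ, ℝ)) (pw : EuclideanSpace ℝ (Fin d) → ℝ) (pb : ℝ → ℝ)
    (S : ℝ) (χ : EuclideanSpace ℝ (Fin d) → ℝ) (σw σb : ℝ) (n N : ℕ)
    (θ : Fin N → EuclideanSpace ℝ (Fin d) × ℝ)
    (f : EuclideanSpace ℝ (Fin d) → ℝ) (x : EuclideanSpace ℝ (Fin d)) : ℝ :=
  ∑ i, (totalMass pw pb σw σb * (N : ℝ)⁻¹) *
    (∑ j : Fin d → Fin n, gridWeight S n χ j * f (gridNode S n j) *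
        ψ (inner ℝ (θ i).1 (gridNode S n j) + (θ i).2)) *
      φ (inner ℝ (θ i).1 x + (θ i).2)

/-- The rate in the error bound. -/
def rate (d : ℕ) (σw σb δ : ℝ) (D N : ℕ) : ℝ :=
  1 / σw + σw ^ d * (σw + 1) ^ 2 / σb
    + σb * (σb + 1) * σw ^ d * (σw + 1) ^ 2 / (D : ℝ) ^ (1 / (d : ℝ))
    + σb * σw ^ (d + 1) / (δ * √(N : ℝ))

/-! ### Kernels of class `C^{1×1}` -/

/-- `∂^α g` for a multi-index `α` with `|α| ≤ 1`: `none` stands for `α = 0` and `some i` for the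
`i`-th unit multi-index. -/
def pderiv {d : ℕ} : Option (Fin d) → (EuclideanSpace ℝ (Fin d) → ℝ) →
    EuclideanSpace ℝ (Fin d) → ℝ
  | none, g, x => g x
  | some i, g, x => lineDeriv ℝ g x (EuclideanSpace.single i 1)

/-- The derivative `∂^α g` exists at every point. -/
def HasPDeriv {d : ℕ} : Option (Fin d) → (EuclideanSpace ℝ (Fin d) → ℝ) → Prop
  | none, _ => True
  | some i, g => ∀ x, LineDifferentiableAt ℝ g x (EuclideanSpace.single i 1)

/-- `∂^{α,β} h(x,y) = ∂_x^α ∂_y^β h(x,y)`. -/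
def mixedPDeriv {d : ℕ} (α β : Option (Fin d))
    (h : EuclideanSpace ℝ (Fin d) → EuclideanSpace ℝ (Fin d) → ℝ)
    (x y : EuclideanSpace ℝ (Fin d)) : ℝ :=
  pderiv α (fun x' => pderiv β (h x') y) x

/-- The class `C^{1×1}(ℝ^d × ℝ^d)`: all `∂^{α,β} h` with `|α|, |β| ≤ 1` exist and are
continuous. -/
def IsC11 {d : ℕ} (h : EuclideanSpace ℝ (Fin d) → EuclideanSpace ℝ (Fin d) → ℝ) : Prop :=
  ∀ α β : Option (Fin d),
    (∀ x, HasPDeriv β (h x)) ∧ (∀ y, HasPDeriv α fun x => pderiv β (h x) y) ∧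
      Continuous fun z : EuclideanSpace ℝ (Fin d) × EuclideanSpace ℝ (Fin d) =>
        mixedPDeriv α β h z.1 z.2

/-- `M_1^*(h)`, the maximum over `|α|, |β| ≤ 1` of the supremum of `|∂^{α,β} h(x,y)|` over
`x, y ∈ [-S,S]^d`. -/
def Mstar {d : ℕ} (S : ℝ)
    (h : EuclideanSpace ℝ (Fin d) → EuclideanSpace ℝ (Fin d) → ℝ) : ℝ :=
  ⨆ p : (Option (Fin d) × Option (Fin d)) × (cube d S × cube d S),
    |mixedPDeriv p.1.1 p.1.2 h p.2.1 p.2.2|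

/-- Symmetric, (strictly) positive definite functions. -/
structure IsSymmPosDef {T : Type*} (k : T → T → ℝ) : Prop where
  symm : ∀ x y, k x y = k y x
  pos : ∀ (s : Finset T) (a : T → ℝ), (∃ x ∈ s, a x ≠ 0) →
    0 < ∑ x ∈ s, ∑ y ∈ s, a x * a y * k x y

/-! ### Gaussian processes, covariance operators, trace -/

/-- `f ~ 𝒢𝒫(m, k)`. -/
structure IsGP {Ω T : Type*} [MeasurableSpace Ω] (P : Measure Ω) (f : T → Ω → ℝ)
    (m : T → ℝ) (k : T → T → ℝ) : Prop where
  gaussian : IsGaussianProcess f P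
  mean : ∀ x, ∫ ω, f x ω ∂P = m x
  cov : ∀ x y, cov[f x, f y; P] = k x y

/-- `K` is the covariance operator of the random element `F` with mean `μ` of a Hilbert space:
`⟪K u, v⟫ = 𝔼[⟪F - μ, u⟫ ⟪F - μ, v⟫]`. -/
def IsCovOperator {Ω H : Type*} [MeasurableSpace Ω] [NormedAddCommGroup H]
    [InnerProductSpace ℝ H] (P : Measure Ω) (F : Ω → H) (μ : H) (K : H →L[ℝ] H) : Prop :=
  ∀ u v : H, inner ℝ (K u) v = ∫ ω, inner ℝ (F ω - μ) u * inner ℝ (F ω - μ) v ∂P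

/-- A positive operator `T` is trace class if `∑ ⟪T e_i, e_i⟫ < ∞` along orthonormal bases. -/
def IsPosTraceClass {H : Type*} [NormedAddCommGroup H] [InnerProductSpace ℝ H]
    [CompleteSpace H] (T : H →L[ℝ] H) : Prop :=
  T.IsPositive ∧ ∀ (w : Set H) (b : HilbertBasis w ℝ H),
    Summable fun i => inner ℝ (T (b i)) (b i)

/-- The trace `∑ ⟪T e_i, e_i⟫` (along some orthonormal basis; for positive trace class `T` it does
not depend on the basis). -/
def opTrace {H : Type*} [NormedAddCommGroup H] [InnerProductSpace ℝ H]
    [CompleteSpace H] (T : H →L[ℝ] H) : ℝ :=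
  ∑' i : (exists_hilbertBasis ℝ H).choose,
    inner ℝ (T ((exists_hilbertBasis ℝ H).choose_spec.choose i))
      ((exists_hilbertBasis ℝ H).choose_spec.choose i)

/-! ### Conditional expectations of a family of random variables -/

/-- `V` is a version of the family `x ↦ 𝔼[Y x | θ]`, `x ∈ 𝒳`, of conditional expectations given
the random variable `θ`, that has (almost surely) continuous paths on `𝒳`.
Two such versions agree almost surely, simultaneously for all `x ∈ 𝒳`. -/
structure IsContCondExp {Ω T A : Type*} [mΩ : MeasurableSpace Ω] [TopologicalSpace T]
    [mA : MeasurableSpace A] (P : Measure Ω) (θ : Ω → A) (𝒳 : Set T)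
    (Y V : T → Ω → ℝ) : Prop where
  version : ∀ x ∈ 𝒳, V x =ᵐ[P] P[Y x | mA.comap θ]
  continuousOn : ∀ᵐ ω ∂P, ContinuousOn (fun x => V x ω) 𝒳

end Ridgelet

end

/-! Let `H` be the Hilbert space with kernel `R` and `feat H x` the representer of evaluation at
`x`. The operator is linear in point values, so f(x) - I f(x) = ⟨f, g_x⟩, where g_x (`residual`)
depends only on the weights and biases. These are independent of f, hence the conditional second
moment of the error is ⟨m, g_x⟩² + ⟨K g_x, g_x⟩, at most (‖m‖ + √tr K)² ‖g_x‖²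
(`integrable_sqErr_and_condExp`, `sqrt_secondMoment_le`). It remains to bound ‖g_x‖ uniformly in x
on an event of probability 1 - δ in the parameters (`exists_norm_residual_le`). This is a
reconstruction problem for one `H`-valued function, y ↦ χ(y) `feat H y`. It is Lipschitz with
constant of order √(M_1^*(R)), because squared distances of features are mixed second differences of
`R`.

Three of the errors are deterministic. For a nearly flat bias density, integrating out b turns
ψ(w·y+b) φ(w·x+b) into a multiple of the correlation of ψ and φ at w·(x-y); this costs the term with
1/σ_b (`exists_abs_integral_nodeFn_sub_le`). Averaged over w and written in frequency, that
correlation is a superposition of dilates of the transform of p_w; admissibility gives it total mass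
one, so it is an approximate identity at scale 1/σ_w (`norm_integral_corr_smul_sub_le`). The left
endpoint rule for a Lipschitz integrand costs 1/n = D^(-1/d) (`norm_quadrature_sub_le`).

The fourth error is random and must be uniform in x (`exists_good_event`). For a fixed node y it is
split into its value at x = y and the increment from y to x. Increments are dominated by |w·(x-x')|,
so symmetrisation and contraction reduce their supremum to the norm of a Rademacher sum of the
weights, of order σ_w √N, and Markov's inequality gives the factor 1/δ. The diagonal part is
controlled by its variance, of order N min(1, 1/σ_b). After normalisation this is absorbed by the
first and last terms of the rate (`monteCarlo_rate_le`). -/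

namespace Ridgelet

/-! ### Rademacher sums -/

/-- The sign `±1` encoded by a Boolean. -/
def sgn (b : Bool) : ℝ := if b then 1 else -1

@[simp] lemma sgn_true : sgn true = 1 := rfl

@[simp] lemma sgn_false : sgn false = -1 := rfl

lemma sgn_not (b : Bool) : sgn (!b) = -sgn b := by cases b <;> simp [sgn]

lemma sum_signs_succ {n : ℕ} {V : Type*} [AddCommMonoid V] (f : (Fin (n + 1) → Bool) → V) :
    ∑ ε, f ε = ∑ ε : Fin n → Bool, (f (Fin.cons true ε) + f (Fin.cons false ε)) := by
  rw [← (Fin.consEquiv (fun _ : Fin (n + 1) => Bool)).sum_comp, Fintype.sum_prod_type,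
    Fintype.sum_bool, Finset.sum_add_distrib]
  rfl

/-- At any two points s, t the left side contributes A s + A t + (c s - c t), at most A s + A t + |e
s - e t|. Whichever sign the absolute value takes, one of the pairings (s, t), (t, s) realises it on
the right. This is the contraction principle for a single sign. -/
lemma ciSup_add_ciSup_contract {T : Type*} [Finite T] [Nonempty T] (A c e : T → ℝ)
    (h : ∀ s t, |c s - c t| ≤ |e s - e t|) :
    (⨆ t, (A t + c t)) + (⨆ t, (A t - c t)) ≤ (⨆ t, (A t + e t)) + ⨆ t, (A t - e t) := by
  rw [← le_sub_iff_add_le]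
  refine ciSup_le fun s => ?_
  rw [le_sub_comm]
  refine ciSup_le fun t => ?_
  have b1 := fun u => le_ciSup (f := fun t => A t + e t) (Set.finite_range _).bddAbove u
  have b2 := fun u => le_ciSup (f := fun t => A t - e t) (Set.finite_range _).bddAbove u
  have h1 := b1 s
  have h2 := b1 t
  have h3 := b2 s
  have h4 := b2 t
  have h5 := le_abs_self (c s - c t)
  have h6 := h s t
  rcases abs_cases (e s - e t) with ⟨h7, _⟩ | ⟨h7, _⟩ <;> linarith

/-- One-sided contraction principle for Rademacher averages. -/
lemma sum_signs_ciSup_contract {T : Type*} [Finite T] [Nonempty T] (n : ℕ)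
    (c e : Fin n → T → ℝ) (h : ∀ i s t, |c i s - c i t| ≤ |e i s - e i t|) (A : T → ℝ) :
    ∑ ε : Fin n → Bool, (⨆ t, (A t + ∑ i, sgn (ε i) * c i t)) ≤
      ∑ ε : Fin n → Bool, ⨆ t, (A t + ∑ i, sgn (ε i) * e i t) := by
  -- The offset must stay free: once the first sign is treated, `A + e 0` and `A - e 0` serve as
  -- offsets for the remaining ones.
  induction n generalizing A with
  | zero => simp
  | succ n ih =>
    rw [sum_signs_succ, sum_signs_succ]
    simp only [Fin.sum_univ_succ, Fin.cons_zero, Fin.cons_succ, sgn_true, sgn_false]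
    calc _ ≤ ∑ ε : Fin n → Bool,
          ((⨆ t, ((A t + e 0 t) + ∑ i, sgn (ε i) * c i.succ t)) +
            ⨆ t, ((A t - e 0 t) + ∑ i, sgn (ε i) * c i.succ t)) := by
          refine Finset.sum_le_sum fun ε _ => ?_
          have := ciSup_add_ciSup_contract (fun t => A t + ∑ i, sgn (ε i) * c i.succ t)
            (c 0) (e 0) (h 0)
          refine (le_of_eq ?_).trans (this.trans (le_of_eq ?_)) <;>
          · congr 1 <;>
            · congr 1; funext t; ring
      _ ≤ _ := by
          rw [Finset.sum_add_distrib, Finset.sum_add_distrib]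
          have h1 := ih (fun i => c i.succ) (fun i => e i.succ) (fun i => h i.succ)
            (fun t => A t + e 0 t)
          have h2 := ih (fun i => c i.succ) (fun i => e i.succ) (fun i => h i.succ)
            (fun t => A t - e 0 t)
          refine (add_le_add h1 h2).trans (le_of_eq ?_)
          congr 1 <;>
          · refine Finset.sum_congr rfl fun ε _ => ?_
            congr 1; funext t; ring

/-- Contraction principle for Rademacher averages, for uniform norms. -/
lemma sum_signs_norm_contract {T : Type*} [Fintype T] (n : ℕ)
    (c e : Fin n → T → ℝ) (h : ∀ i s t, |c i s - c i t| ≤ |e i s - e i t|)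
    (h0 : ∀ i t, |c i t| ≤ |e i t|) :
    ∑ ε : Fin n → Bool, ‖∑ i, sgn (ε i) • c i‖ ≤
      2 * ∑ ε : Fin n → Bool, ‖∑ i, sgn (ε i) • e i‖ := by
  -- An extra point `none`, where all functions vanish, makes the suprema nonnegative. The bound
  -- `h0` is the increment condition between `none` and the other points.
  set c' : Fin n → Option T → ℝ := fun i t => t.elim 0 (c i)
  set e' : Fin n → Option T → ℝ := fun i t => t.elim 0 (e i)
  have hc : ∀ i s t, |c' i s - c' i t| ≤ |e' i s - e' i t| := by
    rintro i (_ | s) (_ | t) <;> simp [c', e', h, h0]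
  have key := sum_signs_ciSup_contract n c' e' hc 0
  -- Flipping all signs permutes the sign vectors, so the suprema of the sum and of its negative
  -- have equal averages. This is the source of the factor 2.
  have hneg : ∑ ε : Fin n → Bool, (⨆ t, ∑ i, sgn (!(ε i)) * c' i t) =
      ∑ ε : Fin n → Bool, ⨆ t, ∑ i, sgn (ε i) * c' i t :=
    Equiv.sum_comp (Equiv.arrowCongr (Equiv.refl (Fin n)) Equiv.boolNot)
      fun ε : Fin n → Bool => ⨆ t, ∑ i, sgn (ε i) * c' i t
  have hle : ∀ ε : Fin n → Bool, ‖∑ i, sgn (ε i) • c i‖ ≤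
      (⨆ t, ∑ i, sgn (ε i) * c' i t) + ⨆ t, ∑ i, sgn (!(ε i)) * c' i t := by
    intro ε
    have b1 := fun u => le_ciSup (f := fun t => ∑ i, sgn (ε i) * c' i t)
      (Set.finite_range _).bddAbove u
    have b2 := fun u => le_ciSup (f := fun t => ∑ i, sgn (!(ε i)) * c' i t)
      (Set.finite_range _).bddAbove u
    have z1 : 0 ≤ ⨆ t, ∑ i, sgn (ε i) * c' i t := (by simp [c'] : (0 : ℝ) ≤ _).trans (b1 none)
    have z2 : 0 ≤ ⨆ t, ∑ i, sgn (!(ε i)) * c' i t := (by simp [c'] : (0 : ℝ) ≤ _).trans (b2 none)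
    refine (pi_norm_le_iff_of_nonneg (by positivity)).2 fun t => ?_
    have h1 := b1 (some t)
    have h2 := b2 (some t)
    simp only [sgn_not, neg_mul, Finset.sum_neg_distrib, c', Option.elim_some] at h1 h2 z1 z2 ⊢
    simp only [Finset.sum_apply, Pi.smul_apply, smul_eq_mul, Real.norm_eq_abs]
    rw [abs_le]
    constructor <;> linarith
  have hge : ∀ ε : Fin n → Bool, (⨆ t, ∑ i, sgn (ε i) * e' i t) ≤ ‖∑ i, sgn (ε i) • e i‖ := by
    intro ε
    refine ciSup_le fun t => ?_
    cases t with
    | none => simp [e']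
    | some t =>
      have := (le_abs_self _).trans (norm_le_pi_norm (∑ i, sgn (ε i) • e i) t)
      simpa [e', Finset.sum_apply] using this
  simp only [Pi.zero_apply, zero_add] at key
  calc _ ≤ ∑ ε : Fin n → Bool, ((⨆ t, ∑ i, sgn (ε i) * c' i t) +
        ⨆ t, ∑ i, sgn (!(ε i)) * c' i t) := Finset.sum_le_sum fun ε _ => hle ε
    _ = 2 * ∑ ε : Fin n → Bool, ⨆ t, ∑ i, sgn (ε i) * c' i t := by
      rw [Finset.sum_add_distrib, hneg, two_mul]
    _ ≤ 2 * ∑ ε : Fin n → Bool, ⨆ t, ∑ i, sgn (ε i) * e' i t := by gcongr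
    _ ≤ _ := by
      gcongr with ε _
      exact hge ε

/-- Cross terms cancel on averaging; each sign is removed by the parallelogram law, for which the
offset `a` is needed. -/
lemma sum_signs_norm_sq {E : Type*} [NormedAddCommGroup E] [InnerProductSpace ℝ E] (n : ℕ)
    (w : Fin n → E) (a : E) :
    ∑ ε : Fin n → Bool, ‖a + ∑ i, sgn (ε i) • w i‖ ^ 2 = 2 ^ n * (‖a‖ ^ 2 + ∑ i, ‖w i‖ ^ 2) := by
  induction n generalizing a with
  | zero => simp
  | succ n ih =>
    rw [sum_signs_succ, Finset.sum_add_distrib]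
    simp only [Fin.sum_univ_succ, Fin.cons_zero, Fin.cons_succ, ← add_assoc]
    rw [ih, ih]
    have := parallelogram_law_with_norm ℝ a (w 0)
    simp only [sgn, if_true, one_smul, Bool.false_eq_true, if_false, neg_smul, ← sub_eq_add_neg]
    rw [pow_succ]
    linear_combination (2 : ℝ) ^ n * this

lemma sum_signs_norm_le {E : Type*} [NormedAddCommGroup E] [InnerProductSpace ℝ E] (n : ℕ)
    (w : Fin n → E) :
    ∑ ε : Fin n → Bool, ‖∑ i, sgn (ε i) • w i‖ ≤ 2 ^ n * √(∑ i, ‖w i‖ ^ 2) := by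
  have h := sum_signs_norm_sq n w 0
  have cs := sq_sum_le_card_mul_sum_sq (s := (Finset.univ : Finset (Fin n → Bool)))
    (f := fun ε => ‖∑ i, sgn (ε i) • w i‖)
  simp only [zero_add, norm_zero] at h
  rw [h] at cs
  refine (sq_le_sq₀ (by positivity) (by positivity)).1 ?_
  rw [mul_pow, Real.sq_sqrt (by positivity)]
  refine cs.trans (le_of_eq ?_)
  simp
  ring

/-! ### Symmetrisation -/

section Symmetrisation

variable {A : Type*} [MeasurableSpace A] {V : Type*} [NormedAddCommGroup V]

lemma integrable_eval_pi (μ : Measure A) [IsProbabilityMeasure μ] {X : A → V}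
    (hX : Integrable X μ) (n : ℕ) (i : Fin n) :
    Integrable (fun θ : Fin n → A => X (θ i)) (Measure.pi fun _ => μ) :=
  (measurePreserving_eval (fun _ : Fin n => μ) i).integrable_comp_of_integrable hX

variable [NormedSpace ℝ V] [CompleteSpace V]

/-- The vector v + X(a) - E X is the midpoint of v + 2X(a) and the mean of v - 2X. Convexity of the
norm therefore exchanges centring for a random sign and a factor 2, one variable at a time. -/
lemma integral_norm_add_sub_integral_le (μ : Measure A) [IsProbabilityMeasure μ] {X : A → V}
    (hX : Integrable X μ) (v : V) :
    ∫ a, ‖v + (X a - ∫ b, X b ∂μ)‖ ∂μ ≤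
      2⁻¹ * ((∫ a, ‖v + (2 : ℝ) • X a‖ ∂μ) + ∫ a, ‖v - (2 : ℝ) • X a‖ ∂μ) := by
  have hX2 : Integrable (fun a => (2 : ℝ) • X a) μ := hX.smul (2 : ℝ)
  have hp : Integrable (fun a => ‖v + (2 : ℝ) • X a‖) μ := ((integrable_const v).add hX2).norm
  have hm : Integrable (fun a => ‖v - (2 : ℝ) • X a‖) μ := ((integrable_const v).sub hX2).norm
  set G : ℝ := (∫ a, ‖v + (2 : ℝ) • X a‖ ∂μ) + ∫ a, ‖v - (2 : ℝ) • X a‖ ∂μ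
  have step1 : ∀ a, ‖v + (X a - ∫ b, X b ∂μ)‖ ≤
      2⁻¹ * (‖v + (2 : ℝ) • X a‖ + ∫ b, ‖v - (2 : ℝ) • X b‖ ∂μ) := by
    intro a
    have e1 : v + (X a - ∫ b, X b ∂μ) = (2 : ℝ)⁻¹ • ((v + (2 : ℝ) • X a) +
        ∫ b, (v - (2 : ℝ) • X b) ∂μ) := by
      rw [integral_sub (integrable_const v) hX2, integral_smul]
      simp only [integral_const, probReal_univ, one_smul]
      module
    rw [e1, norm_smul]
    norm_num
    refine (norm_add_le _ _).trans ?_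
    gcongr
    exact norm_integral_le_integral_norm _
  calc _ ≤ ∫ a, 2⁻¹ * (‖v + (2 : ℝ) • X a‖ + ∫ b, ‖v - (2 : ℝ) • X b‖ ∂μ) ∂μ :=
        integral_mono (((integrable_const v).add (hX.sub (integrable_const _))).norm)
          ((hp.add (integrable_const _)).const_mul _) step1
    _ = _ := by
        rw [integral_const_mul, integral_add hp (integrable_const _)]
        simp [G]

lemma integral_pi_fin_succ (μ : Measure A) [IsProbabilityMeasure μ] (n : ℕ)
    (f : (Fin (n + 1) → A) → ℝ) :
    ∫ θ, f θ ∂(Measure.pi fun _ : Fin (n + 1) => μ) =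
      ∫ p : A × (Fin n → A), f (Fin.cons p.1 p.2) ∂(μ.prod (Measure.pi fun _ : Fin n => μ)) := by
  have h := (measurePreserving_piFinSuccAbove (fun _ : Fin (n + 1) => μ) 0).symm
  rw [← h.integral_comp']
  refine integral_congr_ae (.of_forall fun p => ?_)
  simp [MeasurableEquiv.piFinSuccAbove]
  rfl

/-- Symmetrisation of sums of i.i.d. random vectors. -/
lemma integral_norm_sum_sub_integral_le (μ : Measure A) [IsProbabilityMeasure μ] {X : A → V}
    (hX : Integrable X μ) (n : ℕ) (v : V) :
    ∫ θ : Fin n → A, ‖v + ∑ i, (X (θ i) - ∫ b, X b ∂μ)‖ ∂(Measure.pi fun _ => μ) ≤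
      (2 ^ n)⁻¹ * ∑ ε : Fin n → Bool,
        ∫ θ : Fin n → A, ‖v + ∑ i, (2 * sgn (ε i)) • X (θ i)‖ ∂(Measure.pi fun _ => μ) := by
  -- The first variable is symmetrised with the others frozen inside `v`; the induction hypothesis
  -- then applies with v ± 2X(a) in place of `v`.
  induction n generalizing v with
  | zero => simp
  | succ n ih =>
    set π := Measure.pi fun _ : Fin n => μ
    set m := ∫ b, X b ∂μ
    have hX1 : Integrable (fun p : A × (Fin n → A) => X p.1) (μ.prod π) := hX.comp_fst π
    have hs : Integrable (fun θ : Fin n → A => ∑ i, (X (θ i) - m)) π :=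
      integrable_finsetSum _ fun i _ => (integrable_eval_pi μ hX n i).sub (integrable_const _)
    have hs2 : ∀ ε : Fin n → Bool,
        Integrable (fun θ : Fin n → A => ∑ i, (2 * sgn (ε i)) • X (θ i)) π := fun ε =>
      integrable_finsetSum _ fun i _ => (integrable_eval_pi μ hX n i).smul _
    have hI : ∀ c : ℝ, Integrable (fun p : A × (Fin n → A) =>
        ‖(v + c • X p.1) + ∑ i, (X (p.2 i) - m)‖) (μ.prod π) := fun c =>
      (((integrable_const v).add (hX1.smul c)).add (hs.comp_snd μ)).norm
    have hI2 : ∀ (c : ℝ) (ε : Fin n → Bool), Integrable (fun p : A × (Fin n → A) =>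
        ‖(v + c • X p.1) + ∑ i, (2 * sgn (ε i)) • X (p.2 i)‖) (μ.prod π) := fun c ε =>
      (((integrable_const v).add (hX1.smul c)).add ((hs2 ε).comp_snd μ)).norm
    have hJ : Integrable (fun p : A × (Fin n → A) =>
        ‖(v + ∑ i, (X (p.2 i) - m)) + (X p.1 - m)‖) (μ.prod π) :=
      ((((integrable_const v).add (hs.comp_snd μ))).add (hX1.sub (integrable_const _))).norm
    have hstep : ∀ c : ℝ, ∫ p : A × (Fin n → A),
          ‖(v + c • X p.1) + ∑ i, (X (p.2 i) - m)‖ ∂(μ.prod π) ≤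
        (2 ^ n)⁻¹ * ∑ ε : Fin n → Bool, ∫ p : A × (Fin n → A),
          ‖(v + c • X p.1) + ∑ i, (2 * sgn (ε i)) • X (p.2 i)‖ ∂(μ.prod π) := by
      intro c
      rw [integral_prod _ (hI c), ← integral_finsetSum _ fun ε _ => hI2 c ε, integral_prod _
        (integrable_finsetSum _ fun ε _ => hI2 c ε), ← integral_const_mul]
      refine integral_mono_ae (hI c).integral_prod_left
        ((integrable_finsetSum _ fun ε _ => hI2 c ε).integral_prod_left.const_mul _) ?_
      have hae : ∀ᵐ a ∂μ, ∀ ε : Fin n → Bool, Integrable (fun θ : Fin n → A =>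
          ‖(v + c • X a) + ∑ i, (2 * sgn (ε i)) • X (θ i)‖) π :=
        Filter.Eventually.of_forall fun a ε => ((integrable_const _).add (hs2 ε)).norm
      filter_upwards [hae] with a ha
      rw [integral_finsetSum _ fun ε _ => ha ε]
      exact ih _
    rw [integral_pi_fin_succ]
    simp only [integral_pi_fin_succ]
    rw [sum_signs_succ]
    simp only [Fin.sum_univ_succ, Fin.cons_zero, Fin.cons_succ]
    calc _ = ∫ p : A × (Fin n → A),
          ‖(v + ∑ i, (X (p.2 i) - m)) + (X p.1 - m)‖ ∂(μ.prod π) := by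
          congr 1; funext p; congr 1; abel
      _ = ∫ θ, ∫ a, ‖(v + ∑ i, (X (θ i) - m)) + (X a - m)‖ ∂μ ∂π :=
          integral_prod_symm _ hJ
      _ ≤ ∫ θ, 2⁻¹ * ((∫ a, ‖(v + (2 : ℝ) • X a) + ∑ i, (X (θ i) - m)‖ ∂μ) +
            ∫ a, ‖(v + (-2 : ℝ) • X a) + ∑ i, (X (θ i) - m)‖ ∂μ) ∂π := by
          refine integral_mono hJ.integral_prod_right
            (((hI 2).integral_prod_right.add (hI (-2)).integral_prod_right).const_mul _) fun θ => ?_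
          refine (integral_norm_add_sub_integral_le μ hX _).trans (le_of_eq ?_)
          congr 2 <;>
          · congr 1; funext a; congr 1; module
      _ = 2⁻¹ * ((∫ p : A × (Fin n → A), ‖(v + (2 : ℝ) • X p.1) +
              ∑ i, (X (p.2 i) - m)‖ ∂(μ.prod π)) +
            ∫ p : A × (Fin n → A), ‖(v + (-2 : ℝ) • X p.1) +
              ∑ i, (X (p.2 i) - m)‖ ∂(μ.prod π)) := by
          rw [integral_const_mul, integral_add (hI 2).integral_prod_right
            (hI (-2)).integral_prod_right, integral_prod_symm _ (hI 2),
            integral_prod_symm _ (hI (-2))]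
      _ ≤ 2⁻¹ * ((2 ^ n)⁻¹ * (∑ ε : Fin n → Bool, ∫ p : A × (Fin n → A),
            ‖(v + (2 : ℝ) • X p.1) + ∑ i, (2 * sgn (ε i)) • X (p.2 i)‖ ∂(μ.prod π)) +
          (2 ^ n)⁻¹ * ∑ ε : Fin n → Bool, ∫ p : A × (Fin n → A),
            ‖(v + (-2 : ℝ) • X p.1) + ∑ i, (2 * sgn (ε i)) • X (p.2 i)‖ ∂(μ.prod π)) := by
          gcongr
          exacts [hstep 2, hstep (-2)]
      _ = _ := by
          rw [Finset.sum_add_distrib, ← mul_add, ← mul_assoc, pow_succ, mul_inv, mul_comm (2⁻¹ : ℝ)]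
          simp [π, add_assoc]

lemma integral_norm_sum_sub_integral_le' (μ : Measure A) [IsProbabilityMeasure μ] {X : A → V}
    (hX : Integrable X μ) (n : ℕ) :
    ∫ θ : Fin n → A, ‖∑ i, (X (θ i) - ∫ b, X b ∂μ)‖ ∂(Measure.pi fun _ => μ) ≤
      (2 ^ n)⁻¹ * ∑ ε : Fin n → Bool,
        ∫ θ : Fin n → A, ‖∑ i, (2 * sgn (ε i)) • X (θ i)‖ ∂(Measure.pi fun _ => μ) := by
  simpa only [zero_add] using integral_norm_sum_sub_integral_le μ hX n 0

end Symmetrisation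

/-- Uniform deviation of the empirical means of a family that is dominated, in the sense of
increments, by linear functionals of a square integrable random vector. -/
lemma integral_norm_empirical_le {A : Type*} [MeasurableSpace A] (μ : Measure A)
    [IsProbabilityMeasure μ] {E : Type*} [NormedAddCommGroup E] [InnerProductSpace ℝ E]
    {T : Type*} [Fintype T] (x : T → E) (W : A → E)
    (hW : Integrable (fun a => ‖W a‖ ^ 2) μ)
    (c : A → T → ℝ) (hc : Integrable c μ) {K ρ : ℝ} (hK : 0 ≤ K) (hρ : 0 ≤ ρ)
    (hcs : ∀ a s t, |c a s - c a t| ≤ K * |inner ℝ (W a) (x s - x t)|)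
    (hct : ∀ a t, |c a t| ≤ K * |inner ℝ (W a) (x t)|) (hx : ∀ t, ‖x t‖ ≤ ρ) (n : ℕ) :
    ∫ θ : Fin n → A, ‖∑ i, (c (θ i) - ∫ b, c b ∂μ)‖ ∂(Measure.pi fun _ => μ) ≤
      4 * K * ρ * √(n * ∫ a, ‖W a‖ ^ 2 ∂μ) := by
  set π := Measure.pi fun _ : Fin n => μ
  have h1 := integral_norm_sum_sub_integral_le' μ hc n
  refine h1.trans ?_
  have hint : ∀ ε : Fin n → Bool,
      Integrable (fun θ : Fin n → A => ‖∑ i, (2 * sgn (ε i)) • c (θ i)‖) π := fun ε =>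
    (integrable_finsetSum _ fun i _ => (integrable_eval_pi μ hc n i).smul (2 * sgn (ε i))).norm
  rw [← integral_finsetSum _ fun ε _ => hint ε]
  set Q : (Fin n → A) → ℝ := fun θ => ∑ i, ‖W (θ i)‖ ^ 2
  have hQ0 : ∀ θ, 0 ≤ Q θ := fun θ => by positivity
  have hQ : Integrable Q π := integrable_finsetSum _ fun i _ => integrable_eval_pi μ hW n i
  have hQi : ∫ θ, Q θ ∂π = n * ∫ a, ‖W a‖ ^ 2 ∂μ := by
    rw [integral_finsetSum _ fun i _ => integrable_eval_pi μ hW n i]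
    have : ∀ i : Fin n, ∫ θ : Fin n → A, ‖W (θ i)‖ ^ 2 ∂π = ∫ a, ‖W a‖ ^ 2 ∂μ := fun i => by
      have hmp := measurePreserving_eval (fun _ : Fin n => μ) i
      have := hmp.map_eq ▸ integral_map hmp.measurable.aemeasurable
        (f := fun a => ‖W a‖ ^ 2) (by rw [hmp.map_eq]; exact hW.1)
      exact this.symm
    refine (Finset.sum_congr rfl fun i _ => this i).trans ?_
    simp
  have hQs : MemLp (fun θ => √(Q θ)) 2 π := by
    rw [memLp_two_iff_integrable_sq (Real.continuous_sqrt.comp_aestronglyMeasurable hQ.1)]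
    simpa only [Real.sq_sqrt (hQ0 _)] using hQ
  -- Jensen's inequality for the square root, in the form that the variance of √Q is nonnegative.
  have hsqrt : ∫ θ, √(Q θ) ∂π ≤ √(n * ∫ a, ‖W a‖ ^ 2 ∂μ) := by
    have hv := variance_nonneg (fun θ => √(Q θ)) π
    rw [variance_eq_sub hQs] at hv
    refine Real.le_sqrt_of_sq_le ?_
    have : ∫ θ, ((fun θ => √(Q θ)) ^ 2) θ ∂π = ∫ θ, Q θ ∂π := by
      simp only [Pi.pow_apply, Real.sq_sqrt (hQ0 _)]
    rw [this, hQi] at hv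
    linarith
  have hpt : ∀ θ : Fin n → A, ∑ ε : Fin n → Bool, ‖∑ i, (2 * sgn (ε i)) • c (θ i)‖ ≤
      2 ^ n * (4 * K * ρ * √(Q θ)) := by
    intro θ
    have e1 : ∀ ε : Fin n → Bool, ‖∑ i, (2 * sgn (ε i)) • c (θ i)‖ =
        2 * ‖∑ i, sgn (ε i) • c (θ i)‖ := fun ε => by
      simp only [mul_smul, ← Finset.smul_sum]
      rw [norm_smul]; norm_num
    simp only [e1, ← Finset.mul_sum]
    -- After contraction only linear functionals of one random vector remain, so the maximum over
    -- `T` costs the radius `ρ` and does not depend on the size of `T`. The constant 4 is 2 from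
    -- symmetrisation times 2 from contraction.
    have h2 := sum_signs_norm_contract n (fun i => c (θ i))
      (fun i t => K * inner ℝ (W (θ i)) (x t))
      (fun i s t => by
        rw [← mul_sub, ← inner_sub_right, abs_mul, abs_of_nonneg hK]; exact hcs _ _ _)
      (fun i t => by rw [abs_mul, abs_of_nonneg hK]; exact hct _ _)
    have h3 : ∀ ε : Fin n → Bool, ‖∑ i, sgn (ε i) • (fun t => K * inner ℝ (W (θ i)) (x t))‖ ≤
        K * ρ * ‖∑ i, sgn (ε i) • W (θ i)‖ := fun ε => by
      refine (pi_norm_le_iff_of_nonneg (by positivity)).2 fun t => ?_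
      have : (∑ i, sgn (ε i) • (fun t => K * inner ℝ (W (θ i)) (x t))) t =
          K * inner ℝ (∑ i, sgn (ε i) • W (θ i)) (x t) := by
        simp only [Finset.sum_apply, Pi.smul_apply, smul_eq_mul, sum_inner, inner_smul_left,
          Finset.mul_sum]
        exact Finset.sum_congr rfl fun i _ => by simp; ring
      rw [this, norm_mul, Real.norm_of_nonneg hK, mul_assoc]
      gcongr
      refine (norm_inner_le_norm _ _).trans ?_
      rw [mul_comm]
      gcongr
      exact hx t
    have h4 := sum_signs_norm_le n fun i => W (θ i)
    calc _ ≤ 2 * (2 * ∑ ε : Fin n → Bool, K * ρ * ‖∑ i, sgn (ε i) • W (θ i)‖) := by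
          gcongr
          exact h2.trans (by gcongr with ε _; exact h3 ε)
      _ = 4 * K * ρ * ∑ ε : Fin n → Bool, ‖∑ i, sgn (ε i) • W (θ i)‖ := by
          rw [← Finset.mul_sum]; ring
      _ ≤ 4 * K * ρ * (2 ^ n * √(∑ i, ‖W (θ i)‖ ^ 2)) := by gcongr
      _ = _ := by ring
  calc _ ≤ (2 ^ n)⁻¹ * ∫ θ, 2 ^ n * (4 * K * ρ * √(Q θ)) ∂π := by
        gcongr ?_ * ?_
        refine integral_mono (integrable_finsetSum _ fun ε _ => hint ε)
          (((hQs.integrable (by norm_num)).const_mul _).const_mul _) hpt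
    _ = 4 * K * ρ * ∫ θ, √(Q θ) ∂π := by
        rw [integral_const_mul, integral_const_mul, ← mul_assoc, inv_mul_cancel₀ (by positivity),
          one_mul]
    _ ≤ _ := by gcongr

end Ridgelet

namespace Ridgelet

/-! ### The cube and the quantity `M_1^*` -/

lemma isClosed_cube (d : ℕ) (S : ℝ) : IsClosed (cube d S) := by
  have : cube d S = ⋂ i, (fun x : EuclideanSpace ℝ (Fin d) => x i) ⁻¹' Set.Icc (-S) S := by
    ext; simp [cube]
  rw [this]
  exact isClosed_iInter fun i => isClosed_Icc.preimage (by fun_prop)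

lemma norm_le_of_mem_cube {d : ℕ} {S : ℝ} {x : EuclideanSpace ℝ (Fin d)} (hx : x ∈ cube d S) :
    ‖x‖ ≤ √d * S := by
  rcases Nat.eq_zero_or_pos d with rfl | hd
  · have : x = 0 := Subsingleton.elim _ _
    simp [this]
  have hS : 0 ≤ S := by
    have := hx ⟨0, hd⟩
    linarith [this.1, this.2]
  rw [EuclideanSpace.norm_eq]
  refine Real.sqrt_le_iff.2 ⟨by positivity, ?_⟩
  rw [mul_pow, Real.sq_sqrt (by positivity)]
  calc ∑ i, ‖x i‖ ^ 2 ≤ ∑ _i : Fin d, S ^ 2 := by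
        gcongr with i _
        exact abs_le.2 (hx i)
    _ = _ := by simp

lemma isCompact_cube (d : ℕ) (S : ℝ) : IsCompact (cube d S) :=
  Metric.isCompact_of_isClosed_isBounded (isClosed_cube d S)
    ((Metric.isBounded_closedBall (x := 0) (r := √d * S)).subset fun _ hx => by
      simpa using norm_le_of_mem_cube hx)

/-- A real supremum bounds its terms only when the family is bounded above. Here this follows from
continuity on the compact cube and the finite number of multi-indices. -/
lemma abs_mixedPDeriv_le_Mstar {d : ℕ} {S : ℝ}
    {R : EuclideanSpace ℝ (Fin d) → EuclideanSpace ℝ (Fin d) → ℝ} (hR : IsC11 R)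
    (α β : Option (Fin d)) {x y : EuclideanSpace ℝ (Fin d)} (hx : x ∈ cube d S)
    (hy : y ∈ cube d S) : |mixedPDeriv α β R x y| ≤ Mstar S R := by
  have hb : ∀ p : Option (Fin d) × Option (Fin d), ∃ C : ℝ, ∀ z : cube d S × cube d S,
      |mixedPDeriv p.1 p.2 R z.1 z.2| ≤ C := fun p => by
    obtain ⟨C, hC⟩ := ((isCompact_cube d S).prod (isCompact_cube d S)).exists_bound_of_continuousOn
      (hR p.1 p.2).2.2.continuousOn
    exact ⟨C, fun z => hC (z.1, z.2) ⟨z.1.2, z.2.2⟩⟩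
  choose C hC using hb
  refine le_ciSup (f := fun p : (Option (Fin d) × Option (Fin d)) × (cube d S × cube d S) =>
    |mixedPDeriv p.1.1 p.1.2 R p.2.1 p.2.2|) ⟨⨆ p, C p, ?_⟩ ((α, β), (⟨x, hx⟩, ⟨y, hy⟩))
  rintro _ ⟨p, rfl⟩
  exact (hC p.1 p.2).trans (le_ciSup (Set.finite_range C).bddAbove p.1)

lemma abs_sub_le_of_pderiv_le {d : ℕ} {i : Fin d} {g : EuclideanSpace ℝ (Fin d) → ℝ}
    (hg : HasPDeriv (some i) g) (y : EuclideanSpace ℝ (Fin d)) (t C : ℝ)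
    (hC : ∀ τ ∈ Set.uIcc 0 t, |pderiv (some i) g (y + τ • EuclideanSpace.single i 1)| ≤ C) :
    |g (y + t • EuclideanSpace.single i 1) - g y| ≤ C * |t| := by
  set e : EuclideanSpace ℝ (Fin d) := EuclideanSpace.single i 1
  have hd : ∀ τ : ℝ, HasDerivAt (fun s : ℝ => g (y + s • e)) (pderiv (some i) g (y + τ • e)) τ := by
    intro τ
    have h1 : HasDerivAt (fun s : ℝ => g ((y + τ • e) + s • e))
        (pderiv (some i) g (y + τ • e)) (τ - τ) := by
      rw [sub_self]
      exact (hg (y + τ • e)).hasLineDerivAt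
    have h2 := h1.comp_sub_const τ τ
    refine h2.congr_of_eventuallyEq (.of_forall fun s => ?_)
    simp only
    congr 1
    module
  have := (convex_uIcc (0 : ℝ) t).norm_image_sub_le_of_norm_hasDerivWithin_le
    (fun τ _ => (hd τ).hasDerivWithinAt) hC Set.left_mem_uIcc Set.right_mem_uIcc
  simpa using this

/-! ### The feature map of a reproducing kernel Hilbert space -/

section Feature

variable {d : ℕ} (H : Type*) [NormedAddCommGroup H] [InnerProductSpace ℝ H] [CompleteSpace H]
  [RKHS ℝ H (EuclideanSpace ℝ (Fin d)) ℝ]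

/-- The Riesz representer of the evaluation at `x`. -/
noncomputable def feat (x : EuclideanSpace ℝ (Fin d)) : H := RKHS.kerFun H x (1 : ℝ)

variable {H}

lemma inner_feat (f : H) (x : EuclideanSpace ℝ (Fin d)) : inner ℝ f (feat H x) = f x := by
  simp [feat]

variable {R : EuclideanSpace ℝ (Fin d) → EuclideanSpace ℝ (Fin d) → ℝ}

lemma inner_feat_feat (hk : ∀ x y, RKHS.kernel H x y (1 : ℝ) = R x y)
    (x y : EuclideanSpace ℝ (Fin d)) : inner ℝ (feat H x) (feat H y) = R x y := by
  rw [real_inner_comm, inner_feat, feat, RKHS.kerFun_apply, hk]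

/-- The squared distance is arranged as a second difference of `R`, one difference in each argument,
ready for two applications of the mean value inequality. -/
lemma norm_feat_sub_sq (hk : ∀ x y, RKHS.kernel H x y (1 : ℝ) = R x y)
    (x y : EuclideanSpace ℝ (Fin d)) :
    ‖feat H x - feat H y‖ ^ 2 = (R x x - R y x) - (R x y - R y y) := by
  rw [norm_sub_sq_real, ← real_inner_self_eq_norm_sq, ← real_inner_self_eq_norm_sq,
    inner_feat_feat hk, inner_feat_feat hk, inner_feat_feat hk]
  have : R x y = R y x := by
    rw [← inner_feat_feat hk, ← inner_feat_feat hk, real_inner_comm]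
  rw [this]
  ring

lemma continuous_feat (hk : ∀ x y, RKHS.kernel H x y (1 : ℝ) = R x y) (hR : IsC11 R) :
    Continuous (feat H : EuclideanSpace ℝ (Fin d) → H) := by
  have hc : Continuous fun z : EuclideanSpace ℝ (Fin d) × EuclideanSpace ℝ (Fin d) => R z.1 z.2 :=
    (hR none none).2.2
  rw [continuous_iff_continuousAt]
  intro y
  rw [ContinuousAt, tendsto_iff_norm_sub_tendsto_zero]
  have h1 : Continuous fun x => (R x x - R y x) - (R x y - R y y) := by
    refine ((hc.comp (continuous_id.prodMk continuous_id)).sub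
      (hc.comp (continuous_const.prodMk continuous_id))).sub
      ((hc.comp (continuous_id.prodMk continuous_const)).sub continuous_const)
  have h2 := (Real.continuous_sqrt.comp h1).tendsto y
  simpa [← norm_feat_sub_sq hk, Function.comp_def] using h2

lemma norm_feat_le (hk : ∀ x y, RKHS.kernel H x y (1 : ℝ) = R x y) (hR : IsC11 R) {S : ℝ}
    {x : EuclideanSpace ℝ (Fin d)} (hx : x ∈ cube d S) : ‖feat H x‖ ≤ √(Mstar S R) := by
  refine Real.le_sqrt_of_sq_le ?_
  rw [← real_inner_self_eq_norm_sq, inner_feat_feat hk]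
  exact (le_abs_self _).trans (abs_mixedPDeriv_le_Mstar hR none none hx hx)

/-- Along a coordinate direction the second difference of `R` is at most t² times a bound for its
mixed derivative: the mean value inequality is used once in the second argument and once in the
first. The feature map itself is never differentiated. -/
lemma norm_feat_add_single_sub_le (hk : ∀ x y, RKHS.kernel H x y (1 : ℝ) = R x y)
    (hR : IsC11 R) {S : ℝ} {y : EuclideanSpace ℝ (Fin d)} (i : Fin d) (t : ℝ)
    (hy : ∀ τ ∈ Set.uIcc 0 t, y + τ • EuclideanSpace.single i 1 ∈ cube d S) :
    ‖feat H (y + t • EuclideanSpace.single i 1) - feat H y‖ ≤ √(Mstar S R) * |t| := by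
  have hM : 0 ≤ Mstar S R := by
    have h0 := hy 0 Set.left_mem_uIcc
    exact (abs_nonneg _).trans (abs_mixedPDeriv_le_Mstar hR none none h0 h0)
  set e : EuclideanSpace ℝ (Fin d) := EuclideanSpace.single i 1
  refine (sq_le_sq₀ (by positivity) (by positivity)).1 ?_
  rw [norm_feat_sub_sq hk, mul_pow, Real.sq_sqrt hM, sq, ← mul_assoc]
  have hD : HasPDeriv (some i) fun z => R (y + t • e) z - R y z := fun z =>
    ((hR none (some i)).1 (y + t • e) z).sub ((hR none (some i)).1 y z)
  refine (le_abs_self _).trans (abs_sub_le_of_pderiv_le hD y t _ fun τ hτ => ?_)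
  have h1 : pderiv (some i) (fun z => R (y + t • e) z - R y z) (y + τ • e) =
      pderiv (some i) (R (y + t • e)) (y + τ • e) - pderiv (some i) (R y) (y + τ • e) :=
    deriv_sub ((hR none (some i)).1 (y + t • e) (y + τ • e))
      ((hR none (some i)).1 y (y + τ • e))
  rw [h1]
  exact abs_sub_le_of_pderiv_le ((hR (some i) (some i)).2.1 (y + τ • e)) y t _ fun τ' hτ' =>
    abs_mixedPDeriv_le_Mstar hR (some i) (some i) (hy τ' hτ') (hy τ hτ)

lemma norm_feat_sub_le (hk : ∀ x y, RKHS.kernel H x y (1 : ℝ) = R x y) (hR : IsC11 R) {S : ℝ}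
    {x y : EuclideanSpace ℝ (Fin d)} (hx : x ∈ cube d S) (hy : y ∈ cube d S) :
    ‖feat H x - feat H y‖ ≤ d * √(Mstar S R) * ‖x - y‖ := by
  classical
  -- The path from `y` to `x` replaces one coordinate at a time. It stays in the cube because the
  -- cube is a product; the number of segments gives the factor `d`.
  set mix : Finset (Fin d) → EuclideanSpace ℝ (Fin d) := fun s =>
    WithLp.toLp 2 fun i => if i ∈ s then x i else y i
  have key : ∀ s, ‖feat H (mix s) - feat H y‖ ≤ √(Mstar S R) * ∑ i ∈ s, |x i - y i| := by
    intro s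
    induction s using Finset.induction_on with
    | empty =>
      have : mix ∅ = y := by ext i; simp [mix]
      simp [this]
    | insert i s hi ih =>
      have e1 : mix (insert i s) = mix s + (x i - y i) • EuclideanSpace.single i 1 := by
        ext j
        by_cases hj : j = i
        · subst hj; simp [mix, hi]
        · simp [mix, hj]
      have h1 : ‖feat H (mix (insert i s)) - feat H (mix s)‖ ≤ √(Mstar S R) * |x i - y i| := by
        rw [e1]
        refine norm_feat_add_single_sub_le hk hR i _ fun τ hτ j => ?_
        by_cases hj : j = i
        · subst hj
          have hx' := hx j
          have hy' := hy j
          simp only [mix, PiLp.add_apply, hi, if_false, PiLp.smul_apply, smul_eq_mul,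
            PiLp.single_apply, if_true, mul_one]
          rcases Set.mem_uIcc.1 hτ with h | h <;>
            exact ⟨by linarith [hx'.1, hy'.1], by linarith [hx'.2, hy'.2]⟩
        · simp only [mix, PiLp.add_apply, PiLp.smul_apply, smul_eq_mul,
            PiLp.single_apply, hj, if_false, mul_zero, add_zero]
          split_ifs
          exacts [hx j, hy j]
      rw [Finset.sum_insert hi, mul_add]
      calc _ ≤ ‖feat H (mix (insert i s)) - feat H (mix s)‖ + ‖feat H (mix s) - feat H y‖ :=
            norm_sub_le_norm_sub_add_norm_sub _ _ _
        _ ≤ _ := add_le_add h1 ih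
  have h2 := key Finset.univ
  have e2 : mix Finset.univ = x := by ext i; simp [mix]
  rw [e2] at h2
  refine h2.trans ?_
  rw [mul_comm (d : ℝ), mul_assoc]
  gcongr
  calc ∑ i, |x i - y i| ≤ ∑ _i : Fin d, ‖x - y‖ := by
        gcongr with i _
        exact PiLp.norm_apply_le (x - y) i
    _ = _ := by simp

end Feature

/-! ### The trace -/

section Trace

variable {H : Type*} [NormedAddCommGroup H] [InnerProductSpace ℝ H]

lemma sq_inner_apply_le {T : H →L[ℝ] H} (hT : T.IsPositive) (x y : H) :
    inner ℝ (T x) y ^ 2 ≤ inner ℝ (T x) x * inner ℝ (T y) y := by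
  have h := LinearMap.BilinForm.apply_sq_le_of_symm
    ((innerₗ H).comp (T : H →ₗ[ℝ] H)) (fun x => hT.inner_nonneg_left x)
    ⟨fun x y => by
      simp only [LinearMap.comp_apply, innerₗ_apply_apply, RingHom.id_apply,
        ContinuousLinearMap.coe_coe]
      rw [real_inner_comm]
      exact (hT.isSymmetric _ _).symm⟩ x y
  simpa using h

variable [CompleteSpace H]

lemma opTrace_nonneg {T : H →L[ℝ] H} (hT : IsPosTraceClass T) : 0 ≤ opTrace T :=
  tsum_nonneg fun _ => hT.1.inner_nonneg_left _

/-- The quadratic form of a positive operator is bounded by its trace. In the basis that defines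
`opTrace`, off-diagonal entries are at most the geometric mean of diagonal ones (Cauchy–Schwarz for
a positive form), and Cauchy–Schwarz for finite sums followed by a limit concludes. -/
lemma inner_apply_le_opTrace {T : H →L[ℝ] H} (hT : IsPosTraceClass T) (g : H) :
    inner ℝ (T g) g ≤ opTrace T * ‖g‖ ^ 2 := by
  set b := (exists_hilbertBasis ℝ H).choose_spec.choose
  set q : H → ℝ := fun x => inner ℝ (T x) x
  have hq : ∀ x, 0 ≤ q x := fun x => hT.1.inner_nonneg_left x
  have hsum : Summable fun i => q (b i) := hT.2 _ b
  have hlim : Tendsto (fun s => q (∑ i ∈ s, b.repr g i • b i)) atTop (𝓝 (q g)) := by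
    have hc : Continuous q := by fun_prop
    exact (hc.tendsto g).comp (b.hasSum_repr g)
  refine le_of_tendsto hlim (.of_forall fun s => ?_)
  have h1 : ∑ i ∈ s, b.repr g i ^ 2 ≤ ‖g‖ ^ 2 := by
    have := b.orthonormal.sum_inner_products_le g (s := s)
    simpa [b.repr_apply_apply] using this
  have h2 : ∑ i ∈ s, q (b i) ≤ opTrace T := hsum.sum_le_tsum s fun i _ => hq _
  have h3 : ∀ i j, |inner ℝ (T (b i)) (b j)| ≤ √(q (b i)) * √(q (b j)) := fun i j => by
    rw [← Real.sqrt_mul (hq _)]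
    exact Real.abs_le_sqrt (sq_inner_apply_le hT.1 _ _)
  calc q (∑ i ∈ s, b.repr g i • b i)
      = ∑ i ∈ s, ∑ j ∈ s, b.repr g i * (b.repr g j * inner ℝ (T (b i)) (b j)) := by
        simp only [q, map_sum, map_smul, sum_inner, inner_sum, inner_smul_left, inner_smul_right,
          Finset.mul_sum]
        rw [Finset.sum_comm]
        refine Finset.sum_congr rfl fun i _ => Finset.sum_congr rfl fun j _ => ?_
        simp only [RCLike.conj_to_real]
        ring
    _ ≤ ∑ i ∈ s, ∑ j ∈ s, |b.repr g i| * (|b.repr g j| * (√(q (b i)) * √(q (b j)))) := by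
        refine Finset.sum_le_sum fun i _ => Finset.sum_le_sum fun j _ => ?_
        refine (le_abs_self _).trans ?_
        rw [abs_mul, abs_mul]
        gcongr
        exact h3 i j
    _ = (∑ i ∈ s, |b.repr g i| * √(q (b i))) ^ 2 := by
        rw [sq, Finset.sum_mul_sum]
        exact Finset.sum_congr rfl fun i _ => Finset.sum_congr rfl fun j _ => by ring
    _ ≤ (∑ i ∈ s, |b.repr g i| ^ 2) * ∑ i ∈ s, √(q (b i)) ^ 2 :=
        Finset.sum_mul_sq_le_sq_mul_sq _ _ _
    _ = (∑ i ∈ s, b.repr g i ^ 2) * ∑ i ∈ s, q (b i) := by simp [Real.sq_sqrt (hq _)]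
    _ ≤ ‖g‖ ^ 2 * opTrace T := by
        gcongr
        exact Finset.sum_nonneg fun i _ => hq _
    _ = _ := mul_comm _ _

end Trace

end Ridgelet

namespace Ridgelet

/-! ### Conditional second moments -/

section CondExp

variable {Ω : Type*} [MeasurableSpace Ω] {P : Measure Ω}
  {A B : Type*} [mA : MeasurableSpace A] [mB : MeasurableSpace B]

/-- Outside one null set the versions agree on a countable dense subset of `𝒳`, and continuity does
the rest. A bound for one explicit version thus holds for all. -/
lemma IsContCondExp.ae_eq {T : Type*} [TopologicalSpace T] [SecondCountableTopology T]
    {θ : Ω → A} {𝒳 : Set T} {Y V W : T → Ω → ℝ} (hV : IsContCondExp P θ 𝒳 Y V)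
    (hW : IsContCondExp P θ 𝒳 Y W) : ∀ᵐ ω ∂P, ∀ x ∈ 𝒳, V x ω = W x ω := by
  obtain ⟨s, hsc, hsd⟩ := TopologicalSpace.exists_countable_dense 𝒳
  have h1 : ∀ᵐ ω ∂P, ∀ x ∈ s, V x ω = W x ω := by
    rw [ae_ball_iff hsc]
    intro x _
    exact (hV.version x x.2).trans (hW.version x x.2).symm
  filter_upwards [h1, hV.continuousOn, hW.continuousOn] with ω hω hVω hWω x hx
  have := Continuous.ext_on hsd (continuousOn_iff_continuous_domRestrict.1 hVω)
    (continuousOn_iff_continuous_domRestrict.1 hWω) fun y hy => hω y hy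
  exact congrFun this ⟨x, hx⟩

variable [IsProbabilityMeasure P]

/-- The square is expanded into products. In each, the factor in θ is pulled out of the conditional
expectation, while the factor in `F` is independent of θ and contributes its mean. -/
lemma integrable_sq_sum_and_condExp {ι : Type*} [Fintype ι] {θ : Ω → A} {F : Ω → B}
    (hθ : Measurable θ) (hF : Measurable F) (hind : IndepFun F θ P) (c : ι → A → ℝ)
    (G : ι → B → ℝ) (hc : ∀ i, Measurable (c i)) (hG : ∀ i, Measurable (G i))
    (hc2 : ∀ i, MemLp (fun ω => c i (θ ω)) 2 P) (hG2 : ∀ i, MemLp (fun ω => G i (F ω)) 2 P) :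
    Integrable (fun ω => (∑ i, c i (θ ω) * G i (F ω)) ^ 2) P ∧
      P[fun ω => (∑ i, c i (θ ω) * G i (F ω)) ^ 2 | mA.comap θ] =ᵐ[P]
        fun ω => ∑ i, ∑ j, c i (θ ω) * c j (θ ω) * ∫ ω', G i (F ω') * G j (F ω') ∂P := by
  have e : (fun ω => (∑ i, c i (θ ω) * G i (F ω)) ^ 2) =
      ∑ i, ∑ j, (fun ω => c i (θ ω) * c j (θ ω)) * fun ω => G i (F ω) * G j (F ω) := by
    funext ω
    simp only [Finset.sum_apply, Pi.mul_apply, sq, Finset.sum_mul_sum]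
    exact Finset.sum_congr rfl fun i _ => Finset.sum_congr rfl fun j _ => by ring
  have hcc : ∀ i j, Integrable (fun ω => c i (θ ω) * c j (θ ω)) P := fun i j =>
    (hc2 i).integrable_mul (hc2 j)
  have hGG : ∀ i j, Integrable (fun ω => G i (F ω) * G j (F ω)) P := fun i j =>
    (hG2 i).integrable_mul (hG2 j)
  have hint : ∀ i j, Integrable ((fun ω => c i (θ ω) * c j (θ ω)) *
      fun ω => G i (F ω) * G j (F ω)) P := fun i j => by
    refine IndepFun.integrable_mul ?_ (hcc i j) (hGG i j)
    exact hind.symm.comp ((hc i).mul (hc j)) ((hG i).mul (hG j))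
  have hterm : ∀ i j, P[(fun ω => c i (θ ω) * c j (θ ω)) *
      (fun ω => G i (F ω) * G j (F ω)) | mA.comap θ] =ᵐ[P]
        fun ω => c i (θ ω) * c j (θ ω) * ∫ ω', G i (F ω') * G j (F ω') ∂P := fun i j => by
    have hsm : StronglyMeasurable[mA.comap θ] fun ω => c i (θ ω) * c j (θ ω) :=
      (((hc i).mul (hc j)).comp (comap_measurable θ)).stronglyMeasurable
    have h1 := condExp_mul_of_stronglyMeasurable_left hsm (hint i j) (hGG i j)
    have h2 : P[fun ω => G i (F ω) * G j (F ω) | mA.comap θ] =ᵐ[P]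
        fun _ => ∫ ω', G i (F ω') * G j (F ω') ∂P :=
      condExp_indep_eq (m₁ := mB.comap F) hF.comap_le hθ.comap_le
        (((hG i).mul (hG j)).comp (comap_measurable F)).stronglyMeasurable hind
    filter_upwards [h1, h2] with ω hω1 hω2
    rw [hω1, Pi.mul_apply, hω2]
  rw [e]
  refine ⟨integrable_finsetSum' _ fun i _ => integrable_finsetSum' _ fun j _ => hint i j, ?_⟩
  refine (condExp_finsetSum (fun i _ => integrable_finsetSum' _ fun j _ => hint i j) _).trans ?_
  have h3 : ∀ i, P[∑ j, (fun ω => c i (θ ω) * c j (θ ω)) *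
      (fun ω => G i (F ω) * G j (F ω)) | mA.comap θ] =ᵐ[P]
        fun ω => ∑ j, c i (θ ω) * c j (θ ω) * ∫ ω', G i (F ω') * G j (F ω') ∂P := fun i => by
    refine (condExp_finsetSum (fun j _ => hint i j) _).trans ?_
    filter_upwards [ae_all_iff.2 (hterm i)] with ω hω
    rw [Finset.sum_apply]
    exact Finset.sum_congr rfl fun j _ => hω j
  filter_upwards [ae_all_iff.2 h3] with ω hω
  rw [Finset.sum_apply]
  exact Finset.sum_congr rfl fun i _ => hω i

end CondExp

/-! ### Second moments of the process as a quadratic form on the Hilbert space -/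

section GP

variable {H : Type*} [NormedAddCommGroup H] [InnerProductSpace ℝ H]

/-- The second moment of `⟪F, g⟫`, as a function of the mean and the covariance operator. -/
noncomputable def secondMoment (mH : H) (K : H →L[ℝ] H) (g : H) : ℝ :=
  inner ℝ mH g ^ 2 + inner ℝ (K g) g

lemma secondMoment_sum {ι : Type*} [Fintype ι] (mH : H) (K : H →L[ℝ] H) (c : ι → ℝ) (g : ι → H) :
    secondMoment mH K (∑ i, c i • g i) =
      ∑ i, ∑ j, c i * c j * (inner ℝ mH (g i) * inner ℝ mH (g j) + inner ℝ (K (g i)) (g j)) := by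
  have h1 : inner ℝ mH (∑ i, c i • g i) ^ 2 =
      ∑ i, ∑ j, c i * c j * (inner ℝ mH (g i) * inner ℝ mH (g j)) := by
    simp only [inner_sum, inner_smul_right, sq, Finset.sum_mul_sum]
    exact Finset.sum_congr rfl fun i _ => Finset.sum_congr rfl fun j _ => by ring
  have h2 : inner ℝ (K (∑ i, c i • g i)) (∑ i, c i • g i) =
      ∑ i, ∑ j, c i * c j * inner ℝ (K (g i)) (g j) := by
    simp only [map_sum, map_smul, sum_inner, inner_sum, inner_smul_left, inner_smul_right,
      RCLike.conj_to_real, Finset.mul_sum]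
    rw [Finset.sum_comm]
    exact Finset.sum_congr rfl fun i _ => Finset.sum_congr rfl fun j _ => by ring
  rw [secondMoment, h1, h2, ← Finset.sum_add_distrib]
  refine Finset.sum_congr rfl fun i _ => ?_
  rw [← Finset.sum_add_distrib]
  exact Finset.sum_congr rfl fun j _ => by ring

variable {d : ℕ} [RKHS ℝ H (EuclideanSpace ℝ (Fin d)) ℝ]
  {Ω : Type*} [MeasurableSpace Ω] {P : Measure Ω} {F : Ω → H}
  {m : EuclideanSpace ℝ (Fin d) → ℝ}
  {k : EuclideanSpace ℝ (Fin d) → EuclideanSpace ℝ (Fin d) → ℝ}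

lemma IsGP.memLp_two (hF : IsGP P (fun x ω => F ω x) m k) (x : EuclideanSpace ℝ (Fin d)) :
    MemLp (fun ω => F ω x) 2 P :=
  (hF.gaussian.hasGaussianLaw_eval x).memLp (by norm_num)

variable [CompleteSpace H]

lemma IsGP.integral_mul [IsProbabilityMeasure P] (hF : IsGP P (fun x ω => F ω x) m k)
    {mH : H} (hm : ∀ x, mH x = m x)
    {K : H →L[ℝ] H} (hK : IsCovOperator P F mH K) (x y : EuclideanSpace ℝ (Fin d)) :
    ∫ ω, F ω x * F ω y ∂P = mH x * mH y + inner ℝ (K (feat H x)) (feat H y) := by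
  have hx := hF.memLp_two x
  have hy := hF.memLp_two y
  have hcov := covariance_eq_sub hx hy
  rw [hK]
  simp only [inner_feat, RKHS.coe_sub, Pi.sub_apply, hm]
  have h2 : cov[fun ω => F ω x, fun ω => F ω y; P] = ∫ ω, (F ω x - m x) * (F ω y - m y) ∂P := by
    rw [covariance, hF.mean x, hF.mean y]
  rw [← h2, hcov, hF.mean x, hF.mean y]
  simp

/-- From here on, bounding the conditional error means bounding the norm of its representer. -/
lemma sqrt_secondMoment_le {mH : H} {K : H →L[ℝ] H} (hK : IsPosTraceClass K) (g : H) :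
    √(secondMoment mH K g) ≤ (‖mH‖ + √(opTrace K)) * ‖g‖ := by
  refine Real.sqrt_le_iff.2 ⟨by positivity, ?_⟩
  have h1 := inner_apply_le_opTrace hK g
  have h2 : inner ℝ mH g ^ 2 ≤ (‖mH‖ * ‖g‖) ^ 2 :=
    sq_le_sq' (abs_le.1 (abs_real_inner_le_norm mH g)).1 (real_inner_le_norm mH g)
  have h3 := Real.sq_sqrt (opTrace_nonneg hK)
  calc secondMoment mH K g ≤ (‖mH‖ * ‖g‖) ^ 2 + √(opTrace K) ^ 2 * ‖g‖ ^ 2 := by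
        rw [h3]; exact add_le_add h2 h1
    _ ≤ _ := by
        have : 0 ≤ ‖mH‖ * √(opTrace K) * ‖g‖ ^ 2 := by positivity
        nlinarith

end GP

end Ridgelet

namespace Ridgelet

/-! ### Rescaled densities -/

section Scaled

variable {V : Type*} [NormedAddCommGroup V] [InnerProductSpace ℝ V] [MeasureSpace V]

/-- The law with density `scaledDensity σ p`. -/
noncomputable def scaledLaw (σ : ℝ) (p : V → ℝ) : Measure V :=
  volume.withDensity fun w => ENNReal.ofReal (scaledDensity σ p w)

lemma paramLaw_eq {d : ℕ} (pw : EuclideanSpace ℝ (Fin d) → ℝ) (pb : ℝ → ℝ) (σw σb : ℝ) :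
    paramLaw pw pb σw σb = (scaledLaw σw pw).prod (scaledLaw σb pb) := rfl

variable {p : V → ℝ} {σ : ℝ}

lemma scaledDensity_nonneg (hp : IsBandwidthDensity p) (hσ : 0 < σ) (x : V) :
    0 ≤ scaledDensity σ p x := by
  have := hp.nonneg (σ⁻¹ • x)
  unfold scaledDensity
  positivity

variable [BorelSpace V]

lemma measurable_scaledDensity (hp : IsBandwidthDensity p) : Measurable (scaledDensity σ p) :=
  (hp.measurable.comp (measurable_const_smul (σ⁻¹ : ℝ))).const_mul _

variable {G : Type*} [NormedAddCommGroup G] [NormedSpace ℝ G]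

lemma integral_scaledLaw_eq (hp : IsBandwidthDensity p) (hσ : 0 < σ) (f : V → G) :
    ∫ x, f x ∂(scaledLaw σ p) = ∫ x, scaledDensity σ p x • f x := by
  rw [scaledLaw, integral_withDensity_eq_integral_toReal_smul
    (measurable_scaledDensity hp).ennreal_ofReal (.of_forall fun _ => ENNReal.ofReal_lt_top)]
  simp [ENNReal.toReal_ofReal (scaledDensity_nonneg hp hσ _)]

lemma integrable_scaledLaw_iff (hp : IsBandwidthDensity p) (hσ : 0 < σ) (f : V → G) :
    Integrable f (scaledLaw σ p) ↔ Integrable fun x => scaledDensity σ p x • f x := by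
  rw [scaledLaw, integrable_withDensity_iff_integrable_smul'
    (measurable_scaledDensity hp).ennreal_ofReal (.of_forall fun _ => ENNReal.ofReal_lt_top)]
  simp [ENNReal.toReal_ofReal (scaledDensity_nonneg hp hσ _)]

variable [FiniteDimensional ℝ V] [(volume : Measure V).IsAddHaarMeasure]

lemma integral_scaledLaw (hp : IsBandwidthDensity p) (hσ : 0 < σ) (f : V → G) :
    ∫ x, f x ∂(scaledLaw σ p) = ∫ x, p x • f (σ • x) := by
  rw [integral_scaledLaw_eq hp hσ]
  have h := Measure.integral_comp_inv_smul_of_nonneg volume (fun x => p x • f (σ • x)) hσ.le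
  simp only [smul_inv_smul₀ hσ.ne'] at h
  simp only [scaledDensity, mul_smul, integral_smul]
  rw [h, inv_smul_smul₀ (by positivity)]

lemma integrable_scaledLaw (hp : IsBandwidthDensity p) (hσ : 0 < σ) (f : V → G) :
    Integrable f (scaledLaw σ p) ↔ Integrable fun x => p x • f (σ • x) := by
  rw [integrable_scaledLaw_iff hp hσ]
  have h := integrable_comp_smul_iff volume (fun x => p x • f (σ • x)) (inv_ne_zero hσ.ne')
  simp only [smul_inv_smul₀ hσ.ne'] at h
  rw [← h]
  simp only [scaledDensity, mul_smul]
  exact integrable_smul_iff (c := (σ ^ Module.finrank ℝ V)⁻¹) (by positivity) _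

lemma isProbabilityMeasure_scaledLaw (hp : IsBandwidthDensity p) (hσ : 0 < σ) :
    IsProbabilityMeasure (scaledLaw σ p) := by
  have h1 : Integrable (fun _ => (1 : ℝ)) (scaledLaw σ p) := by
    rw [integrable_scaledLaw hp hσ]
    simpa using hp.integrable
  have h2 : ∫ _, (1 : ℝ) ∂(scaledLaw σ p) = 1 := by
    rw [integral_scaledLaw hp hσ]
    simpa using hp.integral_eq_one
  have : IsFiniteMeasure (scaledLaw σ p) := by
    simpa [integrable_const_iff] using h1
  refine ⟨?_⟩
  rw [integral_const, smul_eq_mul, mul_one, Measure.real] at h2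
  rw [← ENNReal.toReal_eq_one_iff]
  exact h2

lemma integrable_norm_sq_scaledLaw (hp : IsBandwidthDensity p) (hσ : 0 < σ) :
    Integrable (fun x => ‖x‖ ^ 2) (scaledLaw σ p) := by
  rw [integrable_scaledLaw hp hσ]
  refine (hp.second_moment.const_mul (σ ^ 2)).congr (.of_forall fun x => ?_)
  simp only [norm_smul, mul_pow, Real.norm_eq_abs, sq_abs, smul_eq_mul]
  ring

lemma integral_norm_sq_scaledLaw (hp : IsBandwidthDensity p) (hσ : 0 < σ) :
    ∫ x, ‖x‖ ^ 2 ∂(scaledLaw σ p) = σ ^ 2 * ∫ x, ‖x‖ ^ 2 * p x := by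
  rw [integral_scaledLaw hp hσ, ← integral_const_mul]
  congr 1
  funext x
  simp only [norm_smul, mul_pow, Real.norm_eq_abs, sq_abs, smul_eq_mul]
  ring

lemma integrable_norm_scaledLaw (hp : IsBandwidthDensity p) (hσ : 0 < σ) :
    Integrable (fun x => ‖x‖) (scaledLaw σ p) := by
  have := isProbabilityMeasure_scaledLaw hp hσ
  refine ((integrable_const 1).add (integrable_norm_sq_scaledLaw hp hσ)).mono'
    (by fun_prop) (.of_forall fun x => ?_)
  simp only [norm_norm, Pi.add_apply]
  nlinarith [sq_nonneg (‖x‖ - 1), norm_nonneg x]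

lemma integral_norm_scaledLaw (hp : IsBandwidthDensity p) (hσ : 0 < σ) :
    ∫ x, ‖x‖ ∂(scaledLaw σ p) = σ * ∫ x, ‖x‖ * p x := by
  rw [integral_scaledLaw hp hσ, ← integral_const_mul]
  congr 1
  funext x
  simp only [norm_smul, Real.norm_eq_abs, abs_of_pos hσ, smul_eq_mul]
  ring

end Scaled

/-! ### Fourier inversion -/

/-- Translation to the convention with 2π in the exponent, through which inversion theorems are
applied. -/
lemma fourier_eq {V : Type*} [NormedAddCommGroup V] [InnerProductSpace ℝ V] [MeasurableSpace V]
    [BorelSpace V] [FiniteDimensional ℝ V] (f : V → ℂ) (ξ : V) :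
    fourier f ξ = (((2 * Real.pi) ^ (-(Module.finrank ℝ V : ℝ) / 2) : ℝ) : ℂ) *
      FourierTransform.fourier f ((2 * Real.pi)⁻¹ • ξ) := by
  rw [fourier, Real.fourier_eq']
  congr 2
  funext x
  rw [smul_eq_mul, mul_comm, inner_smul_right, real_inner_comm]
  congr 2
  push_cast
  field_simp

lemma densHat_eq_ofReal {V : Type*} [NormedAddCommGroup V] [InnerProductSpace ℝ V] [MeasureSpace V]
    {p : V → ℝ} (hp : IsBandwidthDensity p) (ξ : V) :
    densHat p ξ = (((densHat p ξ).re : ℝ) : ℂ) :=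
  Complex.ext (by simp) (by simp [(hp.fourier_pos ξ).2])

lemma norm_densHat {V : Type*} [NormedAddCommGroup V] [InnerProductSpace ℝ V] [MeasureSpace V]
    {p : V → ℝ} (hp : IsBandwidthDensity p) (ξ : V) : ‖densHat p ξ‖ = (densHat p ξ).re := by
  conv_lhs => rw [densHat_eq_ofReal hp]
  rw [Complex.norm_real, Real.norm_of_nonneg (hp.fourier_pos ξ).1.le]

lemma integral_norm_densHat_pos {V : Type*} [NormedAddCommGroup V] [InnerProductSpace ℝ V]
    [MeasureSpace V] [(volume : Measure V).IsOpenPosMeasure] {p : V → ℝ}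
    (hp : IsBandwidthDensity p) : 0 < ∫ ξ, ‖densHat p ξ‖ := by
  rw [integral_pos_iff_support_of_nonneg (fun _ => norm_nonneg _) hp.fourier_integrable.norm]
  have : (Function.support fun ξ => ‖densHat p ξ‖) = Set.univ := by
    refine Set.eq_univ_of_forall fun ξ => ?_
    rw [Function.mem_support, norm_densHat hp]
    exact (hp.fourier_pos ξ).1.ne'
  rw [this]
  exact isOpen_univ.measure_pos volume ⟨0, trivial⟩

/-- The value at `0` of a density with integrable positive Fourier transform. -/
lemma density_zero_eq {p : ℝ → ℝ} (hp : IsBandwidthDensity p) (hc : Continuous p) :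
    p 0 = (2 * Real.pi) ^ (-(1 / 2) : ℝ) * ∫ ξ, ‖densHat p ξ‖ := by
  set c : ℝ := (2 * Real.pi) ^ (-(1 / 2) : ℝ)
  have hpi : (0 : ℝ) < 2 * Real.pi := by positivity
  have hc0 : 0 < c := by positivity
  have hcc : c * c * (2 * Real.pi) = 1 := by
    rw [← Real.rpow_add hpi, ← Real.rpow_add_one hpi.ne']
    norm_num
  set f : ℝ → ℂ := fun x => (p x : ℂ)
  have hF : ∀ η : ℝ, FourierTransform.fourier f η = ((c⁻¹ : ℝ) : ℂ) *
      densHat p ((2 * Real.pi) • η) := fun η => by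
    rw [densHat, fourier_eq, inv_smul_smul₀ hpi.ne', ← mul_assoc, ← Complex.ofReal_mul]
    have : (2 * Real.pi) ^ (-(Module.finrank ℝ ℝ : ℝ) / 2) = c := by
      simp [c, neg_div]
    rw [this, inv_mul_cancel₀ hc0.ne']
    simp [f]
  have hfi : Integrable f := hp.integrable.ofReal
  have hFi : Integrable (FourierTransform.fourier f) := by
    rw [funext hF]
    exact (hp.fourier_integrable.comp_smul hpi.ne').const_mul _
  have h := congrFun ((Complex.continuous_ofReal.comp hc).fourierInv_fourier_eq hfi hFi) 0
  rw [Real.fourierInv_eq'] at h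
  simp only [inner_zero_right, mul_zero, Complex.ofReal_zero, zero_mul, Complex.exp_zero,
    one_smul] at h
  change ∫ v, FourierTransform.fourier f v = _ at h
  simp only [hF, integral_const_mul] at h
  rw [Measure.integral_comp_smul_of_nonneg volume _ _ (hR := hpi.le)] at h
  -- Inversion at 0 gives the integral of the transform; positivity turns it into the L¹ norm, the
  -- quantity that occurs in `totalMass`.
  have h2 : ∫ x, densHat p x = ((∫ x, ‖densHat p x‖ : ℝ) : ℂ) := by
    rw [← integral_complex_ofReal]
    congr 1
    funext x
    rw [norm_densHat hp, ← densHat_eq_ofReal hp]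
  rw [h2] at h
  have h3 : c⁻¹ * ((2 * Real.pi)⁻¹ * ∫ x, ‖densHat p x‖) = p 0 := by
    have := congrArg Complex.re h
    simpa using this
  rw [← h3]
  have : c⁻¹ * (2 * Real.pi)⁻¹ = c := by
    rw [← mul_inv]
    exact inv_eq_of_mul_eq_one_right (by linarith)
  rw [← mul_assoc, this]

/-! ### The duality between the activation function and the ridgelet function -/

/-- The translated function `z ↦ ψ (z - s)`, as a complex Schwartz function. -/
noncomputable def translate (ψ : 𝓢(ℝ, ℝ)) (s : ℝ) : 𝓢(ℝ, ℂ) :=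
  SchwartzMap.compSubConstCLM ℝ s (ψ.postcompCLM Complex.ofRealCLM)

lemma translate_apply (ψ : 𝓢(ℝ, ℝ)) (s z : ℝ) : translate ψ s z = ((ψ (z - s) : ℝ) : ℂ) := by
  simp [translate, SchwartzMap.postcompCLM_apply]

/-- The Schwartz function `ξ ↦ conj (psiHat ψ ξ) * exp (i ξ s)`. -/
noncomputable def testFun (ψ : 𝓢(ℝ, ℝ)) (s : ℝ) : 𝓢(ℝ, ℂ) :=
  ((2 * Real.pi) ^ (-(1 / 2) : ℝ)) • SchwartzMap.compCLMOfContinuousLinearEquiv ℝ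
    (ContinuousLinearEquiv.smulLeft (Units.mk0 (2 * Real.pi)⁻¹ (by positivity)))
    (FourierTransformInv.fourierInv (translate ψ s))

lemma testFun_eq_fourierInv (ψ : 𝓢(ℝ, ℝ)) (s ξ : ℝ) :
    testFun ψ s ξ = (((2 * Real.pi) ^ (-(1 / 2) : ℝ) : ℝ) : ℂ) *
      FourierTransformInv.fourierInv (translate ψ s) ((2 * Real.pi)⁻¹ * ξ) := by
  rw [testFun, smul_apply, Complex.real_smul]
  rfl

lemma testFun_apply (ψ : 𝓢(ℝ, ℝ)) (s ξ : ℝ) :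
    testFun ψ s ξ = (starRingEnd ℂ) (psiHat ψ ξ) * Complex.exp (Complex.I * ((ξ * s : ℝ) : ℂ)) := by
  rw [testFun_eq_fourierInv, SchwartzMap.fourierInv_coe, Real.fourierInv_eq', psiHat, fourier,
    map_mul, Complex.conj_ofReal, mul_assoc]
  congr 1
  · simp [neg_div]
  rw [← integral_conj, ← integral_mul_const]
  simp only [translate_apply]
  rw [← integral_add_right_eq_self _ s]
  congr 1
  funext z
  simp only [add_sub_cancel_right, smul_eq_mul, map_mul, Complex.conj_ofReal, ← Complex.exp_conj,
    map_neg, Complex.conj_I]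
  rw [mul_comm, mul_assoc ((ψ z : ℝ) : ℂ), ← Complex.exp_add]
  congr 2
  simp
  field_simp

/-- Inversion again: with `testFun ψ s` as test function, the duality identity pairs the activation
with the translate of ψ by s. -/
lemma fourier_testFun (ψ : 𝓢(ℝ, ℝ)) (s x : ℝ) :
    fourier (fun y : ℝ => testFun ψ s y) x = ((ψ (x - s) : ℝ) : ℂ) := by
  have hpi : (0 : ℝ) < 2 * Real.pi := by positivity
  set c : ℝ := (2 * Real.pi) ^ (-(1 / 2) : ℝ)
  have hcc : c * c * (2 * Real.pi) = 1 := by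
    rw [← Real.rpow_add hpi, ← Real.rpow_add_one hpi.ne']
    norm_num
  have hc : (2 * Real.pi) ^ (-(Module.finrank ℝ ℝ : ℝ) / 2) = c := by
    simp [c, neg_div]
  have h1 : FourierTransform.fourier (FourierTransformInv.fourierInv (translate ψ s)) x =
      ((ψ (x - s) : ℝ) : ℂ) := by
    rw [FourierTransform.fourier_fourierInv_eq, translate_apply]
  rw [← h1, SchwartzMap.fourier_coe, Real.fourier_eq', fourier, hc]
  simp only [testFun_eq_fourierInv]
  have h2 := Measure.integral_comp_mul_left (fun η : ℝ =>
    Complex.exp (((-2 * Real.pi * inner ℝ η x : ℝ) : ℂ) * Complex.I) •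
      FourierTransformInv.fourierInv (translate ψ s) η) (2 * Real.pi)⁻¹
  rw [inv_inv, abs_of_pos hpi] at h2
  have h3 : ∀ ξ : ℝ, (c : ℂ) * FourierTransformInv.fourierInv (translate ψ s)
        ((2 * Real.pi)⁻¹ * ξ) * Complex.exp (-(Complex.I * ((inner ℝ x ξ : ℝ) : ℂ))) =
      (c : ℂ) * (Complex.exp (((-2 * Real.pi * inner ℝ ((2 * Real.pi)⁻¹ * ξ) x : ℝ) : ℂ) *
        Complex.I) • FourierTransformInv.fourierInv (translate ψ s) ((2 * Real.pi)⁻¹ * ξ)) := by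
    intro ξ
    rw [smul_eq_mul, mul_assoc, mul_comm (Complex.exp _)]
    congr 3
    simp
    field_simp
  change (c : ℂ) * ∫ ξ : ℝ, (c : ℂ) * FourierTransformInv.fourierInv (translate ψ s)
        ((2 * Real.pi)⁻¹ * ξ) * Complex.exp (-(Complex.I * ((inner ℝ x ξ : ℝ) : ℂ))) = _
  simp only [h3]
  rw [integral_const_mul, h2, ← mul_assoc, Complex.real_smul, ← mul_assoc, ← Complex.ofReal_mul,
    ← Complex.ofReal_mul, hcc, Complex.ofReal_one, one_mul]

lemma norm_testFun (ψ : 𝓢(ℝ, ℝ)) (s ξ : ℝ) : ‖testFun ψ s ξ‖ = ‖psiHat ψ ξ‖ := by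
  rw [testFun_apply, norm_mul, mul_comm Complex.I, Complex.norm_exp_ofReal_mul_I, mul_one,
    RCLike.norm_conj]

/-- The correlation of `ψ` and `φ`, in terms of their Fourier transforms. -/
lemma IsActivationPair.correlation {d : ℕ} {φ : ℝ → ℝ} {φhat : ℝ → ℂ} {ψ : 𝓢(ℝ, ℝ)}
    (h : IsActivationPair d φ φhat ψ) (s : ℝ) :
    Integrable (fun ξ => (starRingEnd ℂ) (psiHat ψ ξ) * φhat ξ *
        Complex.exp (Complex.I * ((ξ * s : ℝ) : ℂ))) ∧
      ∫ ξ, (starRingEnd ℂ) (psiHat ψ ξ) * φhat ξ * Complex.exp (Complex.I * ((ξ * s : ℝ) : ℂ)) =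
        ((∫ t, ψ t * φ (t + s) : ℝ) : ℂ) := by
  obtain ⟨m, hm, hv⟩ := h.genFourier
  -- Translating ψ only multiplies its transform by a phase, so the order of vanishing at 0 is
  -- preserved.
  have hv' : VanishesToOrder (2 * m) (testFun ψ s) :=
    (Asymptotics.isBigO_norm_left.1
      ((Asymptotics.isBigO_norm_left.2 hv).congr_left fun ξ => (norm_testFun ψ s ξ).symm))
  obtain ⟨h1, h2⟩ := hm.duality (testFun ψ s) hv'
  have e : ∀ ξ, φhat ξ * testFun ψ s ξ = (starRingEnd ℂ) (psiHat ψ ξ) * φhat ξ *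
      Complex.exp (Complex.I * ((ξ * s : ℝ) : ℂ)) := fun ξ => by
    rw [testFun_apply]; ring
  simp only [e] at h1 h2
  refine ⟨h1, h2.trans ?_⟩
  simp only [fourier_testFun, ← Complex.ofReal_mul]
  rw [integral_complex_ofReal]
  congr 1
  rw [← integral_add_right_eq_self _ s]
  congr 1
  funext t
  rw [add_sub_cancel_right, mul_comm]

end Ridgelet

namespace Ridgelet

/-! ### Pointwise bounds for the activation pair -/

/-- Quantitative bounds for an activation function and a ridgelet function. -/
structure ActBound (φ : ℝ → ℝ) (ψ : 𝓢(ℝ, ℝ)) (c : ℝ) : Prop where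
  pos : 0 < c
  growth : ∀ t, |φ t| ≤ c * (1 + |t|)
  lip : ∀ s t, |φ s - φ t| ≤ c * |s - t|
  decay : ∀ t, |ψ t| * (1 + |t|) ≤ c
  deriv_decay : ∀ t, |deriv ψ t| * (1 + |t|) ≤ c

lemma exists_actBound {φ : ℝ → ℝ} (hLip : ∃ L, LipschitzWith L φ) (ψ : 𝓢(ℝ, ℝ)) :
    ∃ c, ActBound φ ψ c := by
  obtain ⟨L, hL⟩ := hLip
  have hs : ∀ f : 𝓢(ℝ, ℝ), ∃ k : ℝ, ∀ t, |f t| * (1 + |t|) ≤ k := fun f => by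
    obtain ⟨C0, h0⟩ := f.decay 0 0
    obtain ⟨C1, h1⟩ := f.decay 1 0
    refine ⟨C0 + C1, fun t => ?_⟩
    have a0 := h0.2 t
    have a1 := h1.2 t
    simp only [pow_zero, one_mul, norm_iteratedFDeriv_zero, Real.norm_eq_abs, pow_one] at a0 a1
    linarith
  obtain ⟨k0, hk0⟩ := hs ψ
  obtain ⟨k1, hk1⟩ := hs (SchwartzMap.derivCLM ℝ ℝ ψ)
  have b0 : 0 ≤ k0 := le_trans (by positivity) (hk0 0)
  have b1 : 0 ≤ k1 := le_trans (by positivity) (hk1 0)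
  have hl : ∀ s t, |φ s - φ t| ≤ L * |s - t| := fun s t => by
    simpa [Real.dist_eq] using hL.dist_le_mul s t
  refine ⟨|φ 0| + L + k0 + k1 + 1, by positivity, fun t => ?_, fun s t => ?_, fun t => ?_,
    fun t => ?_⟩
  · have h1 := hl t 0
    have h2 := abs_sub_abs_le_abs_sub (φ t) (φ 0)
    rw [sub_zero] at h1
    have h3 : 0 ≤ (|φ 0| + k0 + k1 + 1) * |t| := by positivity
    have h4 : (0 : ℝ) ≤ L := L.2
    nlinarith
  · refine (hl s t).trans ?_
    gcongr
    linarith [abs_nonneg (φ 0)]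
  · linarith [hk0 t, abs_nonneg (φ 0), L.2, show (0 : ℝ) ≤ L from L.2]
  · have := hk1 t
    simp only [SchwartzMap.derivCLM_apply] at this
    linarith [abs_nonneg (φ 0), show (0 : ℝ) ≤ L from L.2]

namespace ActBound

variable {φ : ℝ → ℝ} {ψ : 𝓢(ℝ, ℝ)} {c : ℝ}

/-- Growth at `v` is traded for growth at `u`, where the decay of ψ pays for it, at the price 1 + |v
- u|. For u = w·y + b and v = w·x + b the bias cancels in v - u, so the resulting bounds depend on
‖w‖ alone. -/
lemma growth_shift (h : ActBound φ ψ c) (u v : ℝ) :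
    |φ v| ≤ c * (1 + |u|) * (1 + |v - u|) := by
  have h1 := h.growth u
  have h2 := h.lip v u
  have h3 := abs_sub_abs_le_abs_sub (φ v) (φ u)
  have h4 : 0 ≤ c * (|u| * |v - u|) := mul_nonneg h.pos.le (by positivity)
  nlinarith

lemma mul_le (h : ActBound φ ψ c) (u v : ℝ) : |ψ u * φ v| ≤ c ^ 2 * (1 + |v - u|) := by
  rw [abs_mul]
  calc |ψ u| * |φ v| ≤ |ψ u| * (c * (1 + |u|) * (1 + |v - u|)) := by
        gcongr; exact h.growth_shift u v
    _ = c * (|ψ u| * (1 + |u|)) * (1 + |v - u|) := by ring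
    _ ≤ c * c * (1 + |v - u|) := by
        have := h.pos.le
        gcongr; exact h.decay u
    _ = _ := by ring

lemma mul_sub_le (h : ActBound φ ψ c) {u u' v B : ℝ} (hu : |v - u| ≤ B) (hu' : |v - u'| ≤ B) :
    |ψ u * φ v - ψ u' * φ v| ≤ c ^ 2 * (1 + B) * |u - u'| := by
  have hc := h.pos.le
  -- Every τ between `u'` and `u` is still within `B` of `v`, so the derivative bound holds on the
  -- whole segment.
  have hd : ∀ τ ∈ Set.uIcc u' u, ‖deriv ψ τ * φ v‖ ≤ c ^ 2 * (1 + B) := by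
    intro τ hτ
    have hB : |v - τ| ≤ B := by
      rw [abs_le] at hu hu' ⊢
      rcases Set.mem_uIcc.1 hτ with h1 | h1 <;> constructor <;> linarith
    rw [Real.norm_eq_abs, abs_mul]
    calc |deriv ψ τ| * |φ v| ≤ |deriv ψ τ| * (c * (1 + |τ|) * (1 + |v - τ|)) := by
          gcongr; exact h.growth_shift τ v
      _ = c * (|deriv ψ τ| * (1 + |τ|)) * (1 + |v - τ|) := by ring
      _ ≤ c * c * (1 + B) := by
          gcongr; exact h.deriv_decay τ
      _ = _ := by ring
  have := (convex_uIcc u' u).norm_image_sub_le_of_norm_hasDerivWithin_le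
    (f := fun τ => ψ τ * φ v)
    (fun τ _ => ((ψ.differentiableAt (x := τ)).hasDerivAt.mul_const (φ v)).hasDerivWithinAt)
    hd Set.left_mem_uIcc Set.right_mem_uIcc
  simpa only [Real.norm_eq_abs] using this

lemma continuous (h : ActBound φ ψ c) : Continuous φ := by
  refine (LipschitzWith.of_dist_le_mul (K := ⟨c, h.pos.le⟩) fun s t => ?_).continuous
  rw [Real.dist_eq, Real.dist_eq]
  exact h.lip s t

lemma integrable_correlation (h : ActBound φ ψ c) (s : ℝ) :
    Integrable fun t => ψ t * φ (t + s) := by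
  have h0 : Integrable fun t => ‖t‖ ^ 1 * ‖ψ t‖ := ψ.integrable_pow_mul volume 1
  have h1 : Integrable fun t => ‖ψ t‖ := ψ.integrable.norm
  refine ((h1.add h0).const_mul (c * (1 + |s|))).mono'
    (ψ.continuous.mul (h.continuous.comp (continuous_id.add continuous_const))).aestronglyMeasurable
    (.of_forall fun t => ?_)
  rw [Real.norm_eq_abs, abs_mul]
  have := h.growth_shift t (t + s)
  rw [add_sub_cancel_left] at this
  calc |ψ t| * |φ (t + s)| ≤ |ψ t| * (c * (1 + |t|) * (1 + |s|)) := by gcongr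
    _ = _ := by simp only [Pi.add_apply, pow_one, Real.norm_eq_abs]; ring

end ActBound

/-! ### The kernel of the ridgelet operator -/

section Kernel

variable {d : ℕ}

/-- One summand of the ridgelet operator, as a function of the weight and the bias. -/
noncomputable def nodeFn (φ : ℝ → ℝ) (ψ : 𝓢(ℝ, ℝ)) (x y : EuclideanSpace ℝ (Fin d))
    (θ : EuclideanSpace ℝ (Fin d) × ℝ) : ℝ :=
  ψ (inner ℝ θ.1 y + θ.2) * φ (inner ℝ θ.1 x + θ.2)

variable {φ : ℝ → ℝ} {ψ : 𝓢(ℝ, ℝ)} {c : ℝ}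

lemma continuous_nodeFn (h : ActBound φ ψ c) (x y : EuclideanSpace ℝ (Fin d)) :
    Continuous (nodeFn φ ψ x y) := by
  have := h.continuous
  unfold nodeFn
  exact (ψ.continuous.comp (by fun_prop)).mul (this.comp (by fun_prop))

/-- A bound for the norms of the points of the cube. -/
noncomputable def cubeRadius (d : ℕ) (S : ℝ) : ℝ := √d * S

lemma abs_inner_sub_le {S : ℝ} {x y : EuclideanSpace ℝ (Fin d)} (hx : x ∈ cube d S)
    (hy : y ∈ cube d S) (w : EuclideanSpace ℝ (Fin d)) :
    |inner ℝ w (x - y)| ≤ 2 * cubeRadius d S * ‖w‖ := by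
  have h1 : ‖x - y‖ ≤ 2 * cubeRadius d S := by
    have := norm_sub_le x y
    have h2 := norm_le_of_mem_cube hx
    have h3 := norm_le_of_mem_cube hy
    unfold cubeRadius
    linarith
  calc _ ≤ ‖w‖ * ‖x - y‖ := abs_real_inner_le_norm _ _
    _ ≤ ‖w‖ * (2 * cubeRadius d S) := by gcongr
    _ = _ := mul_comm _ _

lemma abs_nodeFn_le (h : ActBound φ ψ c) {S : ℝ} {x y : EuclideanSpace ℝ (Fin d)}
    (hx : x ∈ cube d S) (hy : y ∈ cube d S) (θ : EuclideanSpace ℝ (Fin d) × ℝ) :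
    |nodeFn φ ψ x y θ| ≤ c ^ 2 * (1 + 2 * cubeRadius d S * ‖θ.1‖) := by
  refine (h.mul_le _ _).trans ?_
  have := abs_inner_sub_le hx hy θ.1
  rw [add_sub_add_right_eq_sub, ← inner_sub_right]
  gcongr

lemma abs_nodeFn_sub_le (h : ActBound φ ψ c) {S : ℝ} {x y y' : EuclideanSpace ℝ (Fin d)}
    (hx : x ∈ cube d S) (hy : y ∈ cube d S) (hy' : y' ∈ cube d S)
    (θ : EuclideanSpace ℝ (Fin d) × ℝ) :
    |nodeFn φ ψ x y θ - nodeFn φ ψ x y' θ| ≤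
      c ^ 2 * (‖θ.1‖ + 2 * cubeRadius d S * ‖θ.1‖ ^ 2) * ‖y - y'‖ := by
  have h1 : |(inner ℝ θ.1 x + θ.2) - (inner ℝ θ.1 y + θ.2)| ≤ 2 * cubeRadius d S * ‖θ.1‖ := by
    rw [add_sub_add_right_eq_sub, ← inner_sub_right]; exact abs_inner_sub_le hx hy θ.1
  have h2 : |(inner ℝ θ.1 x + θ.2) - (inner ℝ θ.1 y' + θ.2)| ≤ 2 * cubeRadius d S * ‖θ.1‖ := by
    rw [add_sub_add_right_eq_sub, ← inner_sub_right]; exact abs_inner_sub_le hx hy' θ.1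
  refine (h.mul_sub_le h1 h2).trans ?_
  rw [add_sub_add_right_eq_sub, ← inner_sub_right]
  have h3 := abs_real_inner_le_norm θ.1 (y - y')
  have h4 : 0 ≤ 2 * cubeRadius d S * ‖θ.1‖ := (abs_nonneg _).trans h1
  calc _ ≤ c ^ 2 * (1 + 2 * cubeRadius d S * ‖θ.1‖) * (‖θ.1‖ * ‖y - y'‖) := by gcongr
    _ = _ := by ring

variable {pw : EuclideanSpace ℝ (Fin d) → ℝ} {pb : ℝ → ℝ} {σw σb : ℝ}

lemma isProbabilityMeasure_paramLaw (hp : FiniteBandwidth pw pb) (hw : 0 < σw) (hb : 0 < σb) :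
    IsProbabilityMeasure (paramLaw pw pb σw σb) := by
  have := isProbabilityMeasure_scaledLaw hp.weight hw
  have := isProbabilityMeasure_scaledLaw hp.bias hb
  rw [paramLaw_eq]
  infer_instance

lemma integrable_norm_fst (hp : FiniteBandwidth pw pb) (hw : 0 < σw) (hb : 0 < σb) :
    Integrable (fun θ => ‖θ.1‖) (paramLaw pw pb σw σb) := by
  have := isProbabilityMeasure_scaledLaw hp.bias hb
  rw [paramLaw_eq]
  exact (integrable_norm_scaledLaw hp.weight hw).comp_fst _

lemma integrable_norm_sq_fst (hp : FiniteBandwidth pw pb) (hw : 0 < σw) (hb : 0 < σb) :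
    Integrable (fun θ => ‖θ.1‖ ^ 2) (paramLaw pw pb σw σb) := by
  have := isProbabilityMeasure_scaledLaw hp.bias hb
  rw [paramLaw_eq]
  exact (integrable_norm_sq_scaledLaw hp.weight hw).comp_fst _

lemma integral_norm_fst (hp : FiniteBandwidth pw pb) (hw : 0 < σw) (hb : 0 < σb) :
    ∫ θ, ‖θ.1‖ ∂(paramLaw pw pb σw σb) = σw * ∫ x, ‖x‖ * pw x := by
  have := isProbabilityMeasure_scaledLaw hp.bias hb
  have := isProbabilityMeasure_scaledLaw hp.weight hw
  rw [paramLaw_eq, integral_fun_fst (fun w : EuclideanSpace ℝ (Fin d) => ‖w‖)]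
  simp [integral_norm_scaledLaw hp.weight hw]

lemma integral_norm_sq_fst (hp : FiniteBandwidth pw pb) (hw : 0 < σw) (hb : 0 < σb) :
    ∫ θ, ‖θ.1‖ ^ 2 ∂(paramLaw pw pb σw σb) = σw ^ 2 * ∫ x, ‖x‖ ^ 2 * pw x := by
  have := isProbabilityMeasure_scaledLaw hp.bias hb
  have := isProbabilityMeasure_scaledLaw hp.weight hw
  rw [paramLaw_eq, integral_fun_fst (fun w : EuclideanSpace ℝ (Fin d) => ‖w‖ ^ 2)]
  simp [integral_norm_sq_scaledLaw hp.weight hw]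

lemma memLp_nodeFn (h : ActBound φ ψ c) (hp : FiniteBandwidth pw pb) (hw : 0 < σw) (hb : 0 < σb)
    {S : ℝ} {x y : EuclideanSpace ℝ (Fin d)} (hx : x ∈ cube d S) (hy : y ∈ cube d S) :
    MemLp (nodeFn φ ψ x y) 2 (paramLaw pw pb σw σb) := by
  have := isProbabilityMeasure_paramLaw hp hw hb
  have h1 : MemLp (fun θ : EuclideanSpace ℝ (Fin d) × ℝ => ‖θ.1‖) 2 (paramLaw pw pb σw σb) :=
    (memLp_two_iff_integrable_sq (by fun_prop)).2 (integrable_norm_sq_fst hp hw hb)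
  have h2 := (((memLp_const (1 : ℝ)).add (h1.const_mul (2 * cubeRadius d S))).const_mul (c ^ 2))
  exact h2.mono' (continuous_nodeFn h x y).aestronglyMeasurable
    (.of_forall fun θ => abs_nodeFn_le h hx hy θ)

lemma integrable_nodeFn (h : ActBound φ ψ c) (hp : FiniteBandwidth pw pb) (hw : 0 < σw)
    (hb : 0 < σb) {S : ℝ} {x y : EuclideanSpace ℝ (Fin d)} (hx : x ∈ cube d S)
    (hy : y ∈ cube d S) : Integrable (nodeFn φ ψ x y) (paramLaw pw pb σw σb) := by
  have := isProbabilityMeasure_paramLaw hp hw hb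
  exact (memLp_nodeFn h hp hw hb hx hy).integrable (by norm_num)

lemma first_moment_nonneg (hp : FiniteBandwidth pw pb) : 0 ≤ ∫ x, ‖x‖ * pw x :=
  integral_nonneg fun x => mul_nonneg (norm_nonneg x) (hp.weight.nonneg x)

lemma second_moment_nonneg (hp : FiniteBandwidth pw pb) : 0 ≤ ∫ x, ‖x‖ ^ 2 * pw x :=
  integral_nonneg fun x => mul_nonneg (by positivity) (hp.weight.nonneg x)

/-- Size and Lipschitz constant in `y` of the averaged kernel, as the cubature estimate needs them.
The pointwise bounds are at most quadratic in ‖w‖, whence (σ_w + 1)². -/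
lemma exists_abs_integral_nodeFn_le (h : ActBound φ ψ c) (hp : FiniteBandwidth pw pb) {S : ℝ}
    (hS : 0 < S) :
    ∃ C : ℝ, 0 ≤ C ∧ ∀ σw σb : ℝ, 0 < σw → 0 < σb →
      ∀ x ∈ cube d S, ∀ y ∈ cube d S, ∀ y' ∈ cube d S,
      |∫ θ, nodeFn φ ψ x y θ ∂(paramLaw pw pb σw σb)| ≤ C * (σw + 1) ^ 2 ∧
      |(∫ θ, nodeFn φ ψ x y θ ∂(paramLaw pw pb σw σb)) -
        ∫ θ, nodeFn φ ψ x y' θ ∂(paramLaw pw pb σw σb)| ≤ C * (σw + 1) ^ 2 * ‖y - y'‖ := by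
  set ρ := cubeRadius d S
  have hρ : 0 ≤ ρ := by unfold ρ cubeRadius; positivity
  set m1 := ∫ x, ‖x‖ * pw x
  set m2 := ∫ x, ‖x‖ ^ 2 * pw x
  have hm1 : 0 ≤ m1 := first_moment_nonneg hp
  have hm2 : 0 ≤ m2 := second_moment_nonneg hp
  refine ⟨c ^ 2 * (1 + m1 + 2 * ρ * m1 + 2 * ρ * m2), by positivity, ?_⟩
  intro σw σb hw hb x hx y hy y' hy'
  have := isProbabilityMeasure_paramLaw hp hw hb
  have i1 := integrable_norm_fst hp hw hb
  have i2 := integrable_norm_sq_fst hp hw hb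
  constructor
  · calc _ ≤ ∫ θ, |nodeFn φ ψ x y θ| ∂(paramLaw pw pb σw σb) := abs_integral_le_integral_abs
      _ ≤ ∫ θ, c ^ 2 * (1 + 2 * ρ * ‖θ.1‖) ∂(paramLaw pw pb σw σb) :=
          integral_mono (integrable_nodeFn h hp hw hb hx hy).abs
            (((integrable_const _).add (i1.const_mul _)).const_mul _)
            (fun θ => abs_nodeFn_le h hx hy θ)
      _ = c ^ 2 * (1 + 2 * ρ * (σw * m1)) := by
          rw [integral_const_mul, integral_add (integrable_const _) (i1.const_mul _),
            integral_const_mul, integral_norm_fst hp hw hb]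
          simp [m1]
      _ ≤ _ := by
          rw [mul_assoc (c ^ 2) _ ((σw + 1) ^ 2)]
          gcongr
          have a1 : 0 ≤ m1 * (σw + 1) ^ 2 := by positivity
          have a2 : 0 ≤ ρ * m2 * (σw + 1) ^ 2 := by positivity
          have a3 : 0 ≤ ρ * m1 * (σw ^ 2 + σw + 1) := by positivity
          nlinarith
  · rw [← integral_sub (integrable_nodeFn h hp hw hb hx hy) (integrable_nodeFn h hp hw hb hx hy')]
    calc _ ≤ ∫ θ, |nodeFn φ ψ x y θ - nodeFn φ ψ x y' θ| ∂(paramLaw pw pb σw σb) :=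
          abs_integral_le_integral_abs
      _ ≤ ∫ θ, c ^ 2 * (‖θ.1‖ + 2 * ρ * ‖θ.1‖ ^ 2) * ‖y - y'‖ ∂(paramLaw pw pb σw σb) :=
          integral_mono ((integrable_nodeFn h hp hw hb hx hy).sub
            (integrable_nodeFn h hp hw hb hx hy')).abs
            (((i1.add (i2.const_mul _)).const_mul _).mul_const _)
            (fun θ => abs_nodeFn_sub_le h hx hy hy' θ)
      _ = c ^ 2 * (σw * m1 + 2 * ρ * (σw ^ 2 * m2)) * ‖y - y'‖ := by
          rw [integral_mul_const, integral_const_mul, integral_add i1 (i2.const_mul _),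
            integral_const_mul, integral_norm_fst hp hw hb, integral_norm_sq_fst hp hw hb]
      _ ≤ _ := by
          rw [mul_assoc (c ^ 2) _ ((σw + 1) ^ 2)]
          gcongr
          have a1 : 0 ≤ m1 * (σw ^ 2 + σw + 1) := by positivity
          have a2 : 0 ≤ ρ * m2 * (2 * σw + 1) := by positivity
          have a3 : 0 ≤ ρ * m1 * (σw + 1) ^ 2 := by positivity
          nlinarith

/-! ### Large bias bandwidth -/

/-- Boundedness in L^∞ holds only almost everywhere; continuity of the density makes it hold
everywhere. -/
lemma exists_density_bounds {pb : ℝ → ℝ} (hb : IsBandwidthDensity pb) (hd : Differentiable ℝ pb)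
    (hM : ∃ M : ℝ, ∀ b, |deriv pb b| ≤ M) :
    ∃ M : ℝ, 0 ≤ M ∧ (∀ b, pb b ≤ M) ∧ ∀ a b, |pb a - pb b| ≤ M * |a - b| := by
  obtain ⟨M, hM⟩ := hM
  have hM0 : 0 ≤ M := (abs_nonneg _).trans (hM 0)
  obtain ⟨B, hB⟩ : ∃ B : ℝ, ∀ b, pb b ≤ B := by
    obtain ⟨B, hB⟩ := eLpNormEssSup_lt_top_iff_isBoundedUnder.1 (by simpa using hb.bounded.2)
    refine ⟨B, fun b => ?_⟩
    have hae : ∀ᵐ x, pb x ≤ B := by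
      filter_upwards [hB] with x hx
      exact (le_abs_self _).trans hx
    have hcl : IsClosed {x | pb x ≤ B} := isClosed_le hd.continuous continuous_const
    have := (Measure.dense_of_ae hae).closure_eq
    rw [hcl.closure_eq] at this
    exact this.symm.le (Set.mem_univ b)
  refine ⟨M + |B|, by positivity, fun b => (hB b).trans ?_, fun a b => ?_⟩
  · linarith [le_abs_self B]
  · have := (convex_univ (𝕜 := ℝ) (E := ℝ)).norm_image_sub_le_of_norm_deriv_le
      (fun x _ => hd x) (fun x _ => hM x) (Set.mem_univ b) (Set.mem_univ a)
    simp only [Real.norm_eq_abs] at this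
    refine this.trans ?_
    gcongr
    linarith [abs_nonneg B]

/-- The correlation of `ψ` and `φ`. -/
noncomputable def corr (φ : ℝ → ℝ) (ψ : 𝓢(ℝ, ℝ)) (s : ℝ) : ℝ := ∫ t, ψ t * φ (t + s)

lemma measurable_corr (h : ActBound φ ψ c) : Measurable (corr φ ψ) := by
  have hc : Continuous fun z : ℝ × ℝ => ψ z.2 * φ (z.2 + z.1) :=
    (ψ.continuous.comp continuous_snd).mul (h.continuous.comp (continuous_snd.add continuous_fst))
  exact hc.stronglyMeasurable.integral_prod_right'.measurable

lemma scaledDensity_sub_le {M : ℝ} (hM : ∀ a b, |pb a - pb b| ≤ M * |a - b|) (hb : 0 < σb)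
    (a : ℝ) : |scaledDensity σb pb a - scaledDensity σb pb 0| ≤ M * |a| / σb ^ 2 := by
  simp only [scaledDensity, Module.finrank_self, pow_one, smul_eq_mul, mul_zero]
  rw [← mul_sub, abs_mul, abs_of_pos (by positivity : 0 < σb⁻¹)]
  have := hM (σb⁻¹ * a) 0
  rw [sub_zero, abs_mul, abs_of_pos (by positivity : 0 < σb⁻¹)] at this
  calc _ ≤ σb⁻¹ * (M * (σb⁻¹ * |a|)) := by gcongr
    _ = _ := by field_simp

/-- With t = u + b the integrand becomes ψ(t) φ(t+s) weighted by the density at t - u. Replacing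
that weight by its value at 0 leaves the correlation, free of `u`. The error M|t-u|/σ_b² contains
one power of 1/σ_b from the normalisation and one from the rescaled argument. -/
lemma abs_integral_bias_sub_le (h : ActBound φ ψ c) (hp : IsBandwidthDensity pb) {M : ℝ}
    (hM0 : 0 ≤ M) (hM : ∀ a b, |pb a - pb b| ≤ M * |a - b|) (hb : 0 < σb) (u s : ℝ) :
    |(∫ b, ψ (u + b) * φ (u + s + b) ∂(scaledLaw σb pb)) - scaledDensity σb pb 0 * corr φ ψ s| ≤
      M * c * (∫ t, |ψ t| * (1 + |t|) ^ 2) * ((1 + |s|) * (1 + |u|)) / σb ^ 2 := by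
  have := isProbabilityMeasure_scaledLaw hp hb
  have hφ := h.continuous
  set q := scaledDensity σb pb
  have hI : Integrable (fun b => ψ (u + b) * φ (u + s + b)) (scaledLaw σb pb) := by
    refine (integrable_const (c ^ 2 * (1 + |s|))).mono'
      ((ψ.continuous.comp (by fun_prop)).mul (hφ.comp (by fun_prop))).aestronglyMeasurable
      (.of_forall fun b => ?_)
    have := h.mul_le (u + b) (u + s + b)
    rwa [show u + s + b - (u + b) = s by ring] at this
  have hI2 : Integrable fun t => q (t - u) * (ψ t * φ (t + s)) := by
    have := (((integrable_scaledLaw_iff hp hb _).1 hI).comp_sub_right u)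
    refine this.congr (.of_forall fun t => ?_)
    simp only [smul_eq_mul]
    congr 3 <;> ring_nf
  have e1 : ∫ b, ψ (u + b) * φ (u + s + b) ∂(scaledLaw σb pb) =
      ∫ t, q (t - u) * (ψ t * φ (t + s)) := by
    rw [integral_scaledLaw_eq hp hb, ← integral_sub_right_eq_self _ u]
    congr 1
    funext t
    simp only [smul_eq_mul]
    congr 3 <;> ring_nf
  have hI3 : Integrable fun t => |ψ t| * (1 + |t|) ^ 2 := by
    have h0 : Integrable fun t => ‖ψ t‖ := ψ.integrable.norm
    have h1 : Integrable fun t => ‖t‖ ^ 1 * ‖ψ t‖ := ψ.integrable_pow_mul volume 1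
    have h2 : Integrable fun t => ‖t‖ ^ 2 * ‖ψ t‖ := ψ.integrable_pow_mul volume 2
    refine ((h0.add (h1.const_mul 2)).add h2).congr (.of_forall fun t => ?_)
    simp only [Pi.add_apply, Real.norm_eq_abs]
    ring
  rw [e1, corr, ← integral_const_mul, ← integral_sub hI2
    ((h.integrable_correlation s).const_mul (q 0))]
  calc _ ≤ ∫ t, |q (t - u) * (ψ t * φ (t + s)) - q 0 * (ψ t * φ (t + s))| :=
        abs_integral_le_integral_abs
    _ ≤ ∫ t, (M * c * ((1 + |s|) * (1 + |u|)) / σb ^ 2) * (|ψ t| * (1 + |t|) ^ 2) := by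
        refine integral_mono (hI2.sub ((h.integrable_correlation s).const_mul (q 0))).abs
          (hI3.const_mul _) fun t => ?_
        simp only
        rw [← sub_mul, abs_mul, abs_mul]
        have a1 := scaledDensity_sub_le hM hb (t - u)
        have a2 := h.growth_shift t (t + s)
        rw [add_sub_cancel_left] at a2
        have a3 : |t - u| ≤ (1 + |t|) * (1 + |u|) := by
          have := abs_sub t u
          nlinarith [abs_nonneg t, abs_nonneg u, mul_nonneg (abs_nonneg t) (abs_nonneg u)]
        calc _ ≤ (M * |t - u| / σb ^ 2) * (|ψ t| * (c * (1 + |t|) * (1 + |s|))) := by gcongr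
          _ ≤ (M * ((1 + |t|) * (1 + |u|)) / σb ^ 2) *
                (|ψ t| * (c * (1 + |t|) * (1 + |s|))) := by
              have := h.pos.le
              gcongr
          _ = _ := by ring
    _ = _ := by
        rw [integral_const_mul]
        ring

lemma abs_corr_le (h : ActBound φ ψ c) (s : ℝ) :
    |corr φ ψ s| ≤ c * (∫ t, |ψ t| * (1 + |t|)) * (1 + |s|) := by
  have hI : Integrable fun t => |ψ t| * (1 + |t|) := by
    have h0 : Integrable fun t => ‖ψ t‖ := ψ.integrable.norm
    have h1 : Integrable fun t => ‖t‖ ^ 1 * ‖ψ t‖ := ψ.integrable_pow_mul volume 1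
    refine (h0.add h1).congr (.of_forall fun t => ?_)
    simp only [Pi.add_apply, Real.norm_eq_abs]
    ring
  calc |corr φ ψ s| ≤ ∫ t, |ψ t * φ (t + s)| := abs_integral_le_integral_abs
    _ ≤ ∫ t, (c * (1 + |s|)) * (|ψ t| * (1 + |t|)) := by
        refine integral_mono (h.integrable_correlation s).abs (hI.const_mul _) fun t => ?_
        simp only
        rw [abs_mul]
        have a2 := h.growth_shift t (t + s)
        rw [add_sub_cancel_left] at a2
        calc _ ≤ |ψ t| * (c * (1 + |t|) * (1 + |s|)) := by gcongr
          _ = _ := by ring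
    _ = _ := by
        rw [integral_const_mul]
        ring

lemma integrable_corr_inner (h : ActBound φ ψ c) (hp : IsBandwidthDensity pw) (hw : 0 < σw)
    (z : EuclideanSpace ℝ (Fin d)) :
    Integrable (fun w => corr φ ψ (inner ℝ w z)) (scaledLaw σw pw) := by
  have := isProbabilityMeasure_scaledLaw hp hw
  have hm : Measurable fun w : EuclideanSpace ℝ (Fin d) => corr φ ψ (inner ℝ w z) :=
    (measurable_corr h).comp (by fun_prop)
  refine (((integrable_const 1).add ((integrable_norm_scaledLaw hp hw).mul_const ‖z‖)).const_mul
    (c * (∫ t, |ψ t| * (1 + |t|)))).mono' hm.aestronglyMeasurable (.of_forall fun w => ?_)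
  refine (abs_corr_le h _).trans ?_
  have h1 : 0 ≤ ∫ t, |ψ t| * (1 + |t|) := integral_nonneg fun t => by positivity
  have h2 := h.pos.le
  simp only [Pi.add_apply]
  gcongr
  exact abs_real_inner_le_norm _ _

/-- The previous estimate with u = w·y and s = w·(x-y), integrated over `w`. The coefficients 3ρ and
2ρ² come from expanding (1 + 2ρ‖w‖)(1 + ρ‖w‖). -/
lemma exists_abs_integral_nodeFn_sub_le (h : ActBound φ ψ c) (hp : FiniteBandwidth pw pb) {S : ℝ}
    (hS : 0 < S) :
    ∃ C : ℝ, 0 ≤ C ∧ ∀ σw σb : ℝ, 0 < σw → 0 < σb → ∀ x ∈ cube d S, ∀ y ∈ cube d S,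
      |(∫ θ, nodeFn φ ψ x y θ ∂(paramLaw pw pb σw σb)) -
        scaledDensity σb pb 0 * ∫ w, corr φ ψ (inner ℝ w (x - y)) ∂(scaledLaw σw pw)| ≤
        C * (σw + 1) ^ 2 / σb ^ 2 := by
  obtain ⟨M, hM0, -, hM⟩ := exists_density_bounds hp.bias hp.bias_differentiable
    hp.bias_deriv_bounded
  set ρ := cubeRadius d S
  have hρ : 0 ≤ ρ := by unfold ρ cubeRadius; positivity
  set m1 := ∫ x, ‖x‖ * pw x
  set m2 := ∫ x, ‖x‖ ^ 2 * pw x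
  have hm1 : 0 ≤ m1 := first_moment_nonneg hp
  have hm2 : 0 ≤ m2 := second_moment_nonneg hp
  set I := ∫ t, |ψ t| * (1 + |t|) ^ 2
  have hI : 0 ≤ I := integral_nonneg fun t => by positivity
  have hc := h.pos.le
  refine ⟨M * c * I * (1 + 3 * ρ * m1 + 2 * ρ ^ 2 * m2), by positivity, ?_⟩
  intro σw σb hw hb x hx y hy
  have := isProbabilityMeasure_scaledLaw hp.weight hw
  have := isProbabilityMeasure_scaledLaw hp.bias hb
  have i1 := integrable_norm_scaledLaw hp.weight hw
  have i2 := integrable_norm_sq_scaledLaw hp.weight hw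
  have hin := integrable_nodeFn h hp hw hb hx hy
  rw [paramLaw_eq] at hin ⊢
  rw [integral_prod _ hin, ← integral_const_mul, ← integral_sub hin.integral_prod_left
    ((integrable_corr_inner h hp.weight hw _).const_mul _)]
  calc _ ≤ ∫ w, |(∫ b, nodeFn φ ψ x y (w, b) ∂(scaledLaw σb pb)) -
            scaledDensity σb pb 0 * corr φ ψ (inner ℝ w (x - y))| ∂(scaledLaw σw pw) :=
        abs_integral_le_integral_abs
    _ ≤ ∫ w, M * c * I / σb ^ 2 * (1 + 3 * ρ * ‖w‖ + 2 * ρ ^ 2 * ‖w‖ ^ 2) ∂(scaledLaw σw pw) := by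
        refine integral_mono (hin.integral_prod_left.sub
          ((integrable_corr_inner h hp.weight hw _).const_mul _)).abs
          (((((integrable_const 1).add (i1.const_mul _)).add (i2.const_mul _))).const_mul _)
          fun w => ?_
        have b1 := abs_integral_bias_sub_le h hp.bias hM0 hM hb (inner ℝ w y) (inner ℝ w (x - y))
        have e : (inner ℝ w y : ℝ) + inner ℝ w (x - y) = inner ℝ w x := by
          rw [inner_sub_right]; ring
        rw [e] at b1
        refine b1.trans ?_
        have b2 := abs_inner_sub_le hx hy w
        have b3 : |(inner ℝ w y : ℝ)| ≤ ρ * ‖w‖ := by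
          refine (abs_real_inner_le_norm w y).trans ?_
          rw [mul_comm]
          gcongr
          exact norm_le_of_mem_cube hy
        calc _ ≤ M * c * I * ((1 + 2 * ρ * ‖w‖) * (1 + ρ * ‖w‖)) / σb ^ 2 := by gcongr
          _ = _ := by ring
    _ = M * c * I / σb ^ 2 * (1 + 3 * ρ * (σw * m1) + 2 * ρ ^ 2 * (σw ^ 2 * m2)) := by
        have i3 : Integrable (fun w : EuclideanSpace ℝ (Fin d) => 1 + 3 * ρ * ‖w‖)
            (scaledLaw σw pw) := (integrable_const 1).add (i1.const_mul _)
        rw [integral_const_mul, integral_add i3 (i2.const_mul _), integral_add (integrable_const 1)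
          (i1.const_mul _),
          integral_const_mul, integral_const_mul, integral_norm_scaledLaw hp.weight hw,
          integral_norm_sq_scaledLaw hp.weight hw]
        simp [m1, m2]
    _ ≤ M * c * I / σb ^ 2 * ((1 + 3 * ρ * m1 + 2 * ρ ^ 2 * m2) * (σw + 1) ^ 2) := by
        gcongr
        have a1 : 0 ≤ ρ * m1 * (σw ^ 2 + σw + 1) := by positivity
        have a2 : 0 ≤ ρ ^ 2 * m2 * (2 * σw + 1) := by positivity
        nlinarith
    _ = _ := by ring

end Kernel

end Ridgelet

namespace Ridgelet

/-! ### Large weight bandwidth -/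

section Bandwidth

variable {d : ℕ} {pw : EuclideanSpace ℝ (Fin d) → ℝ} {σw : ℝ}

lemma continuous_densHat (hp : IsBandwidthDensity pw) : Continuous (densHat pw) := by
  unfold densHat fourier
  refine continuous_const.mul (continuous_of_dominated (bound := pw) (fun ξ => ?_) (fun ξ => ?_)
    hp.integrable (.of_forall fun x => ?_))
  · exact (Complex.measurable_ofReal.comp hp.measurable).aestronglyMeasurable.mul
      (by fun_prop)
  · refine .of_forall fun x => ?_
    rw [norm_mul, mul_comm Complex.I, ← neg_mul, ← Complex.ofReal_neg,
      Complex.norm_exp_ofReal_mul_I, mul_one, Complex.norm_real, Real.norm_of_nonneg (hp.nonneg x)]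
  · fun_prop

lemma norm_densHat_le (hp : IsBandwidthDensity pw) (ξ : EuclideanSpace ℝ (Fin d)) :
    ‖densHat pw ξ‖ ≤ (2 * Real.pi) ^ (-(d : ℝ) / 2) := by
  unfold densHat fourier
  rw [norm_mul, Complex.norm_real, Real.norm_of_nonneg (by positivity), finrank_euclideanSpace_fin]
  refine mul_le_of_le_one_right (by positivity) ((norm_integral_le_integral_norm _).trans ?_)
  rw [← hp.integral_eq_one]
  refine le_of_eq ?_
  congr 1
  funext x
  rw [norm_mul, mul_comm Complex.I, ← neg_mul, ← Complex.ofReal_neg,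
      Complex.norm_exp_ofReal_mul_I, mul_one, Complex.norm_real, Real.norm_of_nonneg (hp.nonneg x)]

lemma integral_exp_scaledLaw (hp : IsBandwidthDensity pw) (hw : 0 < σw) (ξ : ℝ)
    (z : EuclideanSpace ℝ (Fin d)) :
    ∫ w, Complex.exp (Complex.I * ((ξ * inner ℝ w z : ℝ) : ℂ)) ∂(scaledLaw σw pw) =
      (((2 * Real.pi) ^ ((d : ℝ) / 2) * (densHat pw (-(σw * ξ) • z)).re : ℝ) : ℂ) := by
  rw [integral_scaledLaw hp hw, Complex.ofReal_mul, ← densHat_eq_ofReal hp, densHat, fourier,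
    finrank_euclideanSpace_fin, ← mul_assoc, ← Complex.ofReal_mul,
    ← Real.rpow_add (by positivity : (0 : ℝ) < 2 * Real.pi)]
  rw [show (d : ℝ) / 2 + -(d : ℝ) / 2 = 0 by ring, Real.rpow_zero, Complex.ofReal_one, one_mul]
  congr 1
  funext w
  rw [Complex.real_smul]
  congr 2
  rw [inner_smul_left, inner_smul_left, real_inner_comm]
  simp
  ring

variable {φ : ℝ → ℝ} {φhat : ℝ → ℂ} {ψ : 𝓢(ℝ, ℝ)}

/-- The real part of `conj (psiHat ψ) * φhat`. -/
noncomputable def specDensity (φhat : ℝ → ℂ) (ψ : 𝓢(ℝ, ℝ)) (ξ : ℝ) : ℝ :=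
  ((starRingEnd ℂ) (psiHat ψ ξ) * φhat ξ).re

lemma IsActivationPair.integrable_mul (hφψ : IsActivationPair d φ φhat ψ) :
    Integrable fun ξ => (starRingEnd ℂ) (psiHat ψ ξ) * φhat ξ := by
  simpa using (hφψ.correlation 0).1

lemma IsActivationPair.integrable_specDensity (hφψ : IsActivationPair d φ φhat ψ) :
    Integrable (specDensity φhat ψ) := hφψ.integrable_mul.re

/-- The integral of a non-integrable function is 0 by convention, which would contradict the value 1
in the admissibility condition. -/
lemma IsActivationPair.integrable_zpow_mul (hφψ : IsActivationPair d φ φhat ψ) :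
    Integrable fun ξ : ℝ => ((|ξ| ^ (-(d : ℤ)) : ℝ) : ℂ) *
      ((starRingEnd ℂ) (psiHat ψ ξ) * φhat ξ) := by
  by_contra h
  have := hφψ.admissible
  rw [integral_undef h, mul_zero] at this
  exact zero_ne_one this

lemma IsActivationPair.integrable_specDensity_zpow (hφψ : IsActivationPair d φ φhat ψ) :
    Integrable fun ξ : ℝ => |ξ| ^ (-(d : ℤ)) * specDensity φhat ψ ξ := by
  refine hφψ.integrable_zpow_mul.re.congr (.of_forall fun ξ => ?_)
  exact Complex.re_ofReal_mul _ _

lemma IsActivationPair.integral_specDensity (hφψ : IsActivationPair d φ φhat ψ) :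
    (2 * Real.pi) ^ ((d : ℝ) / 2) * ∫ ξ : ℝ, |ξ| ^ (-(d : ℤ)) * specDensity φhat ψ ξ = 1 := by
  have h := congrArg Complex.re hφψ.admissible
  rw [Complex.re_ofReal_mul, Complex.one_re] at h
  rw [← h]
  congr 1
  have h2 := integral_re hφψ.integrable_zpow_mul
  refine Eq.trans ?_ h2
  congr 1
  funext ξ
  exact (Complex.re_ofReal_mul _ _).symm

/-- The exponent -d - 1 lies between the integrable exponents -d and -d - 2: away from 0, |ξ|⁻¹ ≤ 1
+ |ξ|⁻². -/
lemma IsActivationPair.integrable_specDensity_zpow_sub_one (hφψ : IsActivationPair d φ φhat ψ) :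
    Integrable fun ξ : ℝ => |ξ| ^ (-(d : ℤ) - 1) * |specDensity φhat ψ ξ| := by
  have hm : AEStronglyMeasurable (specDensity φhat ψ) volume := hφψ.integrable_specDensity.1
  refine (hφψ.integrable_zpow_mul.norm.add hφψ.integrable).mono' ?_ ?_
  · refine AEStronglyMeasurable.mul ?_ hm.norm
    exact (measurable_abs.pow_const _).aestronglyMeasurable
  · have h0 : ∀ᵐ ξ : ℝ, ξ ≠ 0 := Measure.ae_ne volume 0
    filter_upwards [h0] with ξ hξ
    have hξ' : 0 < |ξ| := abs_pos.2 hξ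
    have h1 : |specDensity φhat ψ ξ| ≤ ‖(starRingEnd ℂ) (psiHat ψ ξ) * φhat ξ‖ :=
      Complex.abs_re_le_norm _
    simp only [Pi.add_apply]
    rw [Real.norm_of_nonneg (by positivity), norm_mul, Complex.norm_real,
      Real.norm_of_nonneg (by positivity), ← add_mul]
    refine mul_le_mul ?_ h1 (abs_nonneg _) (by positivity)
    rw [zpow_sub₀ hξ'.ne', zpow_sub₀ hξ'.ne']
    have h2 : 0 ≤ |ξ| ^ (-(d : ℤ)) := by positivity
    have h3 : |ξ|⁻¹ ≤ 1 + (|ξ| ^ 2)⁻¹ := by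
      rw [← inv_pow]
      nlinarith [sq_nonneg (|ξ|⁻¹ - 1), inv_pos.2 hξ']
    calc _ = |ξ| ^ (-(d : ℤ)) * |ξ|⁻¹ := by rw [zpow_one]; rfl
      _ ≤ |ξ| ^ (-(d : ℤ)) * (1 + (|ξ| ^ 2)⁻¹) := by gcongr
      _ = _ := by rw [mul_add, mul_one]; rfl

/-- The correlation is a superposition of exponentials in w·z. By Fubini each is averaged over `w`
separately, which yields the Fourier transform of `pw` at a multiple of σ_w ξ z. Only the real part
is kept because the left side is real. -/
lemma integral_corr_inner (hφψ : IsActivationPair d φ φhat ψ)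
    (hp : IsBandwidthDensity pw) (hw : 0 < σw) (z : EuclideanSpace ℝ (Fin d)) :
    ∫ w, corr φ ψ (inner ℝ w z) ∂(scaledLaw σw pw) = (2 * Real.pi) ^ ((d : ℝ) / 2) *
      ∫ ξ, specDensity φhat ψ ξ * (densHat pw (-(σw * ξ) • z)).re := by
  have := isProbabilityMeasure_scaledLaw hp hw
  set Θ : ℝ → ℂ := fun ξ => (starRingEnd ℂ) (psiHat ψ ξ) * φhat ξ
  have hΘ : Integrable Θ := hφψ.integrable_mul
  have hprod : Integrable (fun q : EuclideanSpace ℝ (Fin d) × ℝ =>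
      Θ q.2 * Complex.exp (Complex.I * ((q.2 * inner ℝ q.1 z : ℝ) : ℂ)))
      ((scaledLaw σw pw).prod volume) := by
    refine (hΘ.comp_snd (scaledLaw σw pw)).norm.mono' ?_ (.of_forall fun q => ?_)
    · exact (hΘ.comp_snd (scaledLaw σw pw)).1.mul (by fun_prop)
    · rw [norm_mul, mul_comm Complex.I, Complex.norm_exp_ofReal_mul_I, mul_one]
  have e1 : ((∫ w, corr φ ψ (inner ℝ w z) ∂(scaledLaw σw pw) : ℝ) : ℂ) =
      ∫ ξ, ((2 * Real.pi) ^ ((d : ℝ) / 2) * (densHat pw (-(σw * ξ) • z)).re : ℝ) • Θ ξ := by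
    rw [← integral_complex_ofReal]
    calc _ = ∫ w, (∫ ξ, Θ ξ * Complex.exp (Complex.I * ((ξ * inner ℝ w z : ℝ) : ℂ)))
          ∂(scaledLaw σw pw) := by
          congr 1
          funext w
          exact ((hφψ.correlation _).2).symm
      _ = ∫ ξ, ∫ w, Θ ξ * Complex.exp (Complex.I * ((ξ * inner ℝ w z : ℝ) : ℂ))
          ∂(scaledLaw σw pw) := integral_integral_swap hprod
      _ = _ := by
          congr 1
          funext ξ
          rw [integral_const_mul, integral_exp_scaledLaw hp hw, Complex.real_smul, mul_comm]
  have hI : Integrable fun ξ : ℝ =>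
      ((2 * Real.pi) ^ ((d : ℝ) / 2) * (densHat pw (-(σw * ξ) • z)).re : ℝ) • Θ ξ := by
    refine hΘ.bdd_smul (𝕜 := ℝ) (φ := fun ξ : ℝ =>
      (2 * Real.pi) ^ ((d : ℝ) / 2) * (densHat pw (-(σw * ξ) • z)).re)
      ((2 * Real.pi) ^ ((d : ℝ) / 2) * (2 * Real.pi) ^ (-(d : ℝ) / 2))
      ?_ (.of_forall fun ξ => ?_)
    · exact (continuous_const.mul (Complex.continuous_re.comp
        ((continuous_densHat hp).comp (by fun_prop)))).aestronglyMeasurable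
    · rw [Real.norm_eq_abs, abs_mul, abs_of_pos (by positivity : 0 < (2 * Real.pi) ^ ((d : ℝ) / 2))]
      gcongr
      exact (Complex.abs_re_le_norm _).trans (norm_densHat_le hp _)
  have e2 := congrArg Complex.re e1
  rw [Complex.ofReal_re] at e2
  rw [e2, ← integral_const_mul]
  refine (integral_re hI).symm.trans ?_
  congr 1
  funext ξ
  change (_ • Θ ξ).re = _
  rw [Complex.smul_re]
  simp only [Θ, specDensity, smul_eq_mul]
  ring

variable {H : Type*} [NormedAddCommGroup H] [InnerProductSpace ℝ H] [CompleteSpace H]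

/-- The contribution of one frequency, a = σ_w ξ: substituting u = a(y - x), the Jacobian gives
|a|^(-d), and the Lipschitz bound at distance ‖u‖/|a| gives one more power and a first moment of the
transform. -/
lemma norm_integral_dilate_sub_le (hp : IsBandwidthDensity pw)
    (hm : Integrable fun ξ => ‖ξ‖ * ‖densHat pw ξ‖) {g : EuclideanSpace ℝ (Fin d) → H}
    {Λ : ℝ} (hg : ∀ x y, ‖g x - g y‖ ≤ Λ * ‖x - y‖) (x : EuclideanSpace ℝ (Fin d)) {a : ℝ}
    (ha : a ≠ 0) :
    ‖(∫ y, (densHat pw (a • (y - x))).re • g y) -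
      (|a| ^ (-(d : ℤ)) * ∫ ξ, ‖densHat pw ξ‖) • g x‖ ≤
      |a| ^ (-(d : ℤ) - 1) * (Λ * ∫ ξ, ‖ξ‖ * ‖densHat pw ξ‖) := by
  have ha' : 0 < |a| := abs_pos.2 ha
  have hP : Integrable fun u => (densHat pw u).re := hp.fourier_integrable.re
  have hPpos : ∀ u, 0 < (densHat pw u).re := fun u => (hp.fourier_pos u).1
  have hnorm : ∀ u, ‖densHat pw u‖ = (densHat pw u).re := norm_densHat hp
  simp only [hnorm] at hm ⊢
  have hgc : Continuous g := by
    refine (LipschitzWith.of_dist_le_mul (K := Λ.toNNReal) fun s t => ?_).continuous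
    rw [dist_eq_norm, dist_eq_norm]
    exact (hg s t).trans (by gcongr; exact Real.le_coe_toNNReal Λ)
  have hdiff : Integrable fun u => (densHat pw u).re • (g (x + a⁻¹ • u) - g x) := by
    refine ((hm.const_mul (Λ * |a|⁻¹))).mono' ?_ (.of_forall fun u => ?_)
    · exact hP.1.smul (Continuous.aestronglyMeasurable (by fun_prop))
    · rw [norm_smul, Real.norm_of_nonneg (hPpos u).le]
      have := hg (x + a⁻¹ • u) x
      rw [add_sub_cancel_left, norm_smul, norm_inv, Real.norm_eq_abs] at this
      have := mul_le_mul_of_nonneg_left this (hPpos u).le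
      refine this.trans (le_of_eq (by ring))
  have e1 : ∫ y, (densHat pw (a • (y - x))).re • g y =
      |a| ^ (-(d : ℤ)) • ∫ u, (densHat pw u).re • g (x + a⁻¹ • u) := by
    rw [← integral_add_right_eq_self _ x]
    have := Measure.integral_comp_smul volume
      (fun u => (densHat pw u).re • g (x + a⁻¹ • u)) a
    simp only [inv_smul_smul₀ ha, finrank_euclideanSpace_fin] at this
    simp only [add_comm _ x, add_sub_cancel_left]
    rw [this, abs_inv, abs_pow, zpow_neg, zpow_natCast]
  have e2 : (∫ u, (densHat pw u).re • g (x + a⁻¹ • u)) =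
      (∫ u, (densHat pw u).re • (g (x + a⁻¹ • u) - g x)) + (∫ u, (densHat pw u).re) • g x := by
    rw [← integral_smul_const, ← integral_add hdiff (hP.smul_const _)]
    congr 1
    funext u
    rw [← smul_add, sub_add_cancel]
  rw [e1, e2, smul_add, mul_smul, add_sub_cancel_right, norm_smul,
    Real.norm_of_nonneg (by positivity), zpow_sub₀ ha'.ne', zpow_one, div_mul_eq_mul_div,
    mul_div_assoc]
  gcongr
  calc _ ≤ ∫ u, Λ * |a|⁻¹ * (‖u‖ * (densHat pw u).re) := by
        refine norm_integral_le_of_norm_le (hm.const_mul _) (.of_forall fun u => ?_)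
        rw [norm_smul, Real.norm_of_nonneg (hPpos u).le]
        have := hg (x + a⁻¹ • u) x
        rw [add_sub_cancel_left, norm_smul, norm_inv, Real.norm_eq_abs] at this
        have := mul_le_mul_of_nonneg_left this (hPpos u).le
        refine this.trans (le_of_eq (by ring))
    _ = _ := by
        rw [integral_const_mul]
        field_simp

/-- The constant in the bound for the weight bandwidth error. -/
noncomputable def bandwidthConst (φhat : ℝ → ℂ) (ψ : 𝓢(ℝ, ℝ))
    (pw : EuclideanSpace ℝ (Fin d) → ℝ) : ℝ :=
  (2 * Real.pi) ^ ((d : ℝ) / 2) / (∫ ξ, ‖densHat pw ξ‖) * (∫ ξ, ‖ξ‖ * ‖densHat pw ξ‖) *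
    ∫ ξ : ℝ, |ξ| ^ (-(d : ℤ) - 1) * |specDensity φhat ψ ξ|

lemma bandwidthConst_nonneg : 0 ≤ bandwidthConst φhat ψ pw := by
  unfold bandwidthConst
  have h1 : 0 ≤ ∫ ξ, ‖densHat pw ξ‖ := integral_nonneg fun _ => norm_nonneg _
  have h2 : 0 ≤ ∫ ξ, ‖ξ‖ * ‖densHat pw ξ‖ := integral_nonneg fun _ => by positivity
  have h3 : 0 ≤ ∫ ξ : ℝ, |ξ| ^ (-(d : ℤ) - 1) * |specDensity φhat ψ ξ| :=
    integral_nonneg fun _ => by positivity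
  positivity

/-- The kernel `∫ corr φ ψ (w·z) dw` is an approximate identity. -/
lemma norm_integral_corr_smul_sub_le (hφψ : IsActivationPair d φ φhat ψ)
    (hp : IsBandwidthDensity pw) (hm : Integrable fun ξ => ‖ξ‖ * ‖densHat pw ξ‖) (hw : 0 < σw)
    {g : EuclideanSpace ℝ (Fin d) → H} {Λ : ℝ} (hg : ∀ x y, ‖g x - g y‖ ≤ Λ * ‖x - y‖)
    (hgi : Integrable g) (x : EuclideanSpace ℝ (Fin d)) :
    ‖(∫ y, (σw ^ d / (∫ ξ, ‖densHat pw ξ‖) *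
        ∫ w, corr φ ψ (inner ℝ w (x - y)) ∂(scaledLaw σw pw)) • g y) - g x‖ ≤
      bandwidthConst φhat ψ pw * Λ / σw := by
  set ν := specDensity φhat ψ
  set J := ∫ ξ, ‖densHat pw ξ‖
  have hJ : 0 < J := integral_norm_densHat_pos hp
  set τ := (2 * Real.pi) ^ ((d : ℝ) / 2)
  have hτ : 0 < τ := by positivity
  set m := ∫ ξ, ‖ξ‖ * ‖densHat pw ξ‖
  set P : EuclideanSpace ℝ (Fin d) → ℝ := fun u => (densHat pw u).re
  have hPc : Continuous P := Complex.continuous_re.comp (continuous_densHat hp)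
  have hPb : ∀ u, ‖P u‖ ≤ (2 * Real.pi) ^ (-(d : ℝ) / 2) := fun u =>
    (Complex.abs_re_le_norm _).trans (norm_densHat_le hp _)
  have hprod : Integrable (fun q : EuclideanSpace ℝ (Fin d) × ℝ =>
      P ((σw * q.2) • (q.1 - x)) • (ν q.2 • g q.1)) (volume.prod volume) := by
    have h1 : Integrable (fun q : EuclideanSpace ℝ (Fin d) × ℝ => ν q.2 • g q.1)
        (volume.prod volume) := by
      have := (hφψ.integrable_specDensity.smul_prod hgi).swap
      exact this
    refine h1.bdd_smul ((2 * Real.pi) ^ (-(d : ℝ) / 2)) ?_ (.of_forall fun q => hPb _)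
    exact Continuous.aestronglyMeasurable (by fun_prop)
  have e1 : ∫ y, (σw ^ d / J * ∫ w, corr φ ψ (inner ℝ w (x - y)) ∂(scaledLaw σw pw)) • g y =
      (σw ^ d / J * τ) • ∫ ξ, ν ξ • ∫ y, P ((σw * ξ) • (y - x)) • g y := by
    have e : ∀ y, (σw ^ d / J * ∫ w, corr φ ψ (inner ℝ w (x - y)) ∂(scaledLaw σw pw)) • g y =
        (σw ^ d / J * τ) • ∫ ξ, P ((σw * ξ) • (y - x)) • (ν ξ • g y) := by
      intro y
      rw [integral_corr_inner hφψ hp hw, ← mul_assoc, mul_smul, ← integral_smul_const]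
      congr 2
      funext ξ
      rw [smul_smul, mul_comm]
      congr 4
      module
    simp only [e]
    rw [integral_smul, integral_integral_swap hprod]
    congr 2
    funext ξ
    rw [← integral_smul]
    congr 1
    funext y
    rw [smul_comm]
  have hint1 : Integrable fun ξ => ν ξ • ∫ y, P ((σw * ξ) • (y - x)) • g y := by
    refine hprod.integral_prod_right.congr (.of_forall fun ξ => ?_)
    simp only
    rw [← integral_smul]
    congr 1
    funext y
    rw [smul_comm]
  have hz : ∀ ξ : ℝ, |σw * ξ| ^ (-(d : ℤ)) = (σw ^ d)⁻¹ * |ξ| ^ (-(d : ℤ)) := fun ξ => by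
    rw [abs_mul, abs_of_pos hw, mul_zpow, zpow_neg, zpow_natCast]
  have hint2 : Integrable fun ξ => ν ξ • ((|σw * ξ| ^ (-(d : ℤ)) * J) • g x) := by
    have := ((hφψ.integrable_specDensity_zpow.const_mul ((σw ^ d)⁻¹ * J))).smul_const (g x)
    refine this.congr (.of_forall fun ξ => ?_)
    simp only [smul_smul, hz]
    congr 1
    ring
  -- Here admissibility enters: the main terms of all frequencies add up to exactly `g x`.
  have e2 : g x = (σw ^ d / J * τ) • ∫ ξ, ν ξ • ((|σw * ξ| ^ (-(d : ℤ)) * J) • g x) := by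
    have e : ∀ ξ, ν ξ • ((|σw * ξ| ^ (-(d : ℤ)) * J) • g x) =
        ((σw ^ d)⁻¹ * J * (|ξ| ^ (-(d : ℤ)) * ν ξ)) • g x := fun ξ => by
      rw [hz, smul_smul]; congr 1; ring
    simp only [e]
    rw [integral_smul_const, integral_const_mul, smul_smul]
    have e3 : σw ^ d / J * τ * ((σw ^ d)⁻¹ * J * ∫ ξ : ℝ, |ξ| ^ (-(d : ℤ)) * ν ξ) =
        τ * ∫ ξ : ℝ, |ξ| ^ (-(d : ℤ)) * ν ξ := by
      field_simp
    rw [e3, hφψ.integral_specDensity, one_smul]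
  rw [e1]
  conv_lhs => rw [e2]
  rw [← smul_sub, ← integral_sub hint1 hint2, norm_smul, Real.norm_of_nonneg (by positivity)]
  -- The errors of single frequencies sum up because |ξ|^(-d-1) is integrable against the spectral
  -- density; the frequency 0 is negligible.
  have hbd : ‖∫ ξ, (ν ξ • (∫ y, P ((σw * ξ) • (y - x)) • g y) -
        ν ξ • ((|σw * ξ| ^ (-(d : ℤ)) * J) • g x))‖ ≤
      ∫ ξ, (σw ^ (d + 1))⁻¹ * (Λ * m) * (|ξ| ^ (-(d : ℤ) - 1) * |ν ξ|) := by
    refine norm_integral_le_of_norm_le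
      (hφψ.integrable_specDensity_zpow_sub_one.const_mul _) ?_
    have h0 : ∀ᵐ ξ : ℝ, ξ ≠ 0 := Measure.ae_ne volume 0
    filter_upwards [h0] with ξ hξ
    rw [← smul_sub, norm_smul, Real.norm_eq_abs]
    have := norm_integral_dilate_sub_le hp hm hg x (mul_ne_zero hw.ne' hξ)
    have e4 : |σw * ξ| ^ (-(d : ℤ) - 1) = (σw ^ (d + 1))⁻¹ * |ξ| ^ (-(d : ℤ) - 1) := by
      rw [abs_mul, abs_of_pos hw, mul_zpow, ← zpow_natCast, ← zpow_neg]
      congr 2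
      push_cast
      ring
    rw [e4] at this
    calc _ ≤ |ν ξ| * ((σw ^ (d + 1))⁻¹ * |ξ| ^ (-(d : ℤ) - 1) * (Λ * m)) := by
          gcongr
      _ = _ := by ring
  calc _ ≤ σw ^ d / J * τ * ∫ ξ, (σw ^ (d + 1))⁻¹ * (Λ * m) * (|ξ| ^ (-(d : ℤ) - 1) * |ν ξ|) := by
        gcongr
    _ = _ := by
        have hB : bandwidthConst φhat ψ pw =
          τ / J * m * ∫ ξ : ℝ, |ξ| ^ (-(d : ℤ) - 1) * |ν ξ| := rfl
        rw [integral_const_mul, hB, pow_succ]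
        field_simp

end Bandwidth

/-! ### The left endpoint rule -/

section Quadrature

variable {d : ℕ}

/-- The cell of the grid with lower left corner `gridNode S n j`. -/
def cell (S : ℝ) (n : ℕ) (j : Fin d → Fin n) : Set (EuclideanSpace ℝ (Fin d)) :=
  {x | ∀ i, x i ∈ Set.Ico (-S + 2 * S * ((j i : ℕ) : ℝ) / n)
    (-S + 2 * S * (((j i : ℕ) : ℝ) + 1) / n)}

lemma cell_eq_preimage (S : ℝ) (n : ℕ) (j : Fin d → Fin n) :
    cell S n j = (WithLp.ofLp : EuclideanSpace ℝ (Fin d) → Fin d → ℝ) ⁻¹'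
      Set.pi Set.univ fun i => Set.Ico (-S + 2 * S * ((j i : ℕ) : ℝ) / n)
        (-S + 2 * S * (((j i : ℕ) : ℝ) + 1) / n) := by
  ext x
  simp [cell]

lemma measurableSet_cell (S : ℝ) (n : ℕ) (j : Fin d → Fin n) : MeasurableSet (cell S n j) := by
  rw [cell_eq_preimage]
  exact (MeasurableSet.univ_pi fun i => measurableSet_Ico).preimage
    (PiLp.volume_preserving_ofLp (Fin d)).measurable

lemma volume_cell {S : ℝ} (hS : 0 < S) {n : ℕ} (j : Fin d → Fin n) :
    volume (cell S n j) = ENNReal.ofReal ((2 * S / n) ^ d) := by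
  rw [cell_eq_preimage, (PiLp.volume_preserving_ofLp (Fin d)).measure_preimage
    (MeasurableSet.univ_pi fun i => measurableSet_Ico).nullMeasurableSet, Real.volume_pi_Ico,
    ← ENNReal.ofReal_prod_of_nonneg]
  · congr 1
    rw [Finset.prod_congr rfl fun i _ =>
      (by ring : (-S + 2 * S * (((j i : ℕ) : ℝ) + 1) / n) - (-S + 2 * S * ((j i : ℕ) : ℝ) / n) =
        2 * S / n)]
    simp [div_pow]
  · intro i _
    have : (-S + 2 * S * (((j i : ℕ) : ℝ) + 1) / n) - (-S + 2 * S * ((j i : ℕ) : ℝ) / n) =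
        2 * S / n := by ring
    rw [this]
    positivity

lemma gridNode_mem_cube {S : ℝ} (hS : 0 < S) {n : ℕ} (j : Fin d → Fin n) :
    gridNode S n j ∈ cube d S := by
  intro i
  have hn : (0 : ℝ) < n := by exact_mod_cast (Nat.zero_le _).trans_lt (j i).2
  have h1 : ((j i : ℕ) : ℝ) / n ≤ 1 := by
    rw [div_le_one hn]; exact_mod_cast (j i).2.le
  have h2 : 0 ≤ ((j i : ℕ) : ℝ) / n := by positivity
  simp only [gridNode, mul_div_assoc]
  constructor <;> nlinarith

lemma cell_subset_cube {S : ℝ} (hS : 0 < S) {n : ℕ} (j : Fin d → Fin n) :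
    cell S n j ⊆ cube d S := by
  intro x hx i
  have hn : (0 : ℝ) < n := by exact_mod_cast (Nat.zero_le _).trans_lt (j i).2
  have h1 : (((j i : ℕ) : ℝ) + 1) / n ≤ 1 := by
    rw [div_le_one hn]; exact_mod_cast (j i).2
  have h2 : 0 ≤ ((j i : ℕ) : ℝ) / n := by positivity
  have := hx i
  simp only [mul_div_assoc, Set.mem_Ico] at this
  constructor <;> nlinarith

lemma norm_sub_gridNode_le {S : ℝ} (hS : 0 < S) {n : ℕ} (j : Fin d → Fin n)
    {x : EuclideanSpace ℝ (Fin d)} (hx : x ∈ cell S n j) :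
    ‖gridNode S n j - x‖ ≤ √d * (2 * S / n) := by
  rw [EuclideanSpace.norm_eq]
  refine Real.sqrt_le_iff.2 ⟨by positivity, ?_⟩
  rw [mul_pow, Real.sq_sqrt (by positivity)]
  calc ∑ i, ‖(gridNode S n j - x) i‖ ^ 2 ≤ ∑ _i : Fin d, (2 * S / n) ^ 2 := by
        gcongr with i _
        have h1 := hx i
        have e : -S + 2 * S * (((j i : ℕ) : ℝ) + 1) / n =
          -S + 2 * S * ((j i : ℕ) : ℝ) / n + 2 * S / n := by ring
        rw [e] at h1
        rw [Real.norm_eq_abs, abs_le]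
        simp only [gridNode, PiLp.sub_apply]
        constructor <;> linarith [h1.1, h1.2, show (0 : ℝ) ≤ 2 * S / n by positivity]
    _ = _ := by simp

lemma pairwise_disjoint_cell {S : ℝ} (hS : 0 < S) {n : ℕ} (hn : 0 < n) :
    Pairwise (Function.onFun Disjoint (cell S n : (Fin d → Fin n) → _)) := by
  intro j k hjk
  rw [Function.onFun, Set.disjoint_left]
  intro x hx hx'
  have hn' : (0 : ℝ) < n := by exact_mod_cast hn
  refine hjk (funext fun i => Fin.ext ?_)
  have h1 := hx i
  have h2 := hx' i
  have key : ∀ a b : ℕ, -S + 2 * S * (a : ℝ) / n < -S + 2 * S * ((b : ℝ) + 1) / n → a ≤ b := by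
    intro a b hab
    have h3 : 2 * S * (a : ℝ) / n < 2 * S * ((b : ℝ) + 1) / n := by linarith
    rw [div_lt_div_iff_of_pos_right hn'] at h3
    have h4 : (a : ℝ) < b + 1 := lt_of_mul_lt_mul_left h3 (by positivity)
    exact Nat.lt_succ_iff.1 (by exact_mod_cast h4)
  exact le_antisymm (key _ _ (h1.1.trans_lt h2.2)) (key _ _ (h2.1.trans_lt h1.2))

lemma iUnion_cell {S : ℝ} (hS : 0 < S) {n : ℕ} (hn : 0 < n) :
    ⋃ j, cell S n j = {x : EuclideanSpace ℝ (Fin d) | ∀ i, x i ∈ Set.Ico (-S) S} := by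
  have hn' : (0 : ℝ) < n := by exact_mod_cast hn
  ext x
  simp only [Set.mem_iUnion, Set.mem_ofPred_eq]
  constructor
  · rintro ⟨j, hj⟩ i
    have h1 : (((j i : ℕ) : ℝ) + 1) / n ≤ 1 := by
      rw [div_le_one hn']; exact_mod_cast (j i).2
    have h2 : 0 ≤ ((j i : ℕ) : ℝ) / n := by positivity
    have := hj i
    simp only [mul_div_assoc, Set.mem_Ico] at this
    constructor <;> nlinarith
  · intro hx
    have h0 : ∀ i, 0 ≤ (x i + S) * n / (2 * S) := fun i => by
      have := (hx i).1
      have : 0 ≤ x i + S := by linarith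
      positivity
    refine ⟨fun i => ⟨⌊(x i + S) * n / (2 * S)⌋₊, ?_⟩, fun i => ?_⟩
    · rw [Nat.floor_lt (h0 i), div_lt_iff₀ (by positivity)]
      have := (hx i).2
      nlinarith
    · have h1 := Nat.floor_le (h0 i)
      have h2 := Nat.lt_floor_add_one ((x i + S) * n / (2 * S))
      rw [le_div_iff₀ (by positivity)] at h1
      rw [div_lt_iff₀ (by positivity)] at h2
      simp only
      constructor
      · have : 2 * S * (⌊(x i + S) * n / (2 * S)⌋₊ : ℝ) / n ≤ x i + S := by
          rw [div_le_iff₀ hn']; linarith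
        linarith
      · have : x i + S < 2 * S * ((⌊(x i + S) * n / (2 * S)⌋₊ : ℝ) + 1) / n := by
          rw [lt_div_iff₀ hn']; linarith
        linarith

/-- Error bound for the left endpoint rule. -/
lemma norm_quadrature_sub_le {H : Type*} [NormedAddCommGroup H] [NormedSpace ℝ H]
    [CompleteSpace H] {S : ℝ} (hS : 0 < S) {n : ℕ} (hn : 0 < n)
    {h : EuclideanSpace ℝ (Fin d) → H} {Λ : ℝ} (hΛ0 : 0 ≤ Λ) (hi : Integrable h)
    (hΛ : ∀ x ∈ cube d S, ∀ y ∈ cube d S, ‖h x - h y‖ ≤ Λ * ‖x - y‖)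
    (h0 : ∀ x : EuclideanSpace ℝ (Fin d), ¬ (∀ i, x i ∈ Set.Ico (-S) S) → h x = 0) :
    ‖(∑ j : Fin d → Fin n, ((2 * S) ^ d * (((n ^ d : ℕ) : ℝ))⁻¹) • h (gridNode S n j)) -
      ∫ x, h x‖ ≤ (2 * S) ^ d * (Λ * (√d * (2 * S / n))) := by
  have hn' : (0 : ℝ) < n := by exact_mod_cast hn
  have hv : (2 * S) ^ d * (((n ^ d : ℕ) : ℝ))⁻¹ = (2 * S / n) ^ d := by
    push_cast; rw [div_pow]; rfl
  -- The half-open cells tile the half-open cube, outside which `h` vanishes.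
  have e1 : ∫ x, h x = ∑ j : Fin d → Fin n, ∫ x in cell S n j, h x := by
    rw [← integral_iUnion_fintype (fun j => measurableSet_cell S n j)
      (pairwise_disjoint_cell hS hn) fun j => hi.integrableOn, iUnion_cell hS hn,
      setIntegral_eq_integral_of_forall_compl_eq_zero]
    intro x hx
    exact h0 x hx
  rw [e1, hv, ← Finset.sum_sub_distrib]
  have hcell : ∀ j : Fin d → Fin n, ‖(2 * S / n) ^ d • h (gridNode S n j) -
      ∫ x in cell S n j, h x‖ ≤ Λ * (√d * (2 * S / n)) * (2 * S / n) ^ d := by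
    intro j
    have hvr : volume.real (cell S n j) = (2 * S / n) ^ d := by
      rw [Measure.real, volume_cell hS, ENNReal.toReal_ofReal (by positivity)]
    have hlt : volume (cell S n j) < ⊤ := by rw [volume_cell hS]; exact ENNReal.ofReal_lt_top
    have : (2 * S / n) ^ d • h (gridNode S n j) = ∫ _ in cell S n j, h (gridNode S n j) := by
      rw [setIntegral_const, hvr]
    have hfin : IsFiniteMeasure (volume.restrict (cell S n j)) := ⟨by simpa using hlt⟩
    rw [this, ← integral_sub (integrable_const _) hi.integrableOn, ← hvr]
    refine norm_setIntegral_le_of_norm_le_const hlt fun x hx => ?_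
    refine (hΛ _ (gridNode_mem_cube hS j) _ (cell_subset_cube hS j hx)).trans ?_
    gcongr
    exact norm_sub_gridNode_le hS j hx
  refine (norm_sum_le _ _).trans ((Finset.sum_le_sum fun j _ => hcell j).trans ?_)
  rw [Finset.sum_const, Finset.card_univ, Fintype.card_fun, Fintype.card_fin, Fintype.card_fin,
    nsmul_eq_mul, ← hv]
  refine le_of_eq ?_
  have : ((n ^ d : ℕ) : ℝ) ≠ 0 := by positivity
  field_simp

end Quadrature

end Ridgelet

namespace Ridgelet

lemma _root_.ContinuousOn.le_of_denseSeq_le {X : Type*} [TopologicalSpace X] {A : Set X}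
    [TopologicalSpace.SeparableSpace A] [Nonempty A] {g : X → ℝ} {b : ℝ} (hg : ContinuousOn g A)
    (h : ∀ k, g (TopologicalSpace.denseSeq A k) ≤ b) {x : X} (hx : x ∈ A) : g x ≤ b :=
  DenseRange.induction_on (p := fun z : A => g z ≤ b) (TopologicalSpace.denseRange_denseSeq A)
    ⟨x, hx⟩ (isClosed_le (continuousOn_iff_continuous_domRestrict.1 hg) continuous_const) h

/-! ### Monte Carlo error -/

section MonteCarlo

variable {d : ℕ} {φ : ℝ → ℝ} {ψ : 𝓢(ℝ, ℝ)} {c : ℝ}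
  {pw : EuclideanSpace ℝ (Fin d) → ℝ} {pb : ℝ → ℝ} {σw σb S : ℝ}

/-- The centred sum of the random variables `nodeFn φ ψ x y`. -/
noncomputable def dev (φ : ℝ → ℝ) (ψ : 𝓢(ℝ, ℝ)) (μ : Measure (EuclideanSpace ℝ (Fin d) × ℝ))
    {N : ℕ} (x y : EuclideanSpace ℝ (Fin d)) (θ : Fin N → EuclideanSpace ℝ (Fin d) × ℝ) : ℝ :=
  ∑ i, (nodeFn φ ψ x y (θ i) - ∫ a, nodeFn φ ψ x y a ∂μ)

lemma measurable_dev (h : ActBound φ ψ c) (μ : Measure (EuclideanSpace ℝ (Fin d) × ℝ)) {N : ℕ}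
    (x y : EuclideanSpace ℝ (Fin d)) : Measurable (dev φ ψ μ (N := N) x y) := by
  unfold dev
  exact Finset.measurable_sum _ fun i _ =>
    ((continuous_nodeFn h x y).measurable.comp (measurable_pi_apply i)).sub_const _

lemma abs_nodeFn_sub_left_le (h : ActBound φ ψ c) (x x' y : EuclideanSpace ℝ (Fin d))
    (θ : EuclideanSpace ℝ (Fin d) × ℝ) :
    |nodeFn φ ψ x y θ - nodeFn φ ψ x' y θ| ≤ c ^ 2 * |inner ℝ θ.1 (x - x')| := by
  unfold nodeFn
  rw [← mul_sub, abs_mul, sq, mul_assoc, inner_sub_right]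
  have h1 := h.lip (inner ℝ θ.1 x + θ.2) (inner ℝ θ.1 x' + θ.2)
  rw [add_sub_add_right_eq_sub] at h1
  have h2 : |ψ (inner ℝ θ.1 y + θ.2)| ≤ c := by
    refine le_trans ?_ (h.decay (inner ℝ θ.1 y + θ.2))
    exact le_mul_of_one_le_right (abs_nonneg _) (by linarith [abs_nonneg (inner ℝ θ.1 y + θ.2)])
  exact mul_le_mul h2 h1 (abs_nonneg _) h.pos.le

/-- Permits the supremum over `𝒳` to be taken along a dense sequence. -/
lemma continuousOn_dev (h : ActBound φ ψ c) (hp : FiniteBandwidth pw pb) (hw : 0 < σw)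
    (hb : 0 < σb) {N : ℕ} {y : EuclideanSpace ℝ (Fin d)} (hy : y ∈ cube d S)
    (θ : Fin N → EuclideanSpace ℝ (Fin d) × ℝ) :
    ContinuousOn (fun x => dev φ ψ (paramLaw pw pb σw σb) x y θ) (cube d S) := by
  have hφ := h.continuous
  unfold dev
  refine continuousOn_finsetSum _ fun i _ => ContinuousOn.sub ?_ ?_
  · unfold nodeFn
    exact Continuous.continuousOn (continuous_const.mul (hφ.comp (by fun_prop)))
  · set K : ℝ := c ^ 2 * ∫ a, ‖a.1‖ ∂(paramLaw pw pb σw σb)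
    have hK : 0 ≤ K := mul_nonneg (by positivity) (integral_nonneg fun _ => norm_nonneg _)
    refine (LipschitzOnWith.of_dist_le_mul (K := ⟨K, hK⟩) fun x hx x' hx' => ?_).continuousOn
    rw [Real.dist_eq, dist_eq_norm, ← integral_sub (integrable_nodeFn h hp hw hb hx hy)
      (integrable_nodeFn h hp hw hb hx' hy)]
    refine abs_integral_le_integral_abs.trans ?_
    calc _ ≤ ∫ a, c ^ 2 * ‖a.1‖ * ‖x - x'‖ ∂(paramLaw pw pb σw σb) := by
          refine integral_mono ((integrable_nodeFn h hp hw hb hx hy).sub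
            (integrable_nodeFn h hp hw hb hx' hy)).abs
            (((integrable_norm_fst hp hw hb).const_mul _).mul_const _) fun a => ?_
          refine (abs_nodeFn_sub_left_le h x x' y a).trans ?_
          rw [mul_assoc]
          gcongr
          exact abs_real_inner_le_norm _ _
      _ = K * ‖x - x'‖ := by rw [integral_mul_const, integral_const_mul]

lemma integrable_norm_dev_sub (h : ActBound φ ψ c) (hp : FiniteBandwidth pw pb) (hw : 0 < σw)
    (hb : 0 < σb) {y : EuclideanSpace ℝ (Fin d)} (hy : y ∈ cube d S)
    {T : Type*} [Fintype T] {x : T → EuclideanSpace ℝ (Fin d)} (hx : ∀ t, x t ∈ cube d S) (N : ℕ) :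
    Integrable (fun θ : Fin N → EuclideanSpace ℝ (Fin d) × ℝ =>
      ‖fun t => dev φ ψ (paramLaw pw pb σw σb) (x t) y θ -
        dev φ ψ (paramLaw pw pb σw σb) y y θ‖) (Measure.pi fun _ => paramLaw pw pb σw σb) := by
  have := isProbabilityMeasure_paramLaw hp hw hb
  have hd : ∀ x ∈ cube d S, Integrable (dev φ ψ (paramLaw pw pb σw σb) (N := N) x y)
      (Measure.pi fun _ => paramLaw pw pb σw σb) := fun x hx =>
    integrable_finsetSum _ fun i _ =>
      (integrable_eval_pi _ (integrable_nodeFn h hp hw hb hx hy) N i).sub (integrable_const _)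
  exact (Integrable.of_eval fun t => (hd _ (hx t)).sub (hd y hy)).norm

/-- Subtracting the value at x = y supplies a base point at which the family vanishes, as
contraction requires. The bound is the same for every finite family of points, which allows a
passage to infinitely many. The factor 8 is 4 times the 2 in ‖x - y‖ ≤ 2 `cubeRadius`. -/
lemma integral_norm_dev_sub_le (h : ActBound φ ψ c) (hp : FiniteBandwidth pw pb) (hS : 0 < S)
    (hw : 0 < σw) (hb : 0 < σb) {y : EuclideanSpace ℝ (Fin d)} (hy : y ∈ cube d S)
    {T : Type*} [Fintype T] {x : T → EuclideanSpace ℝ (Fin d)} (hx : ∀ t, x t ∈ cube d S) (N : ℕ) :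
    ∫ θ : Fin N → EuclideanSpace ℝ (Fin d) × ℝ,
      ‖fun t => dev φ ψ (paramLaw pw pb σw σb) (x t) y θ -
        dev φ ψ (paramLaw pw pb σw σb) y y θ‖ ∂(Measure.pi fun _ => paramLaw pw pb σw σb) ≤
      8 * c ^ 2 * cubeRadius d S * √(∫ x, ‖x‖ ^ 2 * pw x) * σw * √N := by
  have := isProbabilityMeasure_paramLaw hp hw hb
  set μ := paramLaw pw pb σw σb
  set C : EuclideanSpace ℝ (Fin d) × ℝ → T → ℝ := fun a t =>
    nodeFn φ ψ (x t) y a - nodeFn φ ψ y y a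
  have hCt : ∀ t, Integrable (fun a => C a t) μ := fun t =>
    (integrable_nodeFn h hp hw hb (hx t) hy).sub (integrable_nodeFn h hp hw hb hy hy)
  have hC : Integrable C μ := Integrable.of_eval hCt
  have hρ : 0 ≤ cubeRadius d S := by unfold cubeRadius; positivity
  have hxy : ∀ t, ‖x t - y‖ ≤ 2 * cubeRadius d S := fun t => by
    refine (norm_sub_le _ _).trans ?_
    have h2 := norm_le_of_mem_cube (hx t)
    have h3 := norm_le_of_mem_cube hy
    unfold cubeRadius
    linarith
  have key := integral_norm_empirical_le μ (fun t => x t - y) (fun a => a.1)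
    (integrable_norm_sq_fst hp hw hb) C hC (K := c ^ 2) (ρ := 2 * cubeRadius d S)
    (by positivity) (by positivity)
    (fun a s t => by
      have := abs_nodeFn_sub_left_le h (x s) (x t) y a
      simpa [C] using this)
    (fun a t => abs_nodeFn_sub_left_le h (x t) y y a) hxy N
  have e : ∀ θ : Fin N → EuclideanSpace ℝ (Fin d) × ℝ,
      (fun t => dev φ ψ μ (x t) y θ - dev φ ψ μ y y θ) = ∑ i, (C (θ i) - ∫ b, C b ∂μ) := by
    intro θ
    funext t
    rw [Finset.sum_apply, dev, dev, ← Finset.sum_sub_distrib]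
    refine Finset.sum_congr rfl fun i _ => ?_
    rw [Pi.sub_apply, eval_integral hCt, integral_sub (integrable_nodeFn h hp hw hb (hx t) hy)
      (integrable_nodeFn h hp hw hb hy hy)]
    simp only [C]
    ring
  simp only [e]
  refine key.trans (le_of_eq ?_)
  rw [integral_norm_sq_fst hp hw hb, Real.sqrt_mul (by positivity), Real.sqrt_mul (by positivity),
    Real.sqrt_sq hw.le]
  ring

lemma memLp_dev (h : ActBound φ ψ c) (hp : FiniteBandwidth pw pb) (hw : 0 < σw) (hb : 0 < σb)
    {x y : EuclideanSpace ℝ (Fin d)} (hx : x ∈ cube d S) (hy : y ∈ cube d S) (N : ℕ) :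
    MemLp (dev φ ψ (paramLaw pw pb σw σb) (N := N) x y) 2
      (Measure.pi fun _ => paramLaw pw pb σw σb) := by
  have := isProbabilityMeasure_paramLaw hp hw hb
  exact memLp_finsetSum _ fun i _ => ((memLp_nodeFn h hp hw hb hx hy).comp_measurePreserving
    (measurePreserving_eval _ i)).sub (memLp_const _)

lemma integral_dev_sq_le (h : ActBound φ ψ c) (hp : FiniteBandwidth pw pb) (hw : 0 < σw)
    (hb : 0 < σb) {x y : EuclideanSpace ℝ (Fin d)} (hx : x ∈ cube d S) (hy : y ∈ cube d S)
    (N : ℕ) :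
    ∫ θ : Fin N → EuclideanSpace ℝ (Fin d) × ℝ, dev φ ψ (paramLaw pw pb σw σb) x y θ ^ 2
      ∂(Measure.pi fun _ => paramLaw pw pb σw σb) ≤
      N * ∫ a, nodeFn φ ψ x y a ^ 2 ∂(paramLaw pw pb σw σb) := by
  have := isProbabilityMeasure_paramLaw hp hw hb
  set μ := paramLaw pw pb σw σb
  have hY := memLp_nodeFn h hp hw hb hx hy
  set Y : EuclideanSpace ℝ (Fin d) × ℝ → ℝ := fun a => nodeFn φ ψ x y a - ∫ b, nodeFn φ ψ x y b ∂μ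
  have hY' : MemLp Y 2 μ := hY.sub (memLp_const _)
  have hY0 : ∫ a, Y a ∂μ = 0 := by
    rw [integral_sub (hY.integrable (by norm_num)) (integrable_const _)]
    simp [μ]
  have hv := variance_sum_pi (μ := fun _ : Fin N => μ) (X := fun _ => Y) fun _ => hY'
  have hE : ∫ θ : Fin N → EuclideanSpace ℝ (Fin d) × ℝ, dev φ ψ μ x y θ
      ∂(Measure.pi fun _ => μ) = 0 := by
    unfold dev
    rw [integral_finsetSum _ fun i _ =>
      (integrable_eval_pi μ (hY'.integrable (by norm_num)) N i)]
    refine Finset.sum_eq_zero fun i _ => ?_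
    have hmp := measurePreserving_eval (fun _ : Fin N => μ) i
    have := hmp.map_eq ▸ integral_map hmp.measurable.aemeasurable
      (f := Y) (by rw [hmp.map_eq]; exact hY'.1)
    exact this.symm.trans hY0
  have hd : (∑ i : Fin N, fun θ : Fin N → EuclideanSpace ℝ (Fin d) × ℝ => Y (θ i)) =
      dev φ ψ μ x y := by
    funext θ
    rw [Finset.sum_apply]
    rfl
  rw [hd, variance_eq_integral (measurable_dev h μ x y).aemeasurable, hE] at hv
  simp only [sub_zero] at hv
  rw [hv, Finset.sum_const, Finset.card_univ, Fintype.card_fin, nsmul_eq_mul]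
  gcongr
  rw [variance_sub_const hY.1]
  exact variance_le_expectation_sq hY.1

/-- On the diagonal ψ and φ have the same argument, so the product is bounded by c² whatever the
weight, which gives c⁴. It is also square integrable in the bias, whose density is at most M/σ_b. -/
lemma exists_integral_nodeFn_sq_le (h : ActBound φ ψ c) (hp : FiniteBandwidth pw pb) :
    ∃ C : ℝ, 0 < C ∧ ∀ σw σb : ℝ, 0 < σw → 0 < σb → ∀ y ∈ cube d S,
      ∫ a, nodeFn φ ψ y y a ^ 2 ∂(paramLaw pw pb σw σb) ≤ C * min 1 (1 / σb) := by
  obtain ⟨M, hM0, hM, -⟩ := exists_density_bounds hp.bias hp.bias_differentiable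
    hp.bias_deriv_bounded
  have hφ := h.continuous
  have hI : Integrable fun t => (ψ t * φ t) ^ 2 := by
    have h0 := (h.integrable_correlation 0)
    simp only [add_zero] at h0
    refine (h0.abs.const_mul (c ^ 2)).mono'
      ((ψ.continuous.mul hφ).pow 2).aestronglyMeasurable (.of_forall fun t => ?_)
    rw [Real.norm_of_nonneg (sq_nonneg _), ← sq_abs, sq]
    have := h.mul_le t t
    simp only [sub_self, abs_zero, add_zero, mul_one] at this
    gcongr
  set I := ∫ t, (ψ t * φ t) ^ 2
  have hI0 : 0 ≤ I := integral_nonneg fun t => sq_nonneg _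
  have hc := h.pos
  refine ⟨c ^ 4 + M * I, by positivity, fun σw σb hw hb y hy => ?_⟩
  have := isProbabilityMeasure_paramLaw hp hw hb
  have := isProbabilityMeasure_scaledLaw hp.weight hw
  have := isProbabilityMeasure_scaledLaw hp.bias hb
  have hsq := (memLp_nodeFn h hp hw hb hy hy).integrable_sq
  have hb1 : ∫ a, nodeFn φ ψ y y a ^ 2 ∂(paramLaw pw pb σw σb) ≤ c ^ 4 := by
    calc _ ≤ ∫ _, c ^ 4 ∂(paramLaw pw pb σw σb) := by
          refine integral_mono hsq (integrable_const _) fun a => ?_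
          have := h.mul_le (inner ℝ a.1 y + a.2) (inner ℝ a.1 y + a.2)
          simp only [sub_self, abs_zero, add_zero, mul_one] at this
          calc nodeFn φ ψ y y a ^ 2 = |nodeFn φ ψ y y a| ^ 2 := (sq_abs _).symm
            _ ≤ (c ^ 2) ^ 2 := by gcongr; exact this
            _ = c ^ 4 := by ring
      _ = c ^ 4 := by simp
  have hb2 : ∫ a, nodeFn φ ψ y y a ^ 2 ∂(paramLaw pw pb σw σb) ≤ M * I / σb := by
    rw [paramLaw_eq] at hsq ⊢
    rw [integral_prod _ hsq]
    have hin : ∀ w : EuclideanSpace ℝ (Fin d),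
        ∫ b, nodeFn φ ψ y y (w, b) ^ 2 ∂(scaledLaw σb pb) ≤ M * I / σb := by
      intro w
      rw [integral_scaledLaw_eq hp.bias hb]
      calc _ ≤ ∫ b, (M / σb) * (ψ (b + inner ℝ w y) * φ (b + inner ℝ w y)) ^ 2 := by
            refine integral_mono_of_nonneg (.of_forall fun b => ?_)
              ((hI.comp_add_right (inner ℝ w y)).const_mul _) (.of_forall fun b => ?_)
            · exact smul_nonneg (scaledDensity_nonneg hp.bias hb b) (sq_nonneg _)
            · simp only [nodeFn, smul_eq_mul, add_comm (inner ℝ w y : ℝ)]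
              gcongr
              simp only [scaledDensity, Module.finrank_self, pow_one, smul_eq_mul]
              rw [div_eq_inv_mul]
              gcongr
              exact hM _
        _ = _ := by
            rw [integral_const_mul, integral_add_right_eq_self
              (fun t => (ψ t * φ t) ^ 2) (inner ℝ w y)]
            ring
    calc _ ≤ ∫ _, M * I / σb ∂(scaledLaw σw pw) :=
          integral_mono hsq.integral_prod_left (integrable_const _) hin
      _ = _ := by simp
  rcases le_total 1 (1 / σb) with h1 | h1
  · rw [min_eq_left h1]
    have : 0 ≤ M * I := by positivity
    linarith
  · rw [min_eq_right h1]
    refine hb2.trans ?_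
    rw [mul_one_div]
    gcongr
    have : 0 ≤ c ^ 4 := by positivity
    linarith

lemma measure_le_of_integral_le {α : Type*} [MeasurableSpace α] {π : Measure α}
    [IsProbabilityMeasure π] {f : α → ℝ} (hf : ∀ a, 0 ≤ f a) (hi : Integrable f π) {e δ : ℝ}
    (he : 0 < e) (hδ : 0 < δ) (hfe : ∫ a, f a ∂π ≤ e) :
    π {a | 2 * e / δ ≤ f a} ≤ ENNReal.ofReal (δ / 2) := by
  have h1 := mul_meas_ge_le_integral_of_nonneg (.of_forall hf) hi (2 * e / δ)
  have h2 : π.real {a | 2 * e / δ ≤ f a} ≤ δ / 2 := by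
    have h3 := h1.trans hfe
    rw [← le_div_iff₀' (by positivity)] at h3
    refine h3.trans (le_of_eq ?_)
    field_simp
  exact (ENNReal.le_ofReal_iff_toReal_le (measure_ne_top _ _) (by positivity)).2 h2

/-- With high probability, the empirical means are uniformly close to their expectations. -/
lemma exists_good_event (h : ActBound φ ψ c) (hp : FiniteBandwidth pw pb) (hS : 0 < S)
    {𝒳 : Set (EuclideanSpace ℝ (Fin d))} (h𝒳 : 𝒳 ⊆ cube d S) {U : ℝ} (hU : 0 < U) :
    ∃ C : ℝ, 0 < C ∧ ∀ σw σb : ℝ, 0 < σw → 0 < σb → ∀ N : ℕ, 0 < N → ∀ δ : ℝ, 0 < δ →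
      ∀ (ι : Type) [Fintype ι] (u : ι → ℝ) (y : ι → EuclideanSpace ℝ (Fin d)),
        (∀ j, 0 ≤ u j) → ∑ j, u j ≤ U → (∀ j, y j ∈ cube d S) →
      ∃ G : Set (Fin N → EuclideanSpace ℝ (Fin d) × ℝ), MeasurableSet G ∧
        (Measure.pi fun _ => paramLaw pw pb σw σb) Gᶜ ≤ ENNReal.ofReal δ ∧
        ∀ θ ∈ G, ∀ x ∈ 𝒳, ∑ j, u j * |dev φ ψ (paramLaw pw pb σw σb) x (y j) θ| ≤
          C * √N * (σw / δ + √(min 1 (1 / σb)) / √δ) := by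
  obtain ⟨v, hv0, hv⟩ := exists_integral_nodeFn_sq_le (S := S) h hp
  -- The added 1 keeps `D`, and with it the Markov threshold, strictly positive.
  set D : ℝ := 8 * c ^ 2 * cubeRadius d S * √(∫ x, ‖x‖ ^ 2 * pw x) + 1
  have hρ : 0 ≤ cubeRadius d S := by unfold cubeRadius; positivity
  have hD : 0 < D := by positivity
  refine ⟨2 * U * D + U * √(2 * v), by positivity, ?_⟩
  intro σw σb hw hb N hN δ hδ ι _ u y hu hUu hy
  have hprob := isProbabilityMeasure_paramLaw hp hw hb
  set μ := paramLaw pw pb σw σb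
  set π : Measure (Fin N → EuclideanSpace ℝ (Fin d) × ℝ) := Measure.pi fun _ => μ
  have hN' : (0 : ℝ) < √N := Real.sqrt_pos.2 (by exact_mod_cast hN)
  rcases Set.eq_empty_or_nonempty 𝒳 with rfl | hne
  · exact ⟨Set.univ, MeasurableSet.univ, by simp, by simp⟩
  have : Nonempty 𝒳 := hne.to_subtype
  set s : ℕ → EuclideanSpace ℝ (Fin d) := fun k => TopologicalSpace.denseSeq 𝒳 k
  have hs : ∀ k, s k ∈ cube d S := fun k => h𝒳 (TopologicalSpace.denseSeq 𝒳 k).2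
  set e1 : ℝ := U * D * σw * √N
  have he1 : 0 < e1 := by positivity
  set f : ℕ → (Fin N → EuclideanSpace ℝ (Fin d) × ℝ) → ℝ := fun K θ =>
    ∑ j, u j * ‖fun k : Fin K => dev φ ψ μ (s k) (y j) θ - dev φ ψ μ (y j) (y j) θ‖
  have hfi : ∀ K, Integrable (f K) π := fun K => integrable_finsetSum _ fun j _ =>
    (integrable_norm_dev_sub h hp hw hb (hy j) (fun k : Fin K => hs k) N).const_mul _
  have hf0 : ∀ K θ, 0 ≤ f K θ := fun K θ =>
    Finset.sum_nonneg fun j _ => mul_nonneg (hu j) (norm_nonneg _)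
  have hfe : ∀ K, ∫ θ, f K θ ∂π ≤ e1 := fun K => by
    rw [integral_finsetSum _ fun j _ => (integrable_norm_dev_sub h hp hw hb (hy j)
      (fun k : Fin K => hs k) N).const_mul _]
    calc _ ≤ ∑ j, u j * (D * σw * √N) := by
          refine Finset.sum_le_sum fun j _ => ?_
          rw [integral_const_mul]
          refine mul_le_mul_of_nonneg_left ?_ (hu j)
          refine (integral_norm_dev_sub_le h hp hS hw hb (hy j) (fun k : Fin K => hs k) N).trans ?_
          gcongr
          simp [D]
      _ ≤ U * (D * σw * √N) := by rw [← Finset.sum_mul]; gcongr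
      _ = e1 := by ring
  set B1 : Set (Fin N → EuclideanSpace ℝ (Fin d) × ℝ) := ⋃ K, {θ | 2 * e1 / δ ≤ f K θ}
  -- The bad events increase with the number of points, so their union obeys the bound δ/2 common to
  -- all of them; no union bound over points is paid.
  have hmono : Monotone fun K => {θ | 2 * e1 / δ ≤ f K θ} := by
    intro K L hKL θ hθ
    refine le_trans (show 2 * e1 / δ ≤ f K θ from hθ) ?_
    refine Finset.sum_le_sum fun j _ => mul_le_mul_of_nonneg_left ?_ (hu j)
    refine (pi_norm_le_iff_of_nonneg (norm_nonneg _)).2 fun k => ?_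
    exact norm_le_pi_norm (fun k : Fin L => dev φ ψ μ (s k) (y j) θ - dev φ ψ μ (y j) (y j) θ)
      (Fin.castLE hKL k)
  have hB1 : π B1 ≤ ENNReal.ofReal (δ / 2) := by
    rw [hmono.measure_iUnion]
    exact iSup_le fun K => measure_le_of_integral_le (hf0 K) (hfi K) he1 hδ (hfe K)
  set V0 : (Fin N → EuclideanSpace ℝ (Fin d) × ℝ) → ℝ := fun θ =>
    ∑ j, u j * |dev φ ψ μ (y j) (y j) θ|
  set e2 : ℝ := U ^ 2 * (N * (v * min 1 (1 / σb)))
  have hmin : 0 < min 1 (1 / σb) := lt_min one_pos (by positivity)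
  have he2 : 0 < e2 := by positivity
  have hV0n : ∀ θ, 0 ≤ V0 θ := fun θ =>
    Finset.sum_nonneg fun j _ => mul_nonneg (hu j) (abs_nonneg _)
  have hV0i : Integrable (fun θ => V0 θ ^ 2) π :=
    (memLp_finsetSum _ fun j _ =>
      (memLp_dev h hp hw hb (hy j) (hy j) N).abs.const_mul (u j)).integrable_sq
  have hV0e : ∫ θ, V0 θ ^ 2 ∂π ≤ e2 := by
    have hi : ∀ j, Integrable (fun θ => dev φ ψ μ (y j) (y j) θ ^ 2) π := fun j =>
      (memLp_dev h hp hw hb (hy j) (hy j) N).integrable_sq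
    calc _ ≤ ∫ θ, U * ∑ j, u j * dev φ ψ μ (y j) (y j) θ ^ 2 ∂π := by
          refine integral_mono hV0i
            ((integrable_finsetSum _ fun j _ => (hi j).const_mul _).const_mul _) fun θ => ?_
          -- Cauchy–Schwarz with weights `u j` of total mass at most `U`, so that only the second
          -- moments of single nodes are needed.
          have cs := Finset.sum_mul_sq_le_sq_mul_sq Finset.univ (fun j => √(u j))
            (fun j => √(u j) * |dev φ ψ μ (y j) (y j) θ|)
          simp only [← mul_assoc, Real.mul_self_sqrt (hu _), mul_pow, Real.sq_sqrt (hu _),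
            sq_abs] at cs
          refine cs.trans ?_
          gcongr
          exact Finset.sum_nonneg fun j _ => mul_nonneg (hu j) (sq_nonneg _)
      _ = U * ∑ j, u j * ∫ θ, dev φ ψ μ (y j) (y j) θ ^ 2 ∂π := by
          rw [integral_const_mul, integral_finsetSum _ fun j _ => (hi j).const_mul _]
          simp only [integral_const_mul]
      _ ≤ U * ∑ j, u j * (N * (v * min 1 (1 / σb))) := by
          gcongr with j _
          · exact hu j
          · refine (integral_dev_sq_le h hp hw hb (hy j) (hy j) N).trans ?_
            gcongr
            exact hv σw σb hw hb (y j) (hy j)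
      _ ≤ U * (U * (N * (v * min 1 (1 / σb)))) := by
          rw [← Finset.sum_mul]
          gcongr
      _ = e2 := by ring
  set B2 : Set (Fin N → EuclideanSpace ℝ (Fin d) × ℝ) := {θ | 2 * e2 / δ ≤ V0 θ ^ 2}
  have hB2 : π B2 ≤ ENNReal.ofReal (δ / 2) :=
    measure_le_of_integral_le (fun θ => sq_nonneg (V0 θ)) hV0i he2 hδ hV0e
  have hfm : ∀ K, Measurable (f K) := fun K => Finset.measurable_sum _ fun j _ =>
    (Measurable.norm (measurable_pi_lambda _ fun k =>
      (measurable_dev h μ _ _).sub (measurable_dev h μ _ _))).const_mul _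
  have hV0m : Measurable V0 := Finset.measurable_sum _ fun j _ =>
    (measurable_dev h μ _ _).abs.const_mul _
  refine ⟨(B1 ∪ B2)ᶜ, ((MeasurableSet.iUnion fun K => measurableSet_le measurable_const
    (hfm K)).union (measurableSet_le measurable_const (hV0m.pow_const 2))).compl, ?_, ?_⟩
  · rw [compl_compl]
    refine (measure_union_le _ _).trans ((add_le_add hB1 hB2).trans (le_of_eq ?_))
    rw [← ENNReal.ofReal_add (by positivity) (by positivity), add_halves]
  · intro θ hθ
    simp only [Set.mem_compl_iff, Set.mem_union, not_or] at hθ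
    obtain ⟨hθ1, hθ2⟩ := hθ
    have hV : V0 θ ≤ √(2 * e2 / δ) := by
      refine Real.le_sqrt_of_sq_le (le_of_lt ?_)
      exact not_le.1 hθ2
    have hdense : ∀ k, ∑ j, u j * |dev φ ψ μ (s k) (y j) θ| ≤ 2 * e1 / δ + √(2 * e2 / δ) := by
      intro k
      -- The first k + 1 points are those with index at most `k`, so the `k`-th one is included.
      have h1 : f (k + 1) θ < 2 * e1 / δ := by
        rw [← not_le]
        exact fun hc => hθ1 (Set.mem_iUnion.2 ⟨k + 1, hc⟩)
      calc _ ≤ ∑ j, (u j * ‖fun k : Fin (k + 1) =>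
              dev φ ψ μ (s k) (y j) θ - dev φ ψ μ (y j) (y j) θ‖ +
            u j * |dev φ ψ μ (y j) (y j) θ|) := by
            refine Finset.sum_le_sum fun j _ => ?_
            rw [← mul_add]
            refine mul_le_mul_of_nonneg_left ?_ (hu j)
            have h2 := norm_le_pi_norm (fun k : Fin (k + 1) =>
              dev φ ψ μ (s k) (y j) θ - dev φ ψ μ (y j) (y j) θ) (Fin.last k)
            simp only [Fin.val_last, Real.norm_eq_abs] at h2
            have h3 := abs_sub_abs_le_abs_sub (dev φ ψ μ (s k) (y j) θ)
              (dev φ ψ μ (y j) (y j) θ)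
            linarith
        _ = f (k + 1) θ + V0 θ := Finset.sum_add_distrib
        _ ≤ _ := add_le_add h1.le hV
    have hcont : ContinuousOn (fun x => ∑ j, u j * |dev φ ψ μ x (y j) θ|) 𝒳 :=
      (continuousOn_finsetSum _ fun j _ => continuousOn_const.mul
        (continuousOn_dev h hp hw hb (hy j) θ).abs).mono h𝒳
    have hall : ∀ x ∈ 𝒳, ∑ j, u j * |dev φ ψ μ x (y j) θ| ≤ 2 * e1 / δ + √(2 * e2 / δ) :=
      fun x hx => hcont.le_of_denseSeq_le hdense hx
    intro x hx
    refine (hall x hx).trans ?_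
    have e2' : √(2 * e2 / δ) = U * √(2 * v) * √N * (√(min 1 (1 / σb)) / √δ) := by
      rw [show 2 * e2 / δ = U ^ 2 * (2 * v) * N * (min 1 (1 / σb) / δ) by simp only [e2]; ring,
        Real.sqrt_mul (by positivity), Real.sqrt_mul (by positivity),
        Real.sqrt_mul (by positivity), Real.sqrt_sq hU.le, Real.sqrt_div hmin.le]
    rw [e2']
    have t1 : 0 ≤ U * √(2 * v) * √N * (σw / δ) := by positivity
    have t2 : 0 ≤ 2 * U * D * √N * (√(min 1 (1 / σb)) / √δ) := by positivity
    have t3 : 2 * e1 / δ = 2 * U * D * √N * (σw / δ) := by simp only [e1]; ring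
    rw [t3]
    linarith

end MonteCarlo

end Ridgelet

namespace Ridgelet

/-! ### The mollifier -/

section Mollifier

variable {d : ℕ} {S : ℝ} {𝒳 : Set (EuclideanSpace ℝ (Fin d))} {χ : EuclideanSpace ℝ (Fin d) → ℝ}

lemma IsMollifier.hasCompactSupport (hχ : IsMollifier S 𝒳 χ) : HasCompactSupport χ :=
  HasCompactSupport.intro (isCompact_cube d S) hχ.eq_zero

lemma IsMollifier.exists_lipschitz (hχ : IsMollifier S 𝒳 χ) :
    ∃ L : ℝ, 0 ≤ L ∧ ∀ x y, |χ x - χ y| ≤ L * ‖x - y‖ := by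
  obtain ⟨L, hL⟩ := hχ.smooth.lipschitzWith_of_hasCompactSupport hχ.hasCompactSupport (by simp)
  exact ⟨L, L.2, fun x y => by simpa [Real.dist_eq, dist_eq_norm] using hL.dist_le_mul x y⟩

/-- On an upper face of the closed cube χ vanishes too, being a limit of its zero values just
outside. This matches the half-open cells of the left endpoint rule. -/
lemma IsMollifier.eq_zero_of_not_Ico (hχ : IsMollifier S 𝒳 χ) {x : EuclideanSpace ℝ (Fin d)}
    (h : ¬ ∀ i, x i ∈ Set.Ico (-S) S) : χ x = 0 := by
  by_cases hx : x ∈ cube d S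
  swap
  · exact hχ.eq_zero x hx
  push Not at h
  obtain ⟨i, hi⟩ := h
  have hxi : S ≤ x i := by
    by_contra hc
    exact hi ⟨(hx i).1, not_le.1 hc⟩
  set z : ℝ → EuclideanSpace ℝ (Fin d) := fun t => x + t • EuclideanSpace.single i 1
  have hz : Tendsto (fun t => χ (z t)) (𝓝[>] 0) (𝓝 (χ x)) := by
    have hc : Continuous fun t => χ (z t) := hχ.smooth.continuous.comp (by fun_prop)
    have := hc.tendsto 0
    simp only [z, zero_smul, add_zero] at this
    exact this.mono_left nhdsWithin_le_nhds
  refine tendsto_nhds_unique hz (tendsto_const_nhds.congr' ?_)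
  filter_upwards [self_mem_nhdsWithin] with t ht
  refine (hχ.eq_zero _ fun hc => ?_).symm
  have := (hc i).2
  simp only [z, PiLp.add_apply, PiLp.smul_apply, PiLp.single_apply, if_true,
    smul_eq_mul, mul_one] at this
  have ht' : 0 < t := ht
  linarith

variable {H : Type*} [NormedAddCommGroup H] [InnerProductSpace ℝ H] [CompleteSpace H]
  [RKHS ℝ H (EuclideanSpace ℝ (Fin d)) ℝ]
  {R : EuclideanSpace ℝ (Fin d) → EuclideanSpace ℝ (Fin d) → ℝ}

lemma norm_mollified_feat_le (hχ : IsMollifier S 𝒳 χ)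
    (hk : ∀ x y, RKHS.kernel H x y (1 : ℝ) = R x y) (hR : IsC11 R)
    (x : EuclideanSpace ℝ (Fin d)) : ‖χ x • feat H x‖ ≤ √(Mstar S R) := by
  by_cases hx : x ∈ cube d S
  · rw [norm_smul, Real.norm_of_nonneg (hχ.range x).1]
    exact (mul_le_of_le_one_left (norm_nonneg _) (hχ.range x).2).trans (norm_feat_le hk hR hx)
  · simp [hχ.eq_zero x hx]

/-- Features are controlled only inside the cube. If one point lies outside, χ vanishes there and
its Lipschitz bound alone suffices, so the estimate is global, as the approximate identity requires.
-/
lemma norm_mollified_feat_sub_le (hχ : IsMollifier S 𝒳 χ)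
    (hk : ∀ x y, RKHS.kernel H x y (1 : ℝ) = R x y) (hR : IsC11 R) {L : ℝ}
    (hL : ∀ x y, |χ x - χ y| ≤ L * ‖x - y‖) (x y : EuclideanSpace ℝ (Fin d)) :
    ‖χ x • feat H x - χ y • feat H y‖ ≤ (L + d) * √(Mstar S R) * ‖x - y‖ := by
  have hout : ∀ x y : EuclideanSpace ℝ (Fin d), y ∈ cube d S → x ∉ cube d S →
      ‖χ x • feat H x - χ y • feat H y‖ ≤ (L + d) * √(Mstar S R) * ‖x - y‖ := by
    intro x y hy hx
    have h0 := hχ.eq_zero x hx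
    have h1 := hL x y
    rw [h0, zero_sub, abs_neg] at h1
    rw [h0, zero_smul, zero_sub, norm_neg, norm_smul, Real.norm_eq_abs]
    calc _ ≤ (L * ‖x - y‖) * √(Mstar S R) :=
          mul_le_mul h1 (norm_feat_le hk hR hy) (norm_nonneg _) ((abs_nonneg _).trans h1)
      _ ≤ (L * ‖x - y‖) * √(Mstar S R) + d * √(Mstar S R) * ‖x - y‖ :=
          le_add_of_nonneg_right (by positivity)
      _ = _ := by ring
  by_cases hx : x ∈ cube d S
  · by_cases hy : y ∈ cube d S
    · have e : χ x • feat H x - χ y • feat H y =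
          χ x • (feat H x - feat H y) + (χ x - χ y) • feat H y := by
        rw [smul_sub, sub_smul]; abel
      rw [e]
      refine (norm_add_le _ _).trans ?_
      rw [norm_smul, norm_smul, Real.norm_of_nonneg (hχ.range x).1, Real.norm_eq_abs]
      have h1 : χ x * ‖feat H x - feat H y‖ ≤ d * √(Mstar S R) * ‖x - y‖ :=
        (mul_le_of_le_one_left (norm_nonneg _) (hχ.range x).2).trans (norm_feat_sub_le hk hR hx hy)
      have h2 : |χ x - χ y| * ‖feat H y‖ ≤ L * ‖x - y‖ * √(Mstar S R) :=
        mul_le_mul (hL x y) (norm_feat_le hk hR hy) (norm_nonneg _)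
          ((abs_nonneg _).trans (hL x y))
      linarith
    · rw [norm_sub_rev, norm_sub_rev x y]
      exact hout y x hx hy
  · by_cases hy : y ∈ cube d S
    · exact hout x y hy hx
    · rw [hχ.eq_zero x hx, hχ.eq_zero y hy, zero_smul, zero_smul, sub_zero, norm_zero]
      rcases eq_or_ne x y with rfl | hxy
      · simp
      · have : 0 ≤ L := nonneg_of_mul_nonneg_left ((abs_nonneg _).trans (hL x y))
          (norm_pos_iff.2 (sub_ne_zero.2 hxy))
        positivity

lemma continuous_mollified_feat (hχ : IsMollifier S 𝒳 χ)
    (hk : ∀ x y, RKHS.kernel H x y (1 : ℝ) = R x y) (hR : IsC11 R) :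
    Continuous fun x => χ x • feat H x :=
  hχ.smooth.continuous.smul (continuous_feat hk hR)

lemma integrable_mul_mollified_feat (hχ : IsMollifier S 𝒳 χ)
    (hk : ∀ x y, RKHS.kernel H x y (1 : ℝ) = R x y) (hR : IsC11 R)
    {a : EuclideanSpace ℝ (Fin d) → ℝ} (ha : Measurable a) {B : ℝ}
    (hB : ∀ y ∈ cube d S, |a y| ≤ B) :
    Integrable (fun y => a y • χ y • feat H y) ∧
      ‖∫ y, a y • χ y • feat H y‖ ≤ volume.real (cube d S) * (B * √(Mstar S R)) := by
  have hc := continuous_mollified_feat hχ hk hR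
  have hfin : volume (cube d S) < ⊤ := (isCompact_cube d S).measure_lt_top
  have hb : ∀ y ∈ cube d S, ‖a y • χ y • feat H y‖ ≤ B * √(Mstar S R) := fun y hy => by
    rw [norm_smul, Real.norm_eq_abs]
    exact mul_le_mul (hB y hy) (norm_mollified_feat_le hχ hk hR y) (norm_nonneg _)
      ((abs_nonneg _).trans (hB y hy))
  have h0 : ∀ y, y ∉ cube d S → a y • χ y • feat H y = 0 := fun y hy => by
    rw [hχ.eq_zero y hy, zero_smul, smul_zero]
  constructor
  · rw [← integrableOn_iff_integrable_of_support_subset (s := cube d S)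
      (Function.support_subset_iff'.2 h0)]
    exact IntegrableOn.of_bound hfin (ha.aestronglyMeasurable.smul hc.aestronglyMeasurable) _
      ((ae_restrict_iff' (isClosed_cube d S).measurableSet).2 (.of_forall hb))
  · rw [← setIntegral_eq_integral_of_forall_compl_eq_zero h0, mul_comm]
    exact norm_setIntegral_le_of_norm_le_const hfin hb

end Mollifier

/-! ### The rate -/

section Rate

lemma totalMass_eq {d : ℕ} (pw : EuclideanSpace ℝ (Fin d) → ℝ) (pb : ℝ → ℝ) (σw σb : ℝ) :
    totalMass pw pb σw σb = totalMass pw pb 1 1 * (σw ^ d * σb) := by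
  simp only [totalMass, one_pow, mul_one]
  ring

lemma totalMass_nonneg {d : ℕ} (pw : EuclideanSpace ℝ (Fin d) → ℝ) (pb : ℝ → ℝ) {σw σb : ℝ}
    (hw : 0 < σw) (hb : 0 < σb) : 0 ≤ totalMass pw pb σw σb := by
  have h1 : 0 ≤ ∫ ξ, ‖densHat pw ξ‖ := integral_nonneg fun _ => norm_nonneg _
  have h2 : 0 ≤ ∫ ξ, ‖densHat pb ξ‖ := integral_nonneg fun _ => norm_nonneg _
  unfold totalMass
  positivity

/-- The bias factors of `totalMass` are chosen to cancel the flattened bias density: its value at 0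
is given by Fourier inversion. What is left is the normalisation of the approximate identity. -/
lemma totalMass_mul_scaledDensity {d : ℕ} {pw : EuclideanSpace ℝ (Fin d) → ℝ} {pb : ℝ → ℝ}
    (hp : FiniteBandwidth pw pb) {σw σb : ℝ} (hb : 0 < σb) :
    totalMass pw pb σw σb * scaledDensity σb pb 0 = σw ^ d / ∫ ξ, ‖densHat pw ξ‖ := by
  have hc := hp.bias_differentiable.continuous
  have h1 := (integral_norm_densHat_pos hp.bias).ne'
  have hpi : (2 * Real.pi) ^ (1 / 2 : ℝ) * (2 * Real.pi) ^ (-(1 / 2) : ℝ) = 1 := by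
    rw [← Real.rpow_add (by positivity)]; norm_num
  simp only [scaledDensity, Module.finrank_self, pow_one, smul_zero, totalMass,
    density_zero_eq hp.bias hc]
  calc _ = ((2 * Real.pi) ^ (1 / 2 : ℝ) * (2 * Real.pi) ^ (-(1 / 2) : ℝ)) *
        (σb * σb⁻¹) * ((∫ ξ, ‖densHat pb ξ‖) * (∫ ξ, ‖densHat pb ξ‖)⁻¹) *
        (σw ^ d / ∫ ξ, ‖densHat pw ξ‖) := by
        rw [div_eq_mul_inv, mul_inv, div_eq_mul_inv]; ring
    _ = _ := by rw [hpi, mul_inv_cancel₀ hb.ne', mul_inv_cancel₀ h1]; ring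

/-- The diagonal fluctuation needs no term of its own. If s ≥ 1 it is below the last term, since an
extra power of s is free. If s ≤ 1 its square is at most the product of the two terms on the right,
using B² min(1, 1/B) ≤ B. -/
lemma monteCarlo_rate_le {d : ℕ} {s B δ : ℝ} (hs : 0 < s) (hB : 0 < B) (hδ : 0 < δ) (hδ1 : δ < 1)
    {N : ℕ} (hN : 0 < N) :
    s ^ d * B / √N * (√(min 1 (1 / B)) / √δ) ≤ 1 / s + B * s ^ (d + 1) / (δ * √N) := by
  have hN1 : (1 : ℝ) ≤ N := by exact_mod_cast hN
  have hsN : (1 : ℝ) ≤ √N := Real.one_le_sqrt.2 hN1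
  have hsδ : 0 < √δ := Real.sqrt_pos.2 hδ
  have hsδ1 : √δ ≤ 1 := Real.sqrt_le_one.2 hδ1.le
  have hsq : √δ * √δ = δ := Real.mul_self_sqrt hδ.le
  have hNq : √(N : ℝ) * √N = N := Real.mul_self_sqrt (by positivity)
  rcases le_total 1 s with h1 | h1
  · have e1 : √(min 1 (1 / B)) / √δ ≤ 1 / δ := by
      rw [div_le_div_iff₀ hsδ hδ, one_mul]
      have : √(min 1 (1 / B)) ≤ 1 := Real.sqrt_le_one.2 (min_le_left _ _)
      calc _ ≤ 1 * δ := by gcongr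
        _ ≤ √δ := by nlinarith
    calc _ ≤ s ^ (d + 1) * B / √N * (1 / δ) := by
          gcongr
          exact Nat.le_succ d
      _ = B * s ^ (d + 1) / (δ * √N) := by field_simp
      _ ≤ _ := le_add_of_nonneg_left (by positivity)
  · set T1 := 1 / s
    set T4 := B * s ^ (d + 1) / (δ * √N)
    have hT1 : 0 < T1 := by positivity
    have hT4 : 0 < T4 := by positivity
    refine (sq_le_sq₀ (by positivity) (by positivity)).1 ?_
    calc _ = (s ^ d) ^ 2 * (B ^ 2 * min 1 (1 / B)) / (N * δ) := by
          rw [mul_pow, div_pow, div_pow, Real.sq_sqrt (by positivity), Real.sq_sqrt (by positivity),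
            Real.sq_sqrt (by positivity), mul_pow, div_mul_div_comm]
          ring
      _ ≤ s ^ d * B / (√N * δ) := by
          have a1 : (s ^ d) ^ 2 ≤ s ^ d := pow_le_of_le_one (by positivity)
            (pow_le_one₀ hs.le h1) two_ne_zero
          have a2 : B ^ 2 * min 1 (1 / B) ≤ B := by
            calc _ ≤ B ^ 2 * (1 / B) := by gcongr; exact min_le_right _ _
              _ = B := by field_simp
          have a3 : √(N : ℝ) ≤ N := by nlinarith
          gcongr
      _ = T1 * T4 := by simp only [T1, T4, pow_succ]; field_simp
      _ ≤ _ := by nlinarith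

end Rate

end Ridgelet

namespace Ridgelet

/-! ### The approximation error of the features -/

section Residual

variable {d : ℕ} {φ : ℝ → ℝ} {φhat : ℝ → ℂ} {ψ : 𝓢(ℝ, ℝ)} {c : ℝ}
  {pw : EuclideanSpace ℝ (Fin d) → ℝ} {pb : ℝ → ℝ} {σw σb S : ℝ}
  {𝒳 : Set (EuclideanSpace ℝ (Fin d))} {χ : EuclideanSpace ℝ (Fin d) → ℝ}

lemma measurable_integral_nodeFn (h : ActBound φ ψ c) (hp : FiniteBandwidth pw pb) (hw : 0 < σw)
    (hb : 0 < σb) (x : EuclideanSpace ℝ (Fin d)) :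
    Measurable fun y => ∫ θ, nodeFn φ ψ x y θ ∂(paramLaw pw pb σw σb) := by
  have := isProbabilityMeasure_paramLaw hp hw hb
  have hφ := h.continuous
  have hc : Continuous fun z : EuclideanSpace ℝ (Fin d) × (EuclideanSpace ℝ (Fin d) × ℝ) =>
      nodeFn φ ψ x z.1 z.2 := by
    unfold nodeFn
    exact (ψ.continuous.comp (by fun_prop)).mul (hφ.comp (by fun_prop))
  exact hc.stronglyMeasurable.integral_prod_right'.measurable

lemma measurable_integral_corr (h : ActBound φ ψ c) (hp : IsBandwidthDensity pw) (hw : 0 < σw)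
    (x : EuclideanSpace ℝ (Fin d)) :
    Measurable fun y => ∫ w, corr φ ψ (inner ℝ w (x - y)) ∂(scaledLaw σw pw) := by
  have := isProbabilityMeasure_scaledLaw hp hw
  have hm : Measurable fun z : EuclideanSpace ℝ (Fin d) × EuclideanSpace ℝ (Fin d) =>
      corr φ ψ (inner ℝ z.2 (x - z.1)) := (measurable_corr h).comp (by fun_prop)
  exact hm.stronglyMeasurable.integral_prod_right'.measurable

variable {H : Type*} [NormedAddCommGroup H] [InnerProductSpace ℝ H] [CompleteSpace H]
  [RKHS ℝ H (EuclideanSpace ℝ (Fin d)) ℝ]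
  {R : EuclideanSpace ℝ (Fin d) → EuclideanSpace ℝ (Fin d) → ℝ}

/-- The error of the ridgelet reconstruction with finite bandwidths. -/
lemma norm_reconstruction_sub_feat_le (hφψ : IsActivationPair d φ φhat ψ) (h : ActBound φ ψ c)
    (hp : FiniteBandwidth pw pb) (hχ : IsMollifier S 𝒳 χ)
    (hk : ∀ x y, RKHS.kernel H x y (1 : ℝ) = R x y) (hR : IsC11 R) {L : ℝ}
    (hL : ∀ x y, |χ x - χ y| ≤ L * ‖x - y‖) (hw : 0 < σw) (hb : 0 < σb)
    {C₁ C₂ : ℝ} {x : EuclideanSpace ℝ (Fin d)}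
    (hC₁ : ∀ y ∈ cube d S, |∫ θ, nodeFn φ ψ x y θ ∂(paramLaw pw pb σw σb)| ≤ C₁)
    (hC₂ : ∀ y ∈ cube d S, |(∫ θ, nodeFn φ ψ x y θ ∂(paramLaw pw pb σw σb)) -
        scaledDensity σb pb 0 * ∫ w, corr φ ψ (inner ℝ w (x - y)) ∂(scaledLaw σw pw)| ≤ C₂) :
    ‖(∫ y, (totalMass pw pb σw σb * ∫ θ, nodeFn φ ψ x y θ ∂(paramLaw pw pb σw σb)) •
        χ y • feat H y) - χ x • feat H x‖ ≤
      bandwidthConst φhat ψ pw * ((L + d) * √(Mstar S R)) / σw +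
        volume.real (cube d S) * (totalMass pw pb σw σb * C₂ * √(Mstar S R)) := by
  set Z := totalMass pw pb σw σb
  have hZ : 0 ≤ Z := totalMass_nonneg pw pb hw hb
  set a : EuclideanSpace ℝ (Fin d) → ℝ := fun y =>
    Z * ∫ θ, nodeFn φ ψ x y θ ∂(paramLaw pw pb σw σb)
  set b : EuclideanSpace ℝ (Fin d) → ℝ := fun y =>
    σw ^ d / (∫ ξ, ‖densHat pw ξ‖) * ∫ w, corr φ ψ (inner ℝ w (x - y)) ∂(scaledLaw σw pw)
  have ham : Measurable a := (measurable_integral_nodeFn h hp hw hb x).const_mul _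
  have hbm : Measurable b := (measurable_integral_corr h hp.weight hw x).const_mul _
  have ha : ∀ y ∈ cube d S, |a y| ≤ Z * C₁ := fun y hy => by
    rw [abs_mul, abs_of_nonneg hZ]
    exact mul_le_mul_of_nonneg_left (hC₁ y hy) hZ
  have hab : ∀ y ∈ cube d S, |a y - b y| ≤ Z * C₂ := fun y hy => by
    have e : a y - b y = Z * ((∫ θ, nodeFn φ ψ x y θ ∂(paramLaw pw pb σw σb)) -
        scaledDensity σb pb 0 * ∫ w, corr φ ψ (inner ℝ w (x - y)) ∂(scaledLaw σw pw)) := by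
      simp only [a, b]
      rw [← totalMass_mul_scaledDensity hp hb (σw := σw)]
      ring
    rw [e, abs_mul, abs_of_nonneg hZ]
    exact mul_le_mul_of_nonneg_left (hC₂ y hy) hZ
  obtain ⟨hai, -⟩ := integrable_mul_mollified_feat (H := H) hχ hk hR ham ha
  obtain ⟨habi, habn⟩ := integrable_mul_mollified_feat (H := H) hχ hk hR (ham.sub hbm) hab
  have hbi : Integrable fun y => b y • χ y • feat H y := by
    refine (hai.sub habi).congr (.of_forall fun y => ?_)
    simp [sub_smul]
  have hm : Integrable fun ξ => ‖ξ‖ * ‖densHat pw ξ‖ := by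
    refine (hp.weight.fourier_integrable.norm.add hp.weight_fourier_moment).mono'
      (continuous_norm.aestronglyMeasurable.mul
        hp.weight.fourier_integrable.norm.aestronglyMeasurable) (.of_forall fun ξ => ?_)
    rw [Real.norm_of_nonneg (by positivity), Pi.add_apply]
    have : 0 ≤ ((1 - ‖ξ‖) ^ 2 + ‖ξ‖) * ‖densHat pw ξ‖ := by positivity
    linarith
  have hg : Integrable fun y => χ y • feat H y :=
    (continuous_mollified_feat hχ hk hR).integrable_of_hasCompactSupport
      hχ.hasCompactSupport.smul_right
  have key := norm_integral_corr_smul_sub_le hφψ hp.weight hm hw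
    (norm_mollified_feat_sub_le (H := H) hχ hk hR hL) hg x
  -- The exact kernel `a` is the approximate identity `b`, which carries the 1/σ_w error, plus the
  -- flattening error of the bias density.
  have e : (∫ y, a y • χ y • feat H y) - χ x • feat H x =
      ((∫ y, b y • χ y • feat H y) - χ x • feat H x) + ∫ y, (a y - b y) • χ y • feat H y := by
    simp only [sub_smul]
    rw [integral_sub hai hbi]
    abel
  rw [e]
  exact (norm_add_le _ _).trans (add_le_add key habn)

/-- The error of the cubature rule. -/
lemma norm_cubature_sub_reconstruction_le (h : ActBound φ ψ c)
    (hp : FiniteBandwidth pw pb) (hS : 0 < S) (hχ : IsMollifier S 𝒳 χ)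
    (hk : ∀ x y, RKHS.kernel H x y (1 : ℝ) = R x y) (hR : IsC11 R) {L : ℝ} (hL0 : 0 ≤ L)
    (hL : ∀ x y, |χ x - χ y| ≤ L * ‖x - y‖) (hw : 0 < σw) (hb : 0 < σb)
    {C : ℝ} (hC0 : 0 ≤ C) {x : EuclideanSpace ℝ (Fin d)}
    (hC : ∀ y ∈ cube d S, ∀ y' ∈ cube d S,
      |∫ θ, nodeFn φ ψ x y θ ∂(paramLaw pw pb σw σb)| ≤ C ∧
      |(∫ θ, nodeFn φ ψ x y θ ∂(paramLaw pw pb σw σb)) -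
        ∫ θ, nodeFn φ ψ x y' θ ∂(paramLaw pw pb σw σb)| ≤ C * ‖y - y'‖) {n : ℕ} (hn : 0 < n) :
    ‖(∑ j : Fin d → Fin n, (totalMass pw pb σw σb * gridWeight S n χ j *
        ∫ θ, nodeFn φ ψ x (gridNode S n j) θ ∂(paramLaw pw pb σw σb)) •
          feat H (gridNode S n j)) -
      ∫ y, (totalMass pw pb σw σb * ∫ θ, nodeFn φ ψ x y θ ∂(paramLaw pw pb σw σb)) •
        χ y • feat H y‖ ≤
      (2 * S) ^ d * (totalMass pw pb σw σb * C * (L + d + 1) * √(Mstar S R) *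
        (√d * (2 * S / n))) := by
  set Z := totalMass pw pb σw σb
  have hZ : 0 ≤ Z := totalMass_nonneg pw pb hw hb
  set a : EuclideanSpace ℝ (Fin d) → ℝ := fun y =>
    Z * ∫ θ, nodeFn φ ψ x y θ ∂(paramLaw pw pb σw σb)
  have ham : Measurable a := (measurable_integral_nodeFn h hp hw hb x).const_mul _
  have ha : ∀ y ∈ cube d S, |a y| ≤ Z * C := fun y hy => by
    rw [abs_mul, abs_of_nonneg hZ]
    exact mul_le_mul_of_nonneg_left (hC y hy y hy).1 hZ
  have haL : ∀ y ∈ cube d S, ∀ y' ∈ cube d S, |a y - a y'| ≤ Z * C * ‖y - y'‖ :=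
    fun y hy y' hy' => by
      rw [← mul_sub, abs_mul, abs_of_nonneg hZ, mul_assoc]
      exact mul_le_mul_of_nonneg_left (hC y hy y' hy').2 hZ
  obtain ⟨hai, -⟩ := integrable_mul_mollified_feat (H := H) hχ hk hR ham ha
  -- Lipschitz bound for a product: L + d comes from the mollified features and the additional 1
  -- from the kernel `a`.
  have key := norm_quadrature_sub_le hS hn (h := fun y => a y • χ y • feat H y)
    (Λ := Z * C * (L + d + 1) * √(Mstar S R)) (by positivity) hai (fun y hy y' hy' => by
      have e : a y • χ y • feat H y - a y' • χ y' • feat H y' =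
          a y • (χ y • feat H y - χ y' • feat H y') + (a y - a y') • χ y' • feat H y' := by
        rw [smul_sub, sub_smul]; abel
      rw [e]
      refine (norm_add_le _ _).trans ?_
      rw [norm_smul, norm_smul, Real.norm_eq_abs, Real.norm_eq_abs]
      have h1 := mul_le_mul (ha y hy) (norm_mollified_feat_sub_le (H := H) hχ hk hR hL y y')
        (norm_nonneg _) (by positivity)
      have h2 := mul_le_mul (haL y hy y' hy') (norm_mollified_feat_le (H := H) hχ hk hR y')
        (norm_nonneg _) (by positivity)
      linarith) (fun y hy => by
        simp only [hχ.eq_zero_of_not_Ico hy, zero_smul, smul_zero])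
  refine le_trans (le_of_eq ?_) key
  congr 2
  refine Finset.sum_congr rfl fun j _ => ?_
  simp only [smul_smul, gridWeight, a]
  congr 1
  ring

/-- The coefficient of `f (gridNode S n j)` in `ridgeletOp … f x`. -/
noncomputable def nodeCoeff (φ : ℝ → ℝ) (ψ : 𝓢(ℝ, ℝ)) (Z S : ℝ)
    (χ : EuclideanSpace ℝ (Fin d) → ℝ) {n N : ℕ} (θ : Fin N → EuclideanSpace ℝ (Fin d) × ℝ)
    (x : EuclideanSpace ℝ (Fin d)) (j : Fin d → Fin n) : ℝ :=
  ∑ i, Z * (N : ℝ)⁻¹ * (gridWeight S n χ j * nodeFn φ ψ x (gridNode S n j) (θ i))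

lemma ridgeletOp_eq {n N : ℕ} (θ : Fin N → EuclideanSpace ℝ (Fin d) × ℝ)
    (f : EuclideanSpace ℝ (Fin d) → ℝ) (x : EuclideanSpace ℝ (Fin d)) :
    ridgeletOp φ ψ pw pb S χ σw σb n N θ f x =
      ∑ j : Fin d → Fin n,
        nodeCoeff φ ψ (totalMass pw pb σw σb) S χ θ x j * f (gridNode S n j) := by
  simp only [ridgeletOp, nodeCoeff, nodeFn, Finset.mul_sum, Finset.sum_mul]
  rw [Finset.sum_comm]
  exact Finset.sum_congr rfl fun j _ => Finset.sum_congr rfl fun i _ => by ring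

variable (H) in
/-- The representer of `f ↦ f x - ridgeletOp … f x`. -/
noncomputable def residual (φ : ℝ → ℝ) (ψ : 𝓢(ℝ, ℝ)) (Z S : ℝ)
    (χ : EuclideanSpace ℝ (Fin d) → ℝ) (n : ℕ) {N : ℕ}
    (θ : Fin N → EuclideanSpace ℝ (Fin d) × ℝ) (x : EuclideanSpace ℝ (Fin d)) : H :=
  feat H x - ∑ j : Fin d → Fin n, nodeCoeff φ ψ Z S χ θ x j • feat H (gridNode S n j)

lemma gridWeight_nonneg (hS : 0 < S) (hχ : IsMollifier S 𝒳 χ) {n : ℕ} (j : Fin d → Fin n) :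
    0 ≤ gridWeight S n χ j :=
  mul_nonneg (by positivity) (hχ.range _).1

lemma sum_gridWeight_le (hS : 0 < S) (hχ : IsMollifier S 𝒳 χ) {n : ℕ} (hn : 0 < n) :
    ∑ j : Fin d → Fin n, gridWeight S n χ j ≤ (2 * S) ^ d := by
  calc _ ≤ ∑ _j : Fin d → Fin n, (2 * S) ^ d * (((n ^ d : ℕ) : ℝ))⁻¹ :=
        Finset.sum_le_sum fun j _ => mul_le_of_le_one_right (by positivity) (hχ.range _).2
    _ = _ := by
        rw [Finset.sum_const, Finset.card_univ, Fintype.card_fun, Fintype.card_fin,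
          Fintype.card_fin, nsmul_eq_mul]
        have : ((n ^ d : ℕ) : ℝ) ≠ 0 := by positivity
        field_simp

/-- The Monte Carlo error. -/
lemma norm_sampled_sub_cubature_le (hS : 0 < S) (hχ : IsMollifier S 𝒳 χ)
    (hk : ∀ x y, RKHS.kernel H x y (1 : ℝ) = R x y) (hR : IsC11 R) {Z : ℝ} (hZ : 0 ≤ Z)
    (μ : Measure (EuclideanSpace ℝ (Fin d) × ℝ)) {n N : ℕ} (hN : 0 < N)
    (θ : Fin N → EuclideanSpace ℝ (Fin d) × ℝ) (x : EuclideanSpace ℝ (Fin d)) :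
    ‖(∑ j : Fin d → Fin n, nodeCoeff φ ψ Z S χ θ x j • feat H (gridNode S n j)) -
      ∑ j : Fin d → Fin n, (Z * gridWeight S n χ j * ∫ a, nodeFn φ ψ x (gridNode S n j) a ∂μ) •
          feat H (gridNode S n j)‖ ≤
      Z * (N : ℝ)⁻¹ * (∑ j : Fin d → Fin n,
        gridWeight S n χ j * |dev φ ψ μ x (gridNode S n j) θ|) * √(Mstar S R) := by
  have hN' : (N : ℝ) ≠ 0 := by positivity
  rw [← Finset.sum_sub_distrib, Finset.mul_sum, Finset.sum_mul]
  refine (norm_sum_le _ _).trans (Finset.sum_le_sum fun j _ => ?_)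
  have e : nodeCoeff φ ψ Z S χ θ x j -
      Z * gridWeight S n χ j * ∫ a, nodeFn φ ψ x (gridNode S n j) a ∂μ =
      Z * (N : ℝ)⁻¹ * gridWeight S n χ j * dev φ ψ μ x (gridNode S n j) θ := by
    simp only [nodeCoeff, dev, Finset.sum_sub_distrib, Finset.sum_const, Finset.card_univ,
      Fintype.card_fin, nsmul_eq_mul, ← Finset.mul_sum]
    field_simp
  rw [← sub_smul, e, norm_smul, Real.norm_eq_abs, abs_mul,
    abs_of_nonneg (mul_nonneg (by positivity) (gridWeight_nonneg hS hχ j)),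
    ← mul_assoc (Z * (N : ℝ)⁻¹)]
  exact mul_le_mul_of_nonneg_left (norm_feat_le hk hR (gridNode_mem_cube hS j))
    (mul_nonneg (mul_nonneg (by positivity) (gridWeight_nonneg hS hχ j)) (abs_nonneg _))

end Residual

end Ridgelet

namespace Ridgelet

/-! ### Combining the four errors, and the conditional second moment -/

section Main

variable {d : ℕ} {φ : ℝ → ℝ} {φhat : ℝ → ℂ} {ψ : 𝓢(ℝ, ℝ)} {c : ℝ}
  {pw : EuclideanSpace ℝ (Fin d) → ℝ} {pb : ℝ → ℝ} {σw σb S : ℝ}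
  {𝒳 : Set (EuclideanSpace ℝ (Fin d))} {χ : EuclideanSpace ℝ (Fin d) → ℝ}

lemma rate_pow (hd : 0 < d) (σw σb δ : ℝ) (n N : ℕ) :
    rate d σw σb δ (n ^ d) N = 1 / σw + σw ^ d * (σw + 1) ^ 2 / σb +
      σb * (σb + 1) * σw ^ d * (σw + 1) ^ 2 / n + σb * σw ^ (d + 1) / (δ * √(N : ℝ)) := by
  rw [rate]
  congr 3
  push_cast
  rw [one_div, Real.pow_rpow_inv_natCast (by positivity) hd.ne']

/-- With high probability the residuals are small, uniformly in `x`. -/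
lemma exists_norm_residual_le (hd : 0 < d) (hφψ : IsActivationPair d φ φhat ψ)
    (hLip : ∃ L, LipschitzWith L φ) (hp : FiniteBandwidth pw pb) (hS : 0 < S)
    (h𝒳 : 𝒳 ⊆ cube d S) (hχ : IsMollifier S 𝒳 χ) :
    ∃ C : ℝ, 0 < C ∧ ∀ σw σb : ℝ, 0 < σw → 0 < σb → ∀ n N : ℕ, 0 < n → 0 < N →
      ∀ δ : ℝ, 0 < δ → δ < 1 →
      ∃ G : Set (Fin N → EuclideanSpace ℝ (Fin d) × ℝ), MeasurableSet G ∧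
        (Measure.pi fun _ => paramLaw pw pb σw σb) Gᶜ ≤ ENNReal.ofReal δ ∧
        ∀ (R : EuclideanSpace ℝ (Fin d) → EuclideanSpace ℝ (Fin d) → ℝ), IsC11 R →
        ∀ (H : Type*) [NormedAddCommGroup H] [InnerProductSpace ℝ H] [CompleteSpace H]
          [RKHS ℝ H (EuclideanSpace ℝ (Fin d)) ℝ],
        (∀ x y, RKHS.kernel H x y (1 : ℝ) = R x y) →
        ∀ θ ∈ G, ∀ x ∈ 𝒳, ‖residual H φ ψ (totalMass pw pb σw σb) S χ n θ x‖ ≤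
          C * √(Mstar S R) * rate d σw σb δ (n ^ d) N := by
  obtain ⟨c, h⟩ := exists_actBound hLip ψ
  obtain ⟨L, hL0, hL⟩ := hχ.exists_lipschitz
  obtain ⟨C₁, hC₁0, hC₁⟩ := exists_abs_integral_nodeFn_le h hp hS
  obtain ⟨C₂, hC₂0, hC₂⟩ := exists_abs_integral_nodeFn_sub_le h hp hS
  obtain ⟨C₃, hC₃0, hC₃⟩ := exists_good_event h hp hS h𝒳 (U := (2 * S) ^ d) (by positivity)
  set Z₁ := totalMass pw pb 1 1
  have hZ₁ : 0 ≤ Z₁ := totalMass_nonneg pw pb one_pos one_pos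
  set B := bandwidthConst φhat ψ pw
  have hB : 0 ≤ B := bandwidthConst_nonneg
  set v := volume.real (cube d S)
  have hv : 0 ≤ v := measureReal_nonneg
  set A₁ := B * (L + d)
  set A₂ := v * (Z₁ * C₂)
  set A₃ := (2 * S) ^ d * (Z₁ * C₁ * (L + d + 1) * (√d * (2 * S)))
  set A₄ := Z₁ * C₃
  have hA₁ : 0 ≤ A₁ := by positivity
  have hA₂ : 0 ≤ A₂ := by positivity
  have hA₃ : 0 ≤ A₃ := by positivity
  have hA₄ : 0 ≤ A₄ := by positivity
  refine ⟨A₁ + A₂ + A₃ + 2 * A₄ + 1, by positivity, ?_⟩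
  intro σw σb hw hb n N hn hN δ hδ hδ1
  -- The event concerns only scalar deviations of the parameters and is fixed before `R` and `H`;
  -- this keeps the constant and the event independent of the process.
  obtain ⟨G, hGm, hGp, hG⟩ := hC₃ σw σb hw hb N hN δ hδ (Fin d → Fin n) (gridWeight S n χ)
    (gridNode S n) (gridWeight_nonneg hS hχ) (sum_gridWeight_le hS hχ hn) (gridNode_mem_cube hS)
  refine ⟨G, hGm, hGp, ?_⟩
  intro R hR H _ _ _ _ hk θ hθ x hx
  have hZ : totalMass pw pb σw σb = Z₁ * (σw ^ d * σb) := totalMass_eq pw pb σw σb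
  have hZ0 := totalMass_nonneg pw pb hw hb
  have hxS := h𝒳 hx
  have e1 := norm_reconstruction_sub_feat_le (H := H) hφψ h hp hχ hk hR hL hw hb
    (fun y hy => (hC₁ σw σb hw hb x hxS y hy y hy).1) (hC₂ σw σb hw hb x hxS)
  have e2 := norm_cubature_sub_reconstruction_le (H := H) h hp hS hχ hk hR hL0 hL hw hb
    (C := C₁ * (σw + 1) ^ 2) (by positivity) (hC₁ σw σb hw hb x hxS) hn
  have e3 := norm_sampled_sub_cubature_le (H := H) hS hχ hk hR hZ0 (paramLaw pw pb σw σb) hN θ x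
    (φ := φ) (ψ := ψ) (n := n)
  rw [hχ.eq_one x hx, one_smul] at e1
  have e4 := hG θ hθ x hx
  set M := √(Mstar S R)
  have hM : 0 ≤ M := Real.sqrt_nonneg _
  set t₁ := 1 / σw
  set t₂ := σw ^ d * (σw + 1) ^ 2 / σb
  set t₃ := σb * (σb + 1) * σw ^ d * (σw + 1) ^ 2 / n
  set t₄ := σb * σw ^ (d + 1) / (δ * √(N : ℝ))
  have ht₁ : 0 ≤ t₁ := by positivity
  have ht₂ : 0 ≤ t₂ := by positivity
  have ht₃ : 0 ≤ t₃ := by positivity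
  have ht₄ : 0 ≤ t₄ := by positivity
  have hn' : (0 : ℝ) < n := by exact_mod_cast hn
  have hsN : 0 < √(N : ℝ) := Real.sqrt_pos.2 (by exact_mod_cast hN)
  have b1 : B * ((L + d) * M) / σw + v * (totalMass pw pb σw σb * (C₂ * (σw + 1) ^ 2 / σb ^ 2) * M)
      = (A₁ * t₁ + A₂ * t₂) * M := by
    rw [hZ]
    simp only [A₁, A₂, t₁, t₂]
    field_simp
  -- The cubature error carries only the factor σ_b; it is enlarged by σ_b + 1 ≥ 1 to fit the rate.
  have b2 : (2 * S) ^ d * (totalMass pw pb σw σb * (C₁ * (σw + 1) ^ 2) * (L + d + 1) * M *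
      (√d * (2 * S / n))) ≤ A₃ * t₃ * M := by
    have : (2 * S) ^ d * (totalMass pw pb σw σb * (C₁ * (σw + 1) ^ 2) * (L + d + 1) * M *
        (√d * (2 * S / n))) = A₃ * (σb * 1 * σw ^ d * (σw + 1) ^ 2 / n) * M := by
      rw [hZ]
      simp only [A₃]
      field_simp
    rw [this]
    have h1 : (1 : ℝ) ≤ σb + 1 := by linarith
    simp only [t₃]
    gcongr
  have b3 : totalMass pw pb σw σb * (N : ℝ)⁻¹ * (∑ j : Fin d → Fin n,
      gridWeight S n χ j * |dev φ ψ (paramLaw pw pb σw σb) x (gridNode S n j) θ|) * M ≤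
      (A₄ * (t₁ + 2 * t₄)) * M := by
    refine mul_le_mul_of_nonneg_right ?_ hM
    have hNN : (N : ℝ)⁻¹ * √N = 1 / √N := by
      have : (N : ℝ) = √N * √N := (Real.mul_self_sqrt (by positivity)).symm
      nth_rewrite 1 [this]
      field_simp
    calc _ ≤ totalMass pw pb σw σb * (N : ℝ)⁻¹ *
          (C₃ * √N * (σw / δ + √(min 1 (1 / σb)) / √δ)) := by gcongr
      _ = A₄ * (σw ^ d * σb * ((N : ℝ)⁻¹ * √N) * (σw / δ) +
          σw ^ d * σb * ((N : ℝ)⁻¹ * √N) * (√(min 1 (1 / σb)) / √δ)) := by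
          rw [hZ]; simp only [A₄]; ring
      _ = A₄ * (t₄ + σw ^ d * σb / √N * (√(min 1 (1 / σb)) / √δ)) := by
          rw [hNN]
          simp only [t₄, pow_succ]
          congr 2
          · field_simp
          · ring
      -- The increments contribute t₄ and the diagonal part t₁ + t₄.
      _ ≤ A₄ * (t₄ + (t₁ + t₄)) := by
          gcongr
          exact monteCarlo_rate_le hw hb hδ hδ1 hN
      _ = _ := by ring
  rw [rate_pow hd]
  set I := ∑ j : Fin d → Fin n,
    nodeCoeff φ ψ (totalMass pw pb σw σb) S χ θ x j • feat H (gridNode S n j)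
  have e5 : residual H φ ψ (totalMass pw pb σw σb) S χ n θ x = feat H x - I := rfl
  rw [e5, norm_sub_rev]
  refine (norm_sub_le_norm_sub_add_norm_sub _ _ _).trans ((add_le_add e3
    ((norm_sub_le_norm_sub_add_norm_sub _ _ _).trans (add_le_add e2 e1))).trans ?_)
  rw [b1]
  calc _ ≤ (A₄ * (t₁ + 2 * t₄)) * M + (A₃ * t₃ * M + (A₁ * t₁ + A₂ * t₂) * M) := by gcongr
    _ = (A₁ * t₁ + A₂ * t₂ + A₃ * t₃ + A₄ * t₁ + 2 * A₄ * t₄) * M := by ring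
    _ ≤ ((A₁ + A₂ + A₃ + 2 * A₄ + 1) * (t₁ + t₂ + t₃ + t₄)) * M := by
        gcongr
        have g1 : A₁ * t₁ ≤ A₁ * (t₁ + t₂ + t₃ + t₄) := by gcongr; linarith
        have g2 : A₂ * t₂ ≤ A₂ * (t₁ + t₂ + t₃ + t₄) := by gcongr; linarith
        have g3 : A₃ * t₃ ≤ A₃ * (t₁ + t₂ + t₃ + t₄) := by gcongr; linarith
        have g4 : A₄ * t₁ + 2 * A₄ * t₄ ≤ 2 * A₄ * (t₁ + t₂ + t₃ + t₄) := by
          have : 0 ≤ A₄ * (t₁ + 2 * t₂ + 2 * t₃) := by positivity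
          linarith
        have g5 : 0 ≤ t₁ + t₂ + t₃ + t₄ := by positivity
        linarith
    _ = _ := by ring

variable {H : Type*} [NormedAddCommGroup H] [InnerProductSpace ℝ H] [CompleteSpace H]
  [RKHS ℝ H (EuclideanSpace ℝ (Fin d)) ℝ]

lemma continuous_residual (h : ActBound φ ψ c)
    {R : EuclideanSpace ℝ (Fin d) → EuclideanSpace ℝ (Fin d) → ℝ}
    (hk : ∀ x y, RKHS.kernel H x y (1 : ℝ) = R x y) (hR : IsC11 R) (Z : ℝ) {n N : ℕ}
    (θ : Fin N → EuclideanSpace ℝ (Fin d) × ℝ) :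
    Continuous (residual H φ ψ Z S χ n θ) := by
  have hφ := h.continuous
  refine (continuous_feat hk hR).sub (continuous_finsetSum _ fun j _ =>
    Continuous.smul (continuous_finsetSum _ fun i _ => ?_) continuous_const)
  unfold nodeFn
  exact continuous_const.mul (continuous_const.mul (continuous_const.mul (hφ.comp (by fun_prop))))

variable [MeasurableSpace H] [BorelSpace H]
  {Ω : Type*} [MeasurableSpace Ω] {P : Measure Ω} [IsProbabilityMeasure P] {F : Ω → H}
  {m : EuclideanSpace ℝ (Fin d) → ℝ}
  {k : EuclideanSpace ℝ (Fin d) → EuclideanSpace ℝ (Fin d) → ℝ}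

lemma measurable_eval (x : EuclideanSpace ℝ (Fin d)) : Measurable fun f : H => f x := by
  have : Continuous fun f : H => inner ℝ f (feat H x) := by fun_prop
  simpa only [inner_feat] using this.measurable

/-- The conditional second moment of the error, given the weights and biases. -/
lemma integrable_sqErr_and_condExp (h : ActBound φ ψ c) (hp : FiniteBandwidth pw pb) (hS : 0 < S)
    (hw : 0 < σw) (hb : 0 < σb) {mH : H} (hm : ∀ x, mH x = m x) (hFm : Measurable F)
    (hF : IsGP P (fun x ω => F ω x) m k) {K : H →L[ℝ] H} (hK : IsCovOperator P F mH K) {n N : ℕ}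
    {θ : Fin N → Ω → EuclideanSpace ℝ (Fin d) × ℝ} (hθ : ∀ i, Measurable (θ i))
    (hlaw : ∀ i, P.map (θ i) = paramLaw pw pb σw σb) (hind : IndepFun F (fun ω i => θ i ω) P)
    {x : EuclideanSpace ℝ (Fin d)} (hx : x ∈ cube d S) :
    Integrable (fun ω => (F ω x - ridgeletOp φ ψ pw pb S χ σw σb n N (fun i => θ i ω) (F ω) x) ^ 2)
        P ∧
      P[fun ω => (F ω x - ridgeletOp φ ψ pw pb S χ σw σb n N (fun i => θ i ω) (F ω) x) ^ 2 |
        MeasurableSpace.comap (fun ω i => θ i ω) inferInstance] =ᵐ[P]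
        fun ω => secondMoment mH K
          (residual H φ ψ (totalMass pw pb σw σb) S χ n (fun i => θ i ω) x) := by
  set Z := totalMass pw pb σw σb
  -- The evaluation point joins the nodes as `none`, with coefficient 1, so that the error is a
  -- single finite combination of values of `F` with coefficients depending on the parameters.
  set X : Option (Fin d → Fin n) → EuclideanSpace ℝ (Fin d) := fun o => o.elim x (gridNode S n)
  set a : Option (Fin d → Fin n) → (Fin N → EuclideanSpace ℝ (Fin d) × ℝ) → ℝ := fun o t =>
    o.elim 1 fun j => -nodeCoeff φ ψ Z S χ t x j
  have ham : ∀ o, Measurable (a o) := by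
    rintro (_ | j)
    · exact measurable_const
    · refine Measurable.neg (Finset.measurable_sum _ fun i _ => Measurable.const_mul
        (Measurable.const_mul ?_ _) _)
      exact (continuous_nodeFn h _ _).measurable.comp (measurable_pi_apply i)
  have ha2 : ∀ o, MemLp (fun ω => a o fun i => θ i ω) 2 P := by
    rintro (_ | j)
    · exact memLp_const _
    · have hj : ∀ i, MemLp (fun ω => nodeFn φ ψ x (gridNode S n j) (θ i ω)) 2 P := fun i =>
        MemLp.comp_of_map (g := nodeFn φ ψ x (gridNode S n j))
          (hlaw i ▸ memLp_nodeFn h hp hw hb hx (gridNode_mem_cube hS j))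
          (hθ i).aemeasurable
      exact MemLp.neg (memLp_finsetSum _ fun i _ => ((hj i).const_mul _).const_mul _)
  obtain ⟨h1, h2⟩ := integrable_sq_sum_and_condExp (measurable_pi_lambda _ hθ) hFm hind a
    (fun o f => f (X o)) ham (fun o => measurable_eval (X o)) ha2 fun o => hF.memLp_two (X o)
  have e1 : ∀ ω, F ω x - ridgeletOp φ ψ pw pb S χ σw σb n N (fun i => θ i ω) (F ω) x =
      ∑ o, a o (fun i => θ i ω) * F ω (X o) := fun ω => by
    rw [ridgeletOp_eq, Fintype.sum_option, sub_eq_add_neg, ← Finset.sum_neg_distrib]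
    simp [a, X, Z]
  have e2 : ∀ t, residual H φ ψ Z S χ n t x = ∑ o, a o t • feat H (X o) := fun t => by
    rw [residual, Fintype.sum_option, sub_eq_add_neg, ← Finset.sum_neg_distrib]
    simp [a, X]
  simp only [e1]
  refine ⟨h1, h2.trans (.of_forall fun ω => ?_)⟩
  simp only [e2, secondMoment_sum, inner_feat, hF.integral_mul hm hK]

end Main

end Ridgelet

theorem mainTheorem4 {d : ℕ} (hd : 0 < d)
    (φ : ℝ → ℝ) (φhat : ℝ → ℂ) (ψ : 𝓢(ℝ, ℝ))
    (hφψ : Ridgelet.IsActivationPair d φ φhat ψ)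
    (hLip : ∃ L, LipschitzWith L φ)
    (pw : EuclideanSpace ℝ (Fin d) → ℝ) (pb : ℝ → ℝ)
    (hp : Ridgelet.FiniteBandwidth pw pb)
    (S : ℝ) (hS : 0 < S)
    (𝒳 : Set (EuclideanSpace ℝ (Fin d))) (h𝒳 : IsCompact 𝒳)
    (h𝒳S : 𝒳 ⊆ interior (Ridgelet.cube d S))
    (χ : EuclideanSpace ℝ (Fin d) → ℝ) (hχ : Ridgelet.IsMollifier S 𝒳 χ) :
    ∃ C : ℝ, 0 < C ∧
      ∀ (σw σb : ℝ), 0 < σw → 0 < σb →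
      ∀ (n N : ℕ), 0 < n → 0 < N →
      ∀ δ : ℝ, 0 < δ → δ < 1 →
      -- the mean and covariance functions
      ∀ (m : EuclideanSpace ℝ (Fin d) → ℝ)
        (k : EuclideanSpace ℝ (Fin d) → EuclideanSpace ℝ (Fin d) → ℝ),
      ContDiff ℝ 1 m → Ridgelet.IsC11 k → Ridgelet.IsSymmPosDef k →
      -- the reproducing kernel Hilbert space of `R`, which contains `m`
      ∀ (R : EuclideanSpace ℝ (Fin d) → EuclideanSpace ℝ (Fin d) → ℝ), Ridgelet.IsC11 R →
      ∀ (H : Type*) [NormedAddCommGroup H] [InnerProductSpace ℝ H] [CompleteSpace H]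
        [MeasurableSpace H] [BorelSpace H] [RKHS ℝ H (EuclideanSpace ℝ (Fin d)) ℝ],
      (∀ x y, RKHS.kernel H x y (1 : ℝ) = R x y) →
      ∀ mH : H, (∀ x, mH x = m x) →
      -- the Gaussian process, as a random element of `H`, and its covariance operator
      ∀ (Ω : Type*) [MeasurableSpace Ω] (P : Measure Ω) [IsProbabilityMeasure P]
        (F : Ω → H), Measurable F →
      Ridgelet.IsGP P (fun x ω => F ω x) m k →
      ∀ K : H →L[ℝ] H, Ridgelet.IsCovOperator P F mH K → Ridgelet.IsPosTraceClass K →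
      -- the weights and biases, i.i.d. and independent of the Gaussian process
      ∀ θ : Fin N → Ω → EuclideanSpace ℝ (Fin d) × ℝ,
      (∀ i, Measurable (θ i)) → (∀ i, P.map (θ i) = Ridgelet.paramLaw pw pb σw σb) →
      iIndepFun θ P → IndepFun F (fun ω i => θ i ω) P →
      -- the squared error
      ∀ sqErr : EuclideanSpace ℝ (Fin d) → Ω → ℝ,
      (∀ x ω, sqErr x ω = (F ω x -
        Ridgelet.ridgeletOp φ ψ pw pb S χ σw σb n N (fun i => θ i ω) (F ω) x) ^ 2) →
      -- its conditional expectation has a continuous version, for which the bound holds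
      (∀ x ∈ 𝒳, Integrable (sqErr x) P) ∧
      (∃ V, Ridgelet.IsContCondExp P (fun ω i => θ i ω) 𝒳 sqErr V) ∧
      ∀ V, Ridgelet.IsContCondExp P (fun ω i => θ i ω) 𝒳 sqErr V →
        ENNReal.ofReal (1 - δ) ≤
          P {ω | ∀ x ∈ 𝒳, √(V x ω) ≤
            C * √(Ridgelet.Mstar S R) * (‖mH‖ + √(Ridgelet.opTrace K)) *
              Ridgelet.rate d σw σb δ (n ^ d) N} := by
  have h𝒳c : 𝒳 ⊆ Ridgelet.cube d S := h𝒳S.trans interior_subset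
  obtain ⟨c, hc⟩ := Ridgelet.exists_actBound hLip ψ
  obtain ⟨C, hC0, hC⟩ := Ridgelet.exists_norm_residual_le hd hφψ hLip hp hS h𝒳c hχ
  refine ⟨C, hC0, ?_⟩
  intro σw σb hw hb n N hn hN δ hδ hδ1 m k _ _ _ R hR H _ _ _ _ _ _ hk mH hm Ω _ P _ F hFm hF K
    hK hKt θ hθ hlaw hiid hind sqErr hsq
  obtain ⟨G, hGm, hGp, hG⟩ := hC σw σb hw hb n N hn hN δ hδ hδ1
  have hsq' : ∀ x, sqErr x = fun ω => (F ω x -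
      Ridgelet.ridgeletOp φ ψ pw pb S χ σw σb n N (fun i => θ i ω) (F ω) x) ^ 2 :=
    fun x => funext (hsq x)
  have key := fun x (hx : x ∈ 𝒳) => Ridgelet.integrable_sqErr_and_condExp (χ := χ) (n := n) hc hp hS
    hw hb hm hFm hF hK hθ hlaw hind (h𝒳c hx)
  -- An explicit version of the conditional expectation: a continuous quadratic form evaluated at a
  -- residual that is continuous in `x`.
  set V₀ : EuclideanSpace ℝ (Fin d) → Ω → ℝ := fun x ω => Ridgelet.secondMoment mH K
    (Ridgelet.residual H φ ψ (Ridgelet.totalMass pw pb σw σb) S χ n (fun i => θ i ω) x)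
  have hV₀ : Ridgelet.IsContCondExp P (fun ω i => θ i ω) 𝒳 sqErr V₀ := by
    refine ⟨fun x hx => ?_, .of_forall fun ω => Continuous.continuousOn ?_⟩
    · rw [hsq' x]
      exact (key x hx).2.symm
    · have hr := Ridgelet.continuous_residual (H := H) (S := S) (χ := χ) (n := n) hc hk hR
        (Ridgelet.totalMass pw pb σw σb) fun i => θ i ω
      have hs : Continuous (Ridgelet.secondMoment mH K) := by
        unfold Ridgelet.secondMoment; fun_prop
      exact hs.comp hr
  refine ⟨fun x hx => ?_, ⟨V₀, hV₀⟩, fun V hV => ?_⟩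
  · rw [hsq' x]
    exact (key x hx).1
  have hθm : Measurable fun ω i => θ i ω := measurable_pi_lambda _ hθ
  -- Independence and the common law make the joint law a product measure, so the probability of `G`
  -- transfers to `P`.
  have hmap : P.map (fun ω i => θ i ω) =
      Measure.pi fun _ => Ridgelet.paramLaw pw pb σw σb := by
    rw [(iIndepFun_iff_map_fun_eq_pi_map fun i => (hθ i).aemeasurable).1 hiid]
    simp only [hlaw]
  have hPG : ENNReal.ofReal (1 - δ) ≤ P ((fun ω i => θ i ω) ⁻¹' G) := by
    have h1 : P ((fun ω i => θ i ω) ⁻¹' G)ᶜ ≤ ENNReal.ofReal δ := by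
      rw [← Set.preimage_compl, ← Measure.map_apply hθm hGm.compl, hmap]
      exact hGp
    rw [prob_compl_eq_one_sub (hθm hGm)] at h1
    rw [ENNReal.ofReal_sub _ hδ.le, ENNReal.ofReal_one]
    exact tsub_le_iff_tsub_le.1 h1
  -- An arbitrary continuous version agrees with `V₀` only almost surely, so the inclusion of events
  -- is needed up to a null set.
  refine hPG.trans (measure_mono_ae ?_)
  filter_upwards [hV.ae_eq hV₀] with ω hω hGω x hx
  rw [hω x hx]
  calc _ ≤ (‖mH‖ + √(Ridgelet.opTrace K)) * ‖Ridgelet.residual H φ ψ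
        (Ridgelet.totalMass pw pb σw σb) S χ n (fun i => θ i ω) x‖ :=
        Ridgelet.sqrt_secondMoment_le hKt _
    _ ≤ (‖mH‖ + √(Ridgelet.opTrace K)) * (C * √(Ridgelet.Mstar S R) *
        Ridgelet.rate d σw σb δ (n ^ d) N) := by
        gcongr
        exact hG R hR H hk _ hGω x hx
    _ = _ := by ring
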